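/- Let $M\ge 2$ be an integer, $m\in\mathbb N_0=\{0,1,2,\dots\}$, and let $a=\{a(k)\}_{k\in\mathbb Z}$ be a finitely supported complex sequence with $\sum_k a(k)=1$. **Notation.** $\delta(0)=1$ and $\delta(k)=0$ for $k\in\mathbb Z\setminus\{0\}$. For a finitely supported $u:\mathbb Z\to\mathbb C$, $\tilde u(z)=\sum_k u(k)z^k$. For $v:\mathbb Z\to\mathbb C$, $[S_a v](j)=M\sum_k v(k)a(j-Mk)$ and $[\nabla v](k)=v(k)-v(k-1)$, with $\nabla^0v=v$. Put $A_n=M^{-n}S_a^n\delta$ for $n\ge0$, and $[u*w](j)=\sum_k u(k)w(j-k)$. Let $\mathrm{sr}(a,M)$ be the largest $J\in\mathbb N_0$ such that $\tilde a(z)=(1+z+\cdots+z^{M-1})^J\,\tilde b(z)$ for some finitely supported $b$, and $$\mathrm{sm}_\infty(a,M)=-\log_M\limsup_{n\to\infty}\|\nabla^{J}S_a^n\delta\|_{\ell_\infty}^{1/n},\qquad J=\mathrm{sr}(a,M).$$ Let $\phi$ be the compactly supported distribution with $\hat\phi(\xi)=\prod_{j=1}^\infty\tilde a(e^{-iM^{-j}\xi})$,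 where $\hat f(\xi)=\int f(x)e^{-ix\xi}\,dx$. The $M$-subdivision scheme with mask $a$ is *$C^m$-convergent* if for every $v:\mathbb Z\to\mathbb C$ there is $\eta_v\in C^m(\mathbb R)$ (the limit function) such that for all $K>0$ and $j=0,\dots,m$, $$\lim_{n\to\infty}\ \max_{k\in\mathbb Z\cap[-M^nK,\,M^nK]}\bigl|M^{jn}[\nabla^jS_a^nv](k)-\eta_v^{(j)}(M^{-n}k)\bigr|=0 .$$ **Theorem.** Let $s_a\in\mathbb R$, $m_s\in\mathbb N_0$ and $n_s\in\{1,2,\dots\}$ satisfy $M^{m_s}(M^{n_s}-1)s_a\in\mathbb Z$. The following are equivalent: 1. $\phi\in C^m(\mathbb R)$ and $\phi(s_a+k)=\delta(k)$ for all $k\in\mathbb Z$. 2. $\mathrm{sm}_\infty(a,M)>m$, and there is a finitely supported $w:\mathbb Z\to\mathbb C$ such that for all $k\in\mathbb Z$ $$\text{(i)}\ \ [A_{m_s}*w](M^{m_s}k)=M^{-m_s}\delta(k),\qquad \text{(ii)}\ \ [A_{n_s}*w]\bigl(M^{m_s}(M^{n_s}-1)s_a+M^{n_s}k\bigr)=M^{-n_s}w(k).$$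 3. The subdivision scheme is $C^m$-convergent and $\infty$-step interpolatory, i.e. $\eta_v(s_a+k)=v(k)$ for all $k\in\mathbb Z$ and all $v:\mathbb Z\to\mathbb C$. Suppose $m_s=0$. Then $w=\delta$ is the unique finitely supported solution of (i), and the existence of a finitely supported $w$ with (i) and (ii) is equivalent to $$A_{n_s}\bigl((M^{n_s}-1)s_a+M^{n_s}k\bigr)=M^{-n_s}\delta(k)\qquad\text{for all }k\in\mathbb Z .$$ Moreover, if 3 holds, then the scheme is $n_s$-step interpolatory: for all $k\in\mathbb Z$ and $v:\mathbb Z\to\mathbb C$, $$[S_a^{n_s}v]\bigl((M^{n_s}-1)s_a+M^{n_s}k\bigr)=v(k),$$ and consequently, for all integers $q\ge0$, $$[S_a^{qn_s}v]\bigl((1+M^{n_s}+\cdots+M^{(q-1)n_s})(M^{n_s}-1)s_a+M^{qn_s}k\bigr)=v(k).$$ Finally (for every $m_s$), any one of 1–3 implies that for every integer $n\ge1$, every complex polynomial $p$ of degree less than $\mathrm{sr}(a,M)$ (the zero polynomial included) and every $k\in\mathbb Z$, $$[S_a^n p](k)=p\bigl(M^{-n}(s_a+k)-s_a\bigr),$$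 where on the left $p$ denotes the sequence $\{p(j)\}_{j\in\mathbb Z}$. -/

import Mathlib

open scoped SchwartzMap FourierTransform
open Filter Topology MeasureTheory

namespace SubdivisionScheme

noncomputable section

/-! Sequences on `ℤ` are functions `ℤ → ℂ`; finitely supported ones are elements of `ℤ →₀ ℂ`. -/

/-- The Dirac sequence: `1` at `0` and `0` elsewhere. -/
def dirac : ℤ → ℂ := fun k => if k = 0 then 1 else 0

/-- The symbol `∑ k, a k * z ^ k` of a finitely supported sequence (for `z ≠ 0`). -/
def symbol (a : ℤ →₀ ℂ) (z : ℂ) : ℂ := a.sum fun k c => c * z ^ k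

/-- The subdivision operator `[S v](j) = M * ∑ k, v k * a (j - M * k)`. For `M ≠ 0` only finitely
many terms of the series are nonzero. -/
def sd (M : ℕ) (a : ℤ →₀ ℂ) (v : ℤ → ℂ) : ℤ → ℂ :=
  fun j => (M : ℂ) * ∑' k : ℤ, v k * a (j - (M : ℤ) * k)

/-- The backward difference operator `[∇ v](k) = v k - v (k - 1)`. -/
def nabla (v : ℤ → ℂ) : ℤ → ℂ := fun k => v k - v (k - 1)

/-- The convolution `[u * v](j) = ∑ k, u k * v (j - k)`, used for finitely supported `u`, `v`. -/
def conv (u v : ℤ → ℂ) : ℤ → ℂ := fun j => ∑' k : ℤ, u k * v (j - k)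

/-- The iterated mask `A_n = M ^ (-n) * S ^ n δ`. -/
def iterMask (M : ℕ) (a : ℤ →₀ ℂ) (n : ℕ) : ℤ → ℂ :=
  fun k => ((M : ℂ) ^ n)⁻¹ * ((sd M a)^[n] dirac) k

/-- The mask `a` has order `J` sum rules with respect to `M`: its symbol is the product of
`(1 + z + ⋯ + z ^ (M - 1)) ^ J` and the symbol of a finitely supported sequence. -/
def HasSumRules (M : ℕ) (a : ℤ →₀ ℂ) (J : ℕ) : Prop :=
  ∃ b : ℤ →₀ ℂ, ∀ z : ℂ, z ≠ 0 →
    symbol a z = (∑ i ∈ Finset.range M, z ^ i) ^ J * symbol b z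

/-- The largest order of sum rules of `a` (for `M ≥ 2` and `a ≠ 0` the set is bounded, and it
always contains `0`). -/
def sr (M : ℕ) (a : ℤ →₀ ℂ) : ℕ := sSup {J : ℕ | HasSumRules M a J}

/-- The sup norm of a bounded sequence. -/
def supNorm (v : ℤ → ℂ) : ℝ := ⨆ k : ℤ, ‖v k‖

/-- `ρ_J(a, M)_∞ = limsup ‖∇ ^ J (S ^ n δ)‖_∞ ^ (1 / n)`; for `M ≥ 1` the sequence inside the
limsup is bounded. -/
def rhoInfty (M : ℕ) (a : ℤ →₀ ℂ) (J : ℕ) : ℝ :=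
  limsup (fun n : ℕ => supNorm (nabla^[J] ((sd M a)^[n] dirac)) ^ (1 / (n : ℝ))) atTop

/-- The smoothness exponent `sm_∞(a, M) = - log_M ρ_J(a, M)_∞` with `J = sr(a, M)`. -/
def smInfty (M : ℕ) (a : ℤ →₀ ℂ) : ℝ := - Real.logb M (rhoInfty M a (sr M a))

/-- `η` is the `C ^ m` limit function of the subdivision scheme with initial data `v`: it is of
class `C ^ m`, and for all `K > 0` and `j ≤ m` the maximum over the integers `k` in
`[-M ^ n * K, M ^ n * K]` of `|M ^ (j n) [∇ ^ j S ^ n v](k) - η^{(j)}(M ^ (-n) k)|` tends to `0`. -/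
def IsLimitFunction (M : ℕ) (a : ℤ →₀ ℂ) (m : ℕ) (v : ℤ → ℂ) (η : ℝ → ℂ) : Prop :=
  ContDiff ℝ m η ∧
    ∀ K : ℝ, 0 < K → ∀ j : ℕ, j ≤ m → ∀ ε : ℝ, 0 < ε → ∀ᶠ n : ℕ in atTop,
      ∀ k : ℤ, |(k : ℝ)| ≤ (M : ℝ) ^ n * K →
        ‖(M : ℂ) ^ (j * n) * (nabla^[j] ((sd M a)^[n] v)) k
          - iteratedDeriv j η ((k : ℝ) / (M : ℝ) ^ n)‖ < ε

/-- `C ^ m`-convergence of the subdivision scheme with mask `a`. -/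
def IsCmConvergent (M : ℕ) (a : ℤ →₀ ℂ) (m : ℕ) : Prop :=
  ∀ v : ℤ → ℂ, ∃ η : ℝ → ℂ, IsLimitFunction M a m v η

/-- The limit functions of the scheme take the values `η_v (s + k) = v k`. -/
def IsInftyStepInterpolatory (M : ℕ) (a : ℤ →₀ ℂ) (m : ℕ) (s : ℝ) : Prop :=
  ∀ (v : ℤ → ℂ) (η : ℝ → ℂ), IsLimitFunction M a m v η → ∀ k : ℤ, η (s + k) = v k

/-! ### The refinable distribution -/

/-- `φ̂(ξ) = ∏_{j ≥ 1} ã(exp(-i M ^ (-j) ξ))` (angular frequency). -/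
def phiHat (M : ℕ) (a : ℤ →₀ ℂ) (ξ : ℝ) : ℂ :=
  ∏' j : ℕ, symbol a (Complex.exp (-Complex.I * ((ξ / (M : ℝ) ^ (j + 1) : ℝ) : ℂ)))

/-- The mask on the unit circle. -/
def trigMask (a : ℤ →₀ ℂ) (θ : ℝ) : ℂ := symbol a (Complex.exp (-Complex.I * (θ : ℂ)))

theorem norm_trigMask_le (a : ℤ →₀ ℂ) (θ : ℝ) : ‖trigMask a θ‖ ≤ ∑ k ∈ a.support, ‖a k‖ := by
  unfold trigMask symbol Finsupp.sum
  refine (norm_sum_le _ _).trans (Finset.sum_le_sum fun k _ => ?_)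
  have h : ‖Complex.exp (-Complex.I * (θ : ℂ))‖ = 1 := by
    rw [Complex.norm_exp]; simp
  rw [norm_mul, norm_zpow, h, one_zpow, mul_one]

theorem norm_trigMask_sub_one_le (a : ℤ →₀ ℂ) (ha : (a.sum fun _ c => c) = 1) (θ : ℝ) :
    ‖trigMask a θ - 1‖ ≤ (∑ k ∈ a.support, ‖a k‖ * |(k : ℝ)|) * |θ| := by
  have h1 : trigMask a θ - 1
      = ∑ k ∈ a.support, a k * (Complex.exp (Complex.I * ((-(k * θ) : ℝ) : ℂ)) - 1) := by
    have ha' : ∑ k ∈ a.support, a k = 1 := ha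
    unfold trigMask symbol Finsupp.sum
    nth_rewrite 1 [← ha']
    rw [← Finset.sum_sub_distrib]
    refine Finset.sum_congr rfl fun k _ => ?_
    beta_reduce
    rw [← Complex.exp_int_mul, mul_sub, mul_one]
    congr 3
    push_cast
    ring
  rw [h1, Finset.sum_mul]
  refine (norm_sum_le _ _).trans (Finset.sum_le_sum fun k _ => ?_)
  rw [norm_mul, mul_assoc]
  refine mul_le_mul_of_nonneg_left ?_ (norm_nonneg _)
  refine (Real.norm_exp_I_mul_ofReal_sub_one_le).trans ?_
  rw [Real.norm_eq_abs, abs_neg, abs_mul]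

theorem continuous_trigMask (a : ℤ →₀ ℂ) : Continuous (trigMask a) := by
  unfold trigMask symbol Finsupp.sum
  refine continuous_finsetSum _ fun k _ => continuous_const.mul ?_
  refine Continuous.zpow₀ (by fun_prop) k fun θ => Or.inl (Complex.exp_ne_zero _)

theorem multipliable_phiHat {M : ℕ} (hM : 2 ≤ M) (a : ℤ →₀ ℂ) (ha : (a.sum fun _ c => c) = 1)
    (ξ : ℝ) : Multipliable fun j : ℕ => trigMask a (ξ / (M : ℝ) ^ (j + 1)) := by
  have hM' : (2 : ℝ) ≤ M := by exact_mod_cast hM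
  have hs : Summable fun j : ℕ => ‖trigMask a (ξ / (M : ℝ) ^ (j + 1)) - 1‖ := by
    have hg : Summable fun j : ℕ =>
        ((∑ k ∈ a.support, ‖a k‖ * |(k : ℝ)|) * (|ξ| / M)) * ((M : ℝ)⁻¹) ^ j :=
      (summable_geometric_of_lt_one (by positivity)
        (inv_lt_one_of_one_lt₀ (by linarith))).mul_left _
    refine Summable.of_nonneg_of_le (fun _ => norm_nonneg _) (fun j => ?_) hg
    refine (norm_trigMask_sub_one_le a ha _).trans (le_of_eq ?_)
    rw [abs_div, abs_of_nonneg (by positivity : (0 : ℝ) ≤ (M : ℝ) ^ (j + 1)), inv_pow, pow_succ]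
    field_simp
  simpa using multipliable_one_add_of_summable hs

theorem tendsto_phiHat {M : ℕ} (hM : 2 ≤ M) (a : ℤ →₀ ℂ) (ha : (a.sum fun _ c => c) = 1) (ξ : ℝ) :
    Tendsto (fun n : ℕ => ∏ j ∈ Finset.range n, trigMask a (ξ / (M : ℝ) ^ (j + 1))) atTop
      (𝓝 (phiHat M a ξ)) :=
  (multipliable_phiHat hM a ha ξ).hasProd.tendsto_prod_nat

theorem measurable_phiHat {M : ℕ} (hM : 2 ≤ M) (a : ℤ →₀ ℂ) (ha : (a.sum fun _ c => c) = 1) :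
    Measurable (phiHat M a) := by
  refine measurable_of_tendsto_metrizable (f := fun (n : ℕ) (ξ : ℝ) =>
    ∏ j ∈ Finset.range n, trigMask a (ξ / (M : ℝ) ^ (j + 1))) (fun n => ?_)
    (tendsto_pi_nhds.2 fun ξ => tendsto_phiHat hM a ha ξ)
  refine Continuous.measurable (continuous_finsetProd _ fun j _ => ?_)
  exact (continuous_trigMask a).comp (by fun_prop)

/-- The function `φ̂` has polynomial growth. -/
theorem exists_norm_phiHat_le {M : ℕ} (hM : 2 ≤ M) (a : ℤ →₀ ℂ)
    (ha : (a.sum fun _ c => c) = 1) :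
    ∃ (C : ℝ) (N : ℕ), 0 ≤ C ∧ ∀ ξ : ℝ, ‖phiHat M a ξ‖ ≤ C * (1 + |ξ|) ^ N := by
  have hM' : (2 : ℝ) ≤ M := by exact_mod_cast hM
  have hM0 : (0 : ℝ) < M := by linarith
  set A : ℝ := ∑ k ∈ a.support, ‖a k‖ with hA
  set L : ℝ := ∑ k ∈ a.support, ‖a k‖ * |(k : ℝ)| with hL
  have hL0 : 0 ≤ L := Finset.sum_nonneg fun _ _ => by positivity
  have hA0 : 0 ≤ A := Finset.sum_nonneg fun _ _ => norm_nonneg _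
  obtain ⟨N, hN⟩ := pow_unbounded_of_one_lt A (by norm_num : (1 : ℝ) < 3 / 2)
  have key : ∀ (n : ℕ) (ξ : ℝ), ‖∏ j ∈ Finset.range n, trigMask a (ξ / (M : ℝ) ^ (j + 1))‖
      ≤ Real.exp (L * M) * (1 + |ξ|) ^ N := by
    intro n
    induction n with
    | zero =>
      intro ξ
      have h1 : 1 ≤ Real.exp (L * M) := Real.one_le_exp (by positivity)
      have h2 : 1 ≤ (1 + |ξ|) ^ N := one_le_pow₀ (by linarith [abs_nonneg ξ])
      simpa using one_le_mul_of_one_le_of_one_le h1 h2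
    | succ n ih =>
      intro ξ
      rcases le_total |ξ| M with h | h
      · have h2 : 1 ≤ (1 + |ξ|) ^ N := one_le_pow₀ (by linarith [abs_nonneg ξ])
        refine le_trans ?_ (le_mul_of_one_le_right (Real.exp_pos _).le h2)
        have hgeo : ∑ j ∈ Finset.range (n + 1), ((M : ℝ)⁻¹) ^ (j + 1) ≤ 1 := by
          have hle : ∀ q : ℕ, ∑ j ∈ Finset.range q, ((M : ℝ)⁻¹) ^ (j + 1)
              ≤ 1 - (1 / 2) ^ q := by
            intro q
            induction q with
            | zero => simp
            | succ q ihq =>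
              rw [Finset.sum_range_succ]
              have : ((M : ℝ)⁻¹) ^ (q + 1) ≤ (1 / 2) ^ (q + 1) := by
                refine pow_le_pow_left₀ (by positivity) ?_ _
                rw [one_div]
                exact inv_anti₀ (by norm_num) hM'
              have h3 : ((1 : ℝ) / 2) ^ (q + 1) = (1 / 2) ^ q / 2 := by ring
              linarith
          have : (0 : ℝ) ≤ (1 / 2) ^ (n + 1) := by positivity
          linarith [hle (n + 1)]
        calc ‖∏ j ∈ Finset.range (n + 1), trigMask a (ξ / (M : ℝ) ^ (j + 1))‖
            = ∏ j ∈ Finset.range (n + 1), ‖trigMask a (ξ / (M : ℝ) ^ (j + 1))‖ := norm_prod _ _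
          _ ≤ ∏ j ∈ Finset.range (n + 1), Real.exp (L * M * ((M : ℝ)⁻¹) ^ (j + 1)) := by
              refine Finset.prod_le_prod (fun _ _ => norm_nonneg _) fun j _ => ?_
              have h3 := norm_trigMask_sub_one_le a ha (ξ / (M : ℝ) ^ (j + 1))
              have h4 : ‖trigMask a (ξ / (M : ℝ) ^ (j + 1))‖
                  ≤ ‖trigMask a (ξ / (M : ℝ) ^ (j + 1)) - 1‖ + 1 := by
                simpa using norm_add_le (trigMask a (ξ / (M : ℝ) ^ (j + 1)) - 1) 1
              have h5 : L * |ξ / (M : ℝ) ^ (j + 1)| ≤ L * M * ((M : ℝ)⁻¹) ^ (j + 1) := by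
                rw [abs_div, abs_of_nonneg (by positivity : (0 : ℝ) ≤ (M : ℝ) ^ (j + 1)),
                  inv_pow, div_eq_mul_inv, ← mul_assoc]
                gcongr
              have h6 := Real.add_one_le_exp (L * M * ((M : ℝ)⁻¹) ^ (j + 1))
              linarith
          _ = Real.exp (L * M * ∑ j ∈ Finset.range (n + 1), ((M : ℝ)⁻¹) ^ (j + 1)) := by
              rw [← Real.exp_sum, Finset.mul_sum]
          _ ≤ Real.exp (L * M) := by
              refine Real.exp_le_exp.2 (mul_le_of_le_one_right (by positivity) hgeo)
      · rw [Finset.prod_range_succ', norm_mul]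
        have h1 : ∏ j ∈ Finset.range n, trigMask a (ξ / (M : ℝ) ^ (j + 1 + 1))
            = ∏ j ∈ Finset.range n, trigMask a ((ξ / M) / (M : ℝ) ^ (j + 1)) := by
          refine Finset.prod_congr rfl fun j _ => ?_
          rw [div_div, pow_succ' (M : ℝ) (j + 1)]
        rw [h1]
        have h2 := ih (ξ / M)
        have h3 := norm_trigMask_le a (ξ / (M : ℝ) ^ (0 + 1))
        have h4 : (3 / 2) * (1 + |ξ / M|) ≤ 1 + |ξ| := by
          rw [abs_div, abs_of_pos hM0]
          have h5 : |ξ| / M ≤ |ξ| / 2 := div_le_div_of_nonneg_left (abs_nonneg _) (by norm_num) hM'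
          linarith
        calc _ ≤ Real.exp (L * M) * (1 + |ξ / M|) ^ N * A :=
              mul_le_mul h2 h3 (norm_nonneg _) (by positivity)
          _ ≤ Real.exp (L * M) * (1 + |ξ / M|) ^ N * (3 / 2) ^ N := by gcongr
          _ = Real.exp (L * M) * ((3 / 2) * (1 + |ξ / M|)) ^ N := by rw [mul_pow]; ring
          _ ≤ _ := by gcongr
  refine ⟨Real.exp (L * M), N, (Real.exp_pos _).le, fun ξ => ?_⟩
  exact le_of_tendsto ((tendsto_phiHat hM a ha ξ).norm) (Eventually.of_forall fun n => key n ξ)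

theorem exists_norm_phiHat_two_pi_le {M : ℕ} (hM : 2 ≤ M) (a : ℤ →₀ ℂ)
    (ha : (a.sum fun _ c => c) = 1) :
    ∃ (C : ℝ) (N : ℕ), 0 ≤ C ∧ ∀ x : ℝ, ‖phiHat M a (2 * Real.pi * x)‖ ≤ C * (1 + ‖x‖) ^ N := by
  obtain ⟨C, N, hC, h⟩ := exists_norm_phiHat_le hM a ha
  refine ⟨C * (2 * Real.pi) ^ N, N, by positivity, fun x => (h _).trans ?_⟩
  rw [mul_assoc C, ← mul_pow]
  have hpi : 1 ≤ 2 * Real.pi := by linarith [Real.pi_gt_three]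
  have : 1 + |2 * Real.pi * x| ≤ 2 * Real.pi * (1 + ‖x‖) := by
    rw [abs_mul, abs_of_pos (by positivity), Real.norm_eq_abs]
    linarith
  gcongr

theorem exists_schwartz_mul_phiHat_le {M : ℕ} (hM : 2 ≤ M) (a : ℤ →₀ ℂ)
    (ha : (a.sum fun _ c => c) = 1) :
    ∃ (s : Finset (ℕ × ℕ)) (C : ℝ), 0 ≤ C ∧ ∀ (g : 𝓢(ℝ, ℂ)) (x : ℝ),
      ‖g x * phiHat M a (2 * Real.pi * x)‖
        ≤ (C * s.sup (schwartzSeminormFamily ℂ ℝ ℂ) g) * (1 + ‖x‖) ^ (-2 : ℝ) := by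
  obtain ⟨C, N, hC, h⟩ := exists_norm_phiHat_two_pi_le hM a ha
  refine ⟨Finset.Iic (N + 2, 0), C * 2 ^ (N + 2), by positivity, fun g x => ?_⟩
  have h1 := SchwartzMap.one_add_le_sup_seminorm_apply (𝕜 := ℂ) (m := (N + 2, 0)) (k := N + 2)
    (n := 0) le_rfl le_rfl g x
  simp only [norm_iteratedFDeriv_zero] at h1
  have hx : (0 : ℝ) < 1 + ‖x‖ := by positivity
  rw [Real.rpow_neg hx.le, ← div_eq_mul_inv, le_div_iff₀ (by positivity), norm_mul,
    Real.rpow_two]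
  calc ‖g x‖ * ‖phiHat M a (2 * Real.pi * x)‖ * (1 + ‖x‖) ^ 2
      ≤ ‖g x‖ * (C * (1 + ‖x‖) ^ N) * (1 + ‖x‖) ^ 2 := by gcongr; exact h x
    _ = C * ((1 + ‖x‖) ^ (N + 2) * ‖g x‖) := by ring
    _ ≤ C * (2 ^ (N + 2) * (Finset.Iic (N + 2, 0)).sup (schwartzSeminormFamily ℂ ℝ ℂ) g) := by
        exact mul_le_mul_of_nonneg_left h1 hC
    _ = _ := by ring

theorem integrable_schwartz_mul_phiHat {M : ℕ} (hM : 2 ≤ M) (a : ℤ →₀ ℂ)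
    (ha : (a.sum fun _ c => c) = 1) (g : 𝓢(ℝ, ℂ)) :
    Integrable fun x : ℝ => g x * phiHat M a (2 * Real.pi * x) := by
  obtain ⟨s, C, hC, h⟩ := exists_schwartz_mul_phiHat_le hM a ha
  have hi : Integrable fun x : ℝ => (1 + ‖x‖) ^ (-2 : ℝ) :=
    integrable_one_add_norm (by simp)
  refine (hi.const_mul (C * s.sup (schwartzSeminormFamily ℂ ℝ ℂ) g)).mono' ?_
    (Eventually.of_forall fun x => h g x)
  exact (g.continuous.measurable.mul
    ((measurable_phiHat hM a ha).comp (measurable_const_mul _))).aestronglyMeasurable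

/-- The functional `g ↦ ∫ g x * φ̂(2 π x) dx` on Schwartz functions. -/
def phiHatCLM {M : ℕ} (hM : 2 ≤ M) (a : ℤ →₀ ℂ) (ha : (a.sum fun _ c => c) = 1) :
    𝓢(ℝ, ℂ) →L[ℂ] ℂ :=
  SchwartzMap.mkCLMtoNormedSpace (σ := RingHom.id ℂ)
    (fun g : 𝓢(ℝ, ℂ) => ∫ x : ℝ, g x * phiHat M a (2 * Real.pi * x))
    (fun f g => by
      rw [← integral_add (integrable_schwartz_mul_phiHat hM a ha f)
        (integrable_schwartz_mul_phiHat hM a ha g)]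
      simp [add_mul])
    (fun c f => by
      rw [RingHom.id_apply, smul_eq_mul, ← integral_const_mul]
      simp [mul_assoc])
    (by
      obtain ⟨s, C, hC, h⟩ := exists_schwartz_mul_phiHat_le hM a ha
      have hi : Integrable fun x : ℝ => (1 + ‖x‖) ^ (-2 : ℝ) :=
        integrable_one_add_norm (by simp)
      refine ⟨s, C * ∫ x : ℝ, (1 + ‖x‖) ^ (-2 : ℝ), ?_, fun g => ?_⟩
      · exact mul_nonneg hC (integral_nonneg fun x => by positivity)
      · refine (norm_integral_le_of_norm_le (hi.const_mul _)
          (Eventually.of_forall fun x => h g x)).trans (le_of_eq ?_)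
        rw [integral_const_mul]
        ring)

/-- The tempered distribution given by the function `x ↦ φ̂(2 π x)`. -/
def phiHatDistribution {M : ℕ} (hM : 2 ≤ M) (a : ℤ →₀ ℂ) (ha : (a.sum fun _ c => c) = 1) :
    𝓢'(ℝ, ℂ) :=
  ContinuousLinearMap.toPointwiseConvergenceCLM _ _ _ _ (phiHatCLM hM a ha)

/-- The `M`-refinable distribution `φ` with mask `a`, i.e. the tempered distribution whose Fourier
transform is the function `φ̂`. The Fourier transform of Mathlib is normalized by
`𝓕 f x = ∫ f(t) exp(-2 π i t x) dt`, so `𝓕 φ` is the function `x ↦ φ̂(2 π x)`. -/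
def phi {M : ℕ} (hM : 2 ≤ M) (a : ℤ →₀ ℂ) (ha : (a.sum fun _ c => c) = 1) : 𝓢'(ℝ, ℂ) :=
  𝓕⁻ (phiHatDistribution hM a ha)

theorem phi_apply {M : ℕ} (hM : 2 ≤ M) (a : ℤ →₀ ℂ) (ha : (a.sum fun _ c => c) = 1)
    (g : 𝓢(ℝ, ℂ)) :
    phi hM a ha g = ∫ x : ℝ, (𝓕⁻ g) x * phiHat M a (2 * Real.pi * x) := rfl

theorem fourier_phi {M : ℕ} (hM : 2 ≤ M) (a : ℤ →₀ ℂ) (ha : (a.sum fun _ c => c) = 1)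
    (g : 𝓢(ℝ, ℂ)) :
    𝓕 (phi hM a ha) g = ∫ x : ℝ, g x * phiHat M a (2 * Real.pi * x) := by
  unfold phi
  rw [FourierTransform.fourier_fourierInv_eq]
  rfl

/-- The distribution `T` agrees with the (locally integrable) function `f`, tested against all
compactly supported smooth functions. -/
def AgreesWith (T : 𝓢'(ℝ, ℂ)) (f : ℝ → ℂ) : Prop :=
  ∀ g : 𝓢(ℝ, ℂ), HasCompactSupport g → T g = ∫ x : ℝ, g x * f x

end

end SubdivisionScheme

open SubdivisionScheme

/-! Everything passes through one function `f`, the limit of the iterates `S^n δ` at the points `k /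
M^n`. When it exists, it is compactly supported and refinable, the limit function for data `v` is `∑
l, v l * f (· - l)`, and the distribution `φ` is `f`. Each of the three statements amounts to this:
`f` exists, is of class `C^m`, and `f (s + k) = δ k`.

1 and 3. If `φ` is a continuous function, the refinement equation holds pointwise. At `(s + j) /
M^n` the interpolation condition leaves a single term of it, so `[S^n δ](j) = f ((s + j) / M^n)`
exactly (`sd_iterate_dirac_eq`). Samples of a compactly supported `C^m` function have convergent
scaled differences (`isLimitFunction_of_sample`); no sum rules are needed. Conversely, the grid
means `M^(-n) ∑ k, [S^n δ](k) g (k / M^n)` tend to `⟨φ, g⟩` on the Fourier side and to `∫ g f` as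
Riemann sums (`IsLimitFunction.agreesWith`).

2 and 3, smoothness. Sum rules of order `J` mean `a = (nbox M)^[J] c`, and each box factor moves one
difference through the scheme, so the scaled differences of order `i ≤ J` are the iterates of
another scheme (`nabla_iterate_sd_iterate_nbox`). A bound on `ρ_J` below `M^(-m)` descends from
order `J` to the orders `≤ m` and gives convergence (`exists_isLimitFunction_dirac`). Conversely, a
nonzero `C^m` limit forces sum rules of order `m + 1` (`IsLimitFunction.exists_nbox_iterate`), and a
single iterate with small differences already contracts enough for the strict inequality
(`IsLimitFunction.rhoInfty_lt`).

2 and 3, interpolation. Condition (ii) says that `w` is fixed by a block of `ns` steps followed by a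
shift. Iterating it gives `w k = (∑ w) * f (M^ms * s + k)`; then (i) and the refinement equation
give `(∑ w) * f (s + k) = δ k`, and the partition of unity gives `∑ w = 1`. In the other direction
`w k = f (M^ms * s + k)` solves both.

Polynomials. On each grid `M^(-n) (s + ℤ)` the limit function for polynomial data is polynomial of
bounded degree, and on `s + ℤ` it has the expected values. Interpolating from points of fine grids
close to `s + i` shows that it has them everywhere (`eq_zero_of_polynomial_on_grids`). -/

namespace SubdivisionScheme

/-! ### Supports of iterates, and iterates as superpositions of translates of `S^n δ`. -/

section SequencesAndIterates

/-- The sequence `v` vanishes outside `[-L, L]`. -/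
def SupportedIn (L : ℤ) (v : ℤ → ℂ) : Prop := ∀ k : ℤ, L < |k| → v k = 0

namespace SupportedIn

variable {L : ℤ} {v : ℤ → ℂ}

theorem mono {L' : ℤ} (h : SupportedIn L v) (hL : L ≤ L') : SupportedIn L' v :=
  fun k hk => h k (hL.trans_lt hk)

theorem eq_zero_of_notMem (h : SupportedIn L v) {k : ℤ} (hk : k ∉ Finset.Icc (-L) L) :
    v k = 0 := by
  refine h k ?_
  rw [Finset.mem_Icc, ← abs_le] at hk
  exact not_le.1 hk

theorem tsum_eq (h : SupportedIn L v) : ∑' k, v k = ∑ k ∈ Finset.Icc (-L) L, v k :=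
  tsum_eq_sum fun _ hk => h.eq_zero_of_notMem hk

theorem finite_support (h : SupportedIn L v) : v.support.Finite :=
  (Finset.finite_toSet (Finset.Icc (-L) L)).subset fun k hk => by
    by_contra hk'
    exact hk (h.eq_zero_of_notMem hk')

theorem summable (h : SupportedIn L v) : Summable v :=
  summable_of_hasFiniteSupport h.finite_support

theorem mul_comp (h : SupportedIn L v) {N : ℤ} (hN : 1 ≤ N) (u : ℤ → ℂ) (j : ℤ) :
    SupportedIn (L + |j|) fun k => u k * v (j - N * k) := fun k hk => by
  beta_reduce
  rw [h _ ?_, mul_zero]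
  have h1 : |k| ≤ |N * k| := by
    rw [abs_mul]
    exact le_mul_of_one_le_left (abs_nonneg _) (hN.trans (le_abs_self _))
  have h2 := abs_sub_abs_le_abs_sub (N * k) j
  rw [abs_sub_comm] at h2
  linarith

end SupportedIn

theorem SupportedIn.nabla {L : ℤ} {v : ℤ → ℂ} (h : SupportedIn L v) :
    SupportedIn (L + 1) (SubdivisionScheme.nabla v) := fun k hk => by
  unfold SubdivisionScheme.nabla
  rw [h k (by grind), h (k - 1) (by grind), sub_zero]

theorem SupportedIn.nabla_iterate {L : ℤ} {v : ℤ → ℂ} (h : SupportedIn L v) (j : ℕ) :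
    SupportedIn (L + j) (SubdivisionScheme.nabla^[j] v) := by
  induction j with
  | zero => simpa using h
  | succ j ih =>
    rw [Function.iterate_succ_apply']
    exact ih.nabla.mono (by push_cast; lia)

theorem exists_supportedIn (a : ℤ →₀ ℂ) : ∃ R : ℕ, SupportedIn R a := by
  refine ⟨∑ k ∈ a.support, k.natAbs, fun k hk => ?_⟩
  by_contra h
  have := Finset.single_le_sum (f := fun k : ℤ => k.natAbs) (fun _ _ => Nat.zero_le _)
    (Finsupp.mem_support_iff.2 h)
  rw [Int.abs_eq_natAbs] at hk
  lia

theorem supportedIn_dirac : SupportedIn 0 dirac := fun k hk => by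
  simp [dirac, abs_pos.1 hk]

theorem summable_mul_comp {L : ℤ} {u : ℤ → ℂ} (h : SupportedIn L u) {N : ℤ} (hN : 1 ≤ N)
    (v : ℤ → ℂ) (j : ℤ) : Summable fun k => v k * u (j - N * k) :=
  (h.mul_comp hN v j).summable

section Iterate

variable {M : ℕ} (hM : 2 ≤ M) (a : ℤ →₀ ℂ)

include hM in
theorem one_le_natCast_pow (n : ℕ) : (1 : ℤ) ≤ (M : ℤ) ^ n :=
  one_le_pow₀ (by lia)

include hM in
theorem SupportedIn.sd {R : ℤ} {a : ℤ →₀ ℂ} (ha : SupportedIn R a) {L : ℤ} {v : ℤ → ℂ}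
    (hv : SupportedIn L v) : SupportedIn (R + M * L) (sd M a v) := fun j hj => by
  unfold SubdivisionScheme.sd
  have : ∀ k, v k * a (j - M * k) = 0 := fun k => by
    rcases lt_or_ge L |k| with h | h
    · rw [hv k h, zero_mul]
    · rw [ha, mul_zero]
      have h1 : |(M : ℤ) * k| ≤ M * L := by
        rw [abs_mul, Nat.abs_cast]
        exact mul_le_mul_of_nonneg_left h (by lia)
      have h2 := abs_sub_abs_le_abs_sub j (M * k)
      linarith
  simp [this]

include hM in
theorem SupportedIn.sd_iterate {R : ℤ} {a : ℤ →₀ ℂ} (hR : 0 ≤ R) (ha : SupportedIn R a) {L : ℤ}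
    {v : ℤ → ℂ} (hv : SupportedIn L v) (n : ℕ) :
    SupportedIn ((R + L) * M ^ n) ((SubdivisionScheme.sd M a)^[n] v) := by
  -- The radius is lowered by `R` to close the induction: one step sends a radius `r` to `R + M *
  -- r`, and `2 * R ≤ M * R`.
  have key : SupportedIn ((R + L) * M ^ n - R) ((SubdivisionScheme.sd M a)^[n] v) := by
    induction n with
    | zero => simpa using hv
    | succ n ih =>
      rw [Function.iterate_succ_apply']
      refine (ha.sd hM ih).mono ?_
      rw [pow_succ]
      have : (2 : ℤ) ≤ M := by exact_mod_cast hM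
      nlinarith
  exact key.mono (by linarith)

include hM in
theorem exists_supportedIn_sd_iterate {L : ℤ} {v : ℤ → ℂ} (hv : SupportedIn L v) (n : ℕ) :
    ∃ L', SupportedIn L' ((sd M a)^[n] v) := by
  obtain ⟨R, hR⟩ := exists_supportedIn a
  exact ⟨_, hR.sd_iterate hM (by lia) hv n⟩

theorem sd_dirac : sd M a dirac = fun j => (M : ℂ) * a j := by
  funext j
  unfold sd
  rw [tsum_eq_single 0 fun k hk => by simp [dirac, hk]]
  simp [dirac]

include hM in
/-- `S ^ n v` is the superposition of the translates of `S ^ n δ` by multiples of `M ^ n`. -/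
theorem sd_iterate_apply (n : ℕ) (v : ℤ → ℂ) (j : ℤ) :
    (sd M a)^[n] v j = ∑' k : ℤ, v k * (sd M a)^[n] dirac (j - (M : ℤ) ^ n * k) := by
  obtain ⟨R, hR⟩ := exists_supportedIn a
  induction n generalizing v j with
  | zero =>
    rw [tsum_eq_single j fun k hk => by simp [dirac, sub_eq_zero, hk.symm]]
    simp [dirac]
  | succ n ih =>
    have hM1 : (1 : ℤ) ≤ M := by lia
    rw [Function.iterate_succ_apply, ih]
    obtain ⟨L, hL⟩ := exists_supportedIn_sd_iterate hM a supportedIn_dirac n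
    set u := (sd M a)^[n] dirac
    have hu : ∀ l : ℤ, (sd M a)^[n + 1] dirac (j - (M : ℤ) ^ (n + 1) * l)
        = ∑' k : ℤ, (M : ℂ) * a (k - M * l) * u (j - (M : ℤ) ^ n * k) := fun l => by
      rw [Function.iterate_succ_apply, sd_dirac, ih, ← (Equiv.subRight ((M : ℤ) * l)).tsum_eq]
      refine tsum_congr fun k => ?_
      simp only [Equiv.subRight_apply, u]
      exact congrArg _ (congrArg _ (by ring))
    simp_rw [hu, sd, ← tsum_mul_left, ← tsum_mul_right]
    -- Needed to exchange the two sums: `j` bounds `p.1` through `u`, and `p.1` bounds `p.2` through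
    -- `a`, so the double family has finite support.
    have hs : Summable fun p : ℤ × ℤ =>
        (M : ℂ) * (v p.2 * a (p.1 - M * p.2)) * u (j - (M : ℤ) ^ n * p.1) := by
      refine summable_of_hasFiniteSupport (Set.Finite.subset (Finset.finite_toSet
        (Finset.Icc (-(L + |j|)) (L + |j|) ×ˢ
          Finset.Icc (-(R + (L + |j|))) (R + (L + |j|)))) fun p hp => ?_)
      have hp' : (M : ℂ) * (v p.2 * a (p.1 - M * p.2)) * u (j - (M : ℤ) ^ n * p.1) ≠ 0 := hp
      have h1 : p.1 ∈ Finset.Icc (-(L + |j|)) (L + |j|) := by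
        by_contra h
        exact hp' ((hL.mul_comp (one_le_natCast_pow hM n)
          (fun k => (M : ℂ) * (v p.2 * a (k - M * p.2))) j).eq_zero_of_notMem h)
      have h3 : |p.1| ≤ L + |j| := abs_le.2 (Finset.mem_Icc.1 h1)
      have h2 : p.2 ∈ Finset.Icc (-(R + (L + |j|))) (R + (L + |j|)) := by
        by_contra h
        have := ((hR.mul_comp hM1 v p.1).mono (add_le_add_right h3 _)).eq_zero_of_notMem h
        beta_reduce at this
        exact hp' (by rw [this]; simp)
      exact Finset.mem_coe.2 (Finset.mem_product.2 ⟨h1, h2⟩)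
    refine (Summable.tsum_comm (f := fun k l =>
        (M : ℂ) * (v l * a (k - M * l)) * u (j - (M : ℤ) ^ n * k)) hs).symm.trans ?_
    refine tsum_congr fun l => tsum_congr fun k => ?_
    ring

theorem nabla_apply (v : ℤ → ℂ) (k : ℤ) : nabla v k = v k - v (k - 1) := rfl

theorem nabla_superposition {L : ℤ} {u : ℤ → ℂ} (hu : SupportedIn L u)
    {N : ℤ} (hN : 1 ≤ N) (v : ℤ → ℂ) (i : ℕ) (j : ℤ) :
    nabla^[i] (fun j => ∑' k : ℤ, v k * u (j - N * k)) j
      = ∑' k : ℤ, v k * nabla^[i] u (j - N * k) := by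
  induction i generalizing j with
  | zero => rfl
  | succ i ih =>
    rw [Function.iterate_succ_apply', Function.iterate_succ_apply', nabla_apply,
      ih, ih, ← (summable_mul_comp (hu.nabla_iterate i) hN v j).tsum_sub
      (summable_mul_comp (hu.nabla_iterate i) hN v (j - 1))]
    refine tsum_congr fun k => ?_
    rw [nabla_apply, sub_right_comm, mul_sub]

include hM in
theorem nabla_iterate_sd_iterate_apply (i n : ℕ) (v : ℤ → ℂ) (j : ℤ) :
    nabla^[i] ((sd M a)^[n] v) j
      = ∑' k : ℤ, v k * nabla^[i] ((sd M a)^[n] dirac) (j - (M : ℤ) ^ n * k) := by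
  obtain ⟨L, hL⟩ := exists_supportedIn_sd_iterate hM a supportedIn_dirac n
  rw [← nabla_superposition hL (one_le_natCast_pow hM n)]
  exact congrArg (fun w => nabla^[i] w j) (funext fun j => sd_iterate_apply hM a n v j)

include hM in
/-- `S ^ n` turns the difference `∇` into the difference with step `M ^ n`. -/
theorem sd_iterate_nabla (n : ℕ) (v : ℤ → ℂ) (j : ℤ) :
    (sd M a)^[n] (nabla v) j = (sd M a)^[n] v j - (sd M a)^[n] v (j - (M : ℤ) ^ n) := by
  obtain ⟨L, hL⟩ := exists_supportedIn_sd_iterate hM a supportedIn_dirac n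
  have hN := one_le_natCast_pow hM n
  have h1 : (sd M a)^[n] v (j - (M : ℤ) ^ n)
      = ∑' k : ℤ, v (k - 1) * (sd M a)^[n] dirac (j - (M : ℤ) ^ n * k) := by
    rw [sd_iterate_apply hM, ← (Equiv.subRight (1 : ℤ)).tsum_eq]
    refine tsum_congr fun k => ?_
    simp only [Equiv.subRight_apply]
    exact congrArg _ (congrArg _ (by ring))
  rw [h1, sd_iterate_apply hM, sd_iterate_apply hM a n v,
    ← (summable_mul_comp hL hN v j).tsum_sub (summable_mul_comp hL hN (fun k => v (k - 1)) j)]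
  refine tsum_congr fun k => ?_
  rw [nabla, sub_mul]

end Iterate

end SequencesAndIterates

/-! ### Sum rules as box factors, and their interplay with differences. -/

section BoxFactors

theorem tsum_coe_eq_sum (a : ℤ →₀ ℂ) : ∑' k, a k = a.sum fun _ c => c :=
  tsum_eq_sum fun k hk => by simpa using hk

theorem symbol_eq_tsum (a : ℤ →₀ ℂ) (z : ℂ) : symbol a z = ∑' k : ℤ, a k * z ^ k :=
  (tsum_eq_sum fun k hk => by simp [Finsupp.notMem_support_iff.1 hk]).symm

theorem symbol_one (a : ℤ →₀ ℂ) : symbol a 1 = a.sum fun _ c => c := by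
  simp [symbol]

theorem SupportedIn.mul_right {L : ℤ} {v : ℤ → ℂ} (h : SupportedIn L v) (u : ℤ → ℂ) :
    SupportedIn L fun k => v k * u k := fun k hk => by
  beta_reduce
  rw [h k hk, zero_mul]

theorem symbol_sub (a b : ℤ →₀ ℂ) (z : ℂ) : symbol (a - b) z = symbol a z - symbol b z :=
  Finsupp.sum_sub_index fun _ _ _ => sub_mul _ _ _

theorem symbol_smul (r : ℂ) (a : ℤ →₀ ℂ) (z : ℂ) : symbol (r • a) z = r * symbol a z := by
  unfold symbol
  rw [Finsupp.sum_smul_index (fun _ => zero_mul _), Finsupp.mul_sum]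
  simp_rw [mul_assoc]

/-- Multiplied by `z ^ R`, the symbol is a polynomial that vanishes at every nonzero point, hence is
the zero polynomial. -/
theorem eq_zero_of_symbol_eq_zero {a : ℤ →₀ ℂ} (h : ∀ z : ℂ, z ≠ 0 → symbol a z = 0) : a = 0 := by
  obtain ⟨R, hR⟩ := exists_supportedIn a
  set p : Polynomial ℂ :=
    ∑ i ∈ Finset.range (2 * R + 1), Polynomial.monomial i (a ((i : ℤ) - R)) with hp
  have heval : ∀ z : ℂ, z ≠ 0 → p.eval z = z ^ R * symbol a z := fun z hz => by
    rw [symbol_eq_tsum, (hR.mul_right _).tsum_eq, hp, Polynomial.eval_finsetSum, Finset.mul_sum]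
    refine Finset.sum_bij (fun i _ => (i : ℤ) - R) (fun i hi => ?_) (fun i _ j _ hij => by lia)
      (fun k hk => ?_) fun i _ => ?_
    · rw [Finset.mem_range] at hi
      rw [Finset.mem_Icc]
      lia
    · rw [Finset.mem_Icc] at hk
      exact ⟨(k + R).toNat, by rw [Finset.mem_range]; lia, by lia⟩
    · rw [Polynomial.eval_monomial, zpow_sub₀ hz, zpow_natCast, zpow_natCast]
      field_simp
  have hp0 : p = 0 := by
    refine Polynomial.eq_zero_of_infinite_isRoot p
      (Set.Infinite.mono (fun z (hz : z ∈ ({0}ᶜ : Set ℂ)) => ?_)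
        (Set.finite_singleton (0 : ℂ)).infinite_compl)
    simp [Polynomial.IsRoot, heval z hz, h z hz]
  ext k
  by_cases hk : k ∈ Finset.Icc (-(R : ℤ)) R
  · rw [Finset.mem_Icc] at hk
    have := congrArg (fun q : Polynomial ℂ => q.coeff (k + R).toNat) hp0
    simp only [hp, Polynomial.finsetSum_coeff, Polynomial.coeff_monomial, Polynomial.coeff_zero,
      Finset.sum_ite_eq', Finset.mem_range] at this
    rw [if_pos (by lia)] at this
    rw [Finsupp.zero_apply, ← this]
    congr 1
    lia
  · exact hR.eq_zero_of_notMem hk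

theorem symbol_injective {a b : ℤ →₀ ℂ} (h : ∀ z : ℂ, z ≠ 0 → symbol a z = symbol b z) : a = b :=
  sub_eq_zero.1 <| eq_zero_of_symbol_eq_zero fun z hz => by rw [symbol_sub, h z hz, sub_self]

/-- The average `M⁻¹ * (c(·) + c(· - 1) + ⋯ + c(· - M + 1))` of the translates of `c`. -/
noncomputable def nbox (M : ℕ) (c : ℤ →₀ ℂ) : ℤ →₀ ℂ :=
  (M : ℂ)⁻¹ • ∑ i ∈ Finset.range M, Finsupp.equivMapDomain (Equiv.addRight (i : ℤ)) c

theorem nbox_apply (M : ℕ) (c : ℤ →₀ ℂ) (k : ℤ) :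
    nbox M c k = (M : ℂ)⁻¹ * ∑ i ∈ Finset.range M, c (k - i) := by
  simp [nbox, sub_eq_add_neg]

theorem symbol_nbox (M : ℕ) (c : ℤ →₀ ℂ) {z : ℂ} (hz : z ≠ 0) :
    symbol (nbox M c) z = (M : ℂ)⁻¹ * (∑ i ∈ Finset.range M, z ^ i) * symbol c z := by
  obtain ⟨R, hR⟩ := exists_supportedIn c
  have h1 : ∀ i : ℕ, ∑' k : ℤ, c (k - i) * z ^ k = z ^ i * symbol c z := fun i => by
    rw [symbol_eq_tsum, ← tsum_mul_left, ← (Equiv.addRight (i : ℤ)).tsum_eq]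
    refine tsum_congr fun k => ?_
    rw [Equiv.coe_addRight, add_sub_cancel_right, zpow_add₀ hz, zpow_natCast]
    ring
  have hs : ∀ i : ℕ, Summable fun k : ℤ => c (k - i) * z ^ k := fun i => by
    rw [← (Equiv.addRight (i : ℤ)).summable_iff]
    simp only [Function.comp_def, Equiv.coe_addRight, add_sub_cancel_right]
    exact (hR.mul_right _).summable
  rw [symbol_eq_tsum]
  simp_rw [nbox_apply, mul_assoc, Finset.sum_mul]
  rw [tsum_mul_left, Summable.tsum_finsetSum fun i _ => hs i]
  simp_rw [h1]

theorem symbol_nbox_iterate (M : ℕ) (J : ℕ) (c : ℤ →₀ ℂ) {z : ℂ} (hz : z ≠ 0) :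
    symbol ((nbox M)^[J] c) z
      = ((M : ℂ) ^ J)⁻¹ * (∑ i ∈ Finset.range M, z ^ i) ^ J * symbol c z := by
  induction J with
  | zero => simp
  | succ J ih =>
    rw [Function.iterate_succ_apply', symbol_nbox M _ hz, ih, pow_succ', pow_succ', mul_inv]
    ring

theorem sum_nbox_iterate {M : ℕ} (hM : 2 ≤ M) (J : ℕ) (c : ℤ →₀ ℂ) :
    (((nbox M)^[J] c).sum fun _ x => x) = c.sum fun _ x => x := by
  have hM0 : (M : ℂ) ≠ 0 := by exact_mod_cast (by lia : M ≠ 0)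
  rw [← symbol_one, ← symbol_one, symbol_nbox_iterate M J c one_ne_zero]
  simp [hM0]

/-- The symbol of the averaging operator is the sum-rule factor divided by `M`, so the two
factorizations differ by the constant `M ^ J`. The normalized form keeps the sum of the mask equal
to `1`. -/
theorem hasSumRules_iff {M : ℕ} (hM : 2 ≤ M) (a : ℤ →₀ ℂ) (J : ℕ) :
    HasSumRules M a J ↔ ∃ c, a = (nbox M)^[J] c := by
  have hM0 : (M : ℂ) ≠ 0 := by exact_mod_cast (by lia : M ≠ 0)
  constructor
  · rintro ⟨b, hb⟩
    refine ⟨(M : ℂ) ^ J • b, symbol_injective fun z hz => ?_⟩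
    rw [hb z hz, symbol_nbox_iterate M J _ hz, symbol_smul]
    field_simp
  · rintro ⟨c, rfl⟩
    refine ⟨((M : ℂ) ^ J)⁻¹ • c, fun z hz => ?_⟩
    rw [symbol_nbox_iterate M J _ hz, symbol_smul]
    ring

theorem exists_nbox_iterate_of_le {M : ℕ} {a : ℤ →₀ ℂ} {i J : ℕ} (hi : i ≤ J)
    (h : ∃ c, a = (nbox M)^[J] c) : ∃ c, a = (nbox M)^[i] c := by
  obtain ⟨c, rfl⟩ := h
  exact ⟨(nbox M)^[J - i] c, by rw [← Function.iterate_add_apply, Nat.add_sub_cancel' hi]⟩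

section SumRules

variable {M : ℕ} (hM : 2 ≤ M)

include hM in
-- At either end of the support only one summand of the average is nonzero, so no cancellation
-- occurs and each factor widens the support by exactly `M - 1`.
theorem extremes_nbox_iterate (J : ℕ) {c : ℤ →₀ ℂ} {p q : ℤ} (hp : c p ≠ 0)
    (hq : c q ≠ 0) (hlt : ∀ k < p, c k = 0) (hgt : ∀ k > q, c k = 0) :
    (nbox M)^[J] c p ≠ 0 ∧ (nbox M)^[J] c (q + J * (M - 1)) ≠ 0 ∧
      (∀ k < p, (nbox M)^[J] c k = 0) ∧ ∀ k > q + J * (M - 1), (nbox M)^[J] c k = 0 := by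
  have hM0 : (M : ℂ) ≠ 0 := by exact_mod_cast (by lia : M ≠ 0)
  induction J with
  | zero => simpa using ⟨hp, hq, hlt, hgt⟩
  | succ J ih =>
    obtain ⟨h1, h2, h3, h4⟩ := ih
    rw [Function.iterate_succ_apply']
    set d := (nbox M)^[J] c
    set Q := q + J * ((M : ℤ) - 1)
    have hQ : q + ((J + 1 : ℕ) : ℤ) * (M - 1) = Q + (M - 1) := by push_cast; ring
    rw [hQ]
    refine ⟨?_, ?_, fun k hk => ?_, fun k hk => ?_⟩
    · rw [nbox_apply, Finset.sum_eq_single_of_mem 0 (by simp; lia) fun i _ hi =>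
        h3 _ (by lia)]
      simp [hM0, h1]
    · rw [nbox_apply, Finset.sum_eq_single_of_mem (M - 1) (by simp; lia) fun i hi hi' =>
        h4 _ (by rw [Finset.mem_range] at hi; lia)]
      rw [show Q + ((M : ℤ) - 1) - ((M - 1 : ℕ) : ℤ) = Q by lia]
      simp [hM0, h2]
    · rw [nbox_apply, Finset.sum_eq_zero fun i _ => h3 _ (by lia), mul_zero]
    · rw [nbox_apply, Finset.sum_eq_zero fun i hi => h4 _ (by
        rw [Finset.mem_range] at hi; lia), mul_zero]

include hM in
-- The support of `a` has width at least `J * (M - 1) ≥ J`. The bound makes the supremum in `sr`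
-- attained rather than a default value.
theorem bddAbove_hasSumRules {a : ℤ →₀ ℂ} (ha : a ≠ 0) : BddAbove {J | HasSumRules M a J} := by
  obtain ⟨R, hR⟩ := exists_supportedIn a
  refine ⟨2 * R, fun J hJ => ?_⟩
  obtain ⟨c, rfl⟩ := (hasSumRules_iff hM a J).1 hJ
  have hc : c ≠ 0 := by
    rintro rfl
    refine ha (symbol_injective fun z hz => ?_)
    rw [symbol_nbox_iterate M J _ hz]
    simp [symbol]
  have hne : c.support.Nonempty := Finsupp.support_nonempty_iff.2 hc
  obtain ⟨h1, h2, -, -⟩ := extremes_nbox_iterate hM J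
    (Finsupp.mem_support_iff.1 (Finset.min'_mem _ hne))
    (Finsupp.mem_support_iff.1 (Finset.max'_mem _ hne))
    (fun k hk => Finsupp.notMem_support_iff.1 fun h => not_lt.2 (Finset.min'_le _ _ h) hk)
    (fun k hk => Finsupp.notMem_support_iff.1 fun h => not_lt.2 (Finset.le_max' _ _ h) hk)
  have h3 : |c.support.min' hne| ≤ R := not_lt.1 fun h => h1 (hR _ h)
  have h4 : |c.support.max' hne + J * ((M : ℤ) - 1)| ≤ R := not_lt.1 fun h => h2 (hR _ h)
  have h5 := Finset.min'_le_max' _ hne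
  rw [abs_le] at h3 h4
  have h6 : (J : ℤ) * 1 ≤ J * ((M : ℤ) - 1) := mul_le_mul_of_nonneg_left (by lia) (by lia)
  lia

include hM in
theorem exists_eq_nbox_iterate_sr {a : ℤ →₀ ℂ} (ha : a ≠ 0) : ∃ c, a = (nbox M)^[sr M a] c :=
  (hasSumRules_iff hM a _).1 (Nat.sSup_mem ⟨0, (hasSumRules_iff hM a 0).2 ⟨a, rfl⟩⟩
    (bddAbove_hasSumRules hM ha))

include hM in
theorem le_sr {a : ℤ →₀ ℂ} (ha : a ≠ 0) {J : ℕ} (h : ∃ c, a = (nbox M)^[J] c) : J ≤ sr M a :=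
  le_csSup (bddAbove_hasSumRules hM ha) ((hasSumRules_iff hM a J).2 h)

theorem sd_const_mul (a : ℤ →₀ ℂ) (r : ℂ) (v : ℤ → ℂ) :
    sd M a (fun k => r * v k) = fun j => r * sd M a v j := by
  funext j
  simp only [sd, mul_assoc, tsum_mul_left]
  ring

theorem nabla_const_mul (r : ℂ) (v : ℤ → ℂ) :
    nabla (fun k => r * v k) = fun j => r * nabla v j := by
  funext j
  simp only [nabla]
  ring

theorem nabla_iterate_const_mul (i : ℕ) (r : ℂ) (v : ℤ → ℂ) :
    nabla^[i] (fun k => r * v k) = fun j => r * nabla^[i] v j := by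
  induction i with
  | zero => rfl
  | succ i ih => rw [Function.iterate_succ_apply', ih, nabla_const_mul,
      Function.iterate_succ_apply']

theorem sum_range_nabla (v : ℤ → ℂ) (k : ℤ) (n : ℕ) :
    ∑ i ∈ Finset.range n, nabla v (k - i) = v k - v (k - n) := by
  induction n with
  | zero => simp
  | succ n ih =>
    rw [Finset.sum_range_succ, ih, nabla, sub_sub k, ← Nat.cast_succ]
    ring

theorem nabla_nbox (c : ℤ →₀ ℂ) (k : ℤ) :
    nabla (nbox M c) k = (M : ℂ)⁻¹ * (c k - c (k - M)) := by
  rw [nabla, nbox_apply, nbox_apply, ← mul_sub, ← Finset.sum_sub_distrib, ← sum_range_nabla]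
  simp_rw [nabla, sub_right_comm]

include hM in
-- In symbols, `(1 - z) (1 + ⋯ + z ^ (M - 1)) = 1 - z ^ M`, and the factor `1 - z ^ M` after
-- subdivision is a difference of the data before it.
theorem nabla_sd_nbox (c : ℤ →₀ ℂ) (v : ℤ → ℂ) :
    nabla (sd M (nbox M c) v) = fun j => (M : ℂ)⁻¹ * sd M c (nabla v) j := by
  have hM1 : (1 : ℤ) ≤ M := by lia
  obtain ⟨R, hR⟩ := exists_supportedIn c
  obtain ⟨R', hR'⟩ := exists_supportedIn (nbox M c)
  funext j
  have h1 := sd_iterate_nabla hM c 1 v j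
  simp only [Function.iterate_one, pow_one] at h1
  have h2 := nabla_superposition hR' hM1 v 1 j
  simp only [Function.iterate_one] at h2
  have h3 : nabla (sd M (nbox M c) v) j
      = (M : ℂ) * ∑' k : ℤ, v k * nabla (nbox M c) (j - M * k) := by
    rw [← h2]
    unfold sd
    rw [nabla_const_mul]
  rw [h3, h1]
  simp_rw [nabla_nbox]
  unfold sd
  rw [← mul_sub, ← (summable_mul_comp hR hM1 v j).tsum_sub (summable_mul_comp hR hM1 v (j - M)),
    mul_left_comm]
  congr 1
  rw [← tsum_mul_left]
  refine tsum_congr fun k => ?_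
  rw [sub_right_comm]
  ring

include hM in
theorem nabla_sd_iterate_nbox (c : ℤ →₀ ℂ) (n : ℕ) (v : ℤ → ℂ) :
    nabla ((sd M (nbox M c))^[n] v)
      = fun j => ((M : ℂ) ^ n)⁻¹ * (sd M c)^[n] (nabla v) j := by
  induction n with
  | zero => simp
  | succ n ih =>
    rw [Function.iterate_succ_apply', nabla_sd_nbox hM, ih, sd_const_mul,
      Function.iterate_succ_apply']
    funext j
    rw [pow_succ', mul_inv, mul_assoc]

include hM in
-- The bridge between smoothness and boundedness: scaled differences for the mask with `i` box
-- factors are plain iterates for the mask without them.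
theorem nabla_iterate_sd_iterate_nbox (i : ℕ) (c : ℤ →₀ ℂ) (n : ℕ) (v : ℤ → ℂ) (j : ℤ) :
    (M : ℂ) ^ (i * n) * nabla^[i] ((sd M ((nbox M)^[i] c))^[n] v) j
      = (sd M c)^[n] (nabla^[i] v) j := by
  have hM0 : (M : ℂ) ≠ 0 := by exact_mod_cast (by lia : M ≠ 0)
  induction i generalizing v with
  | zero => simp
  | succ i ih =>
    rw [Function.iterate_succ_apply, Function.iterate_succ_apply (f := nabla),
      Function.iterate_succ_apply' (f := nbox M), nabla_sd_iterate_nbox hM,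
      nabla_iterate_const_mul, ← ih, add_mul, one_mul, pow_add]
    field_simp

theorem eq_const_of_nabla_eq_zero {v : ℤ → ℂ} (h : ∀ k, nabla v k = 0) (k l : ℤ) : v k = v l := by
  have key : ∀ k, v k = v 0 := fun k => by
    induction k with
    | zero => rfl
    | succ k ih =>
      rw [← ih, ← sub_eq_zero]
      simpa [nabla] using h (k + 1)
    | pred k ih =>
      rw [← ih, eq_comm, ← sub_eq_zero]
      simpa [nabla] using h (-k)
  rw [key k, key l]

include hM in
theorem tsum_eq_sum_residues {R : ℤ} {u : ℤ → ℂ} (hu : SupportedIn R u) :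
    ∑' k, u k = ∑ r ∈ Finset.range M, ∑' q : ℤ, u (r - M * q) := by
  have : NeZero M := ⟨by lia⟩
  have hs : Summable fun p : Fin M × ℤ => u (p.2 * M + (p.1 : ℕ)) :=
    ((Equiv.prodComm _ _).trans (Int.divModEquiv M).symm).summable_iff.2 hu.summable
  have h : ∑' k, u k = ∑' p : Fin M × ℤ, u (p.2 * M + (p.1 : ℕ)) :=
    (((Equiv.prodComm _ _).trans (Int.divModEquiv M).symm).tsum_eq u).symm
  rw [h, hs.tsum_prod, tsum_fintype,
    Finset.sum_range fun r => ∑' q : ℤ, u ((r : ℤ) - M * q)]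
  refine Finset.sum_congr rfl fun r _ => ?_
  rw [← (Equiv.neg ℤ).tsum_eq]
  refine tsum_congr fun q => congrArg u ?_
  simp only [Equiv.neg_apply]
  ring

include hM in
/-- Sum rules of order one make the subdivision operator preserve constants. -/
theorem sd_nbox_one {c : ℤ →₀ ℂ} (hc : (c.sum fun _ x => x) = 1) (j : ℤ) :
    sd M (nbox M c) (fun _ => 1) j = 1 := by
  have hM0 : (M : ℂ) ≠ 0 := by exact_mod_cast (by lia : M ≠ 0)
  have hM1 : (1 : ℤ) ≤ M := by lia
  have : NeZero M := ⟨by lia⟩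
  -- The image of a constant has zero difference, so it is constant; summing the mask over its
  -- residue classes modulo `M` then finds the value.
  have hconst : ∀ k, nabla (sd M (nbox M c) (fun _ => 1)) k = 0 := fun k => by
    rw [nabla_sd_nbox hM]
    have : nabla (fun _ => (1 : ℂ)) = fun _ => 0 := by
      funext k
      simp [nabla]
    rw [this]
    simp [sd]
  obtain ⟨R, hR⟩ := exists_supportedIn (nbox M c)
  have h1 : ∑' k, nbox M c k = 1 := by
    rw [tsum_coe_eq_sum, ← hc]
    exact sum_nbox_iterate hM 1 c
  have h2 := tsum_eq_sum_residues hM hR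
  have h3 : ∀ r : ℤ, (M : ℂ) * ∑' q : ℤ, nbox M c (r - M * q)
      = sd M (nbox M c) (fun _ => 1) j := fun r => by
    rw [eq_const_of_nabla_eq_zero hconst j r]
    simp [sd]
  have h4 : (M : ℂ) * ∑' k, nbox M c k = M * sd M (nbox M c) (fun _ => 1) j := by
    rw [h2, Finset.mul_sum]
    simp_rw [h3]
    simp
  rw [h1] at h4
  exact (mul_left_cancel₀ hM0 h4).symm

include hM in
/-- A mask whose subdivision operator preserves constants has sum rules of order one. -/
theorem exists_eq_nbox {c : ℤ →₀ ℂ} (hc : ∀ j, sd M c (fun _ => 1) j = 1) :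
    ∃ d, c = nbox M d := by
  have hM0 : (M : ℂ) ≠ 0 := by exact_mod_cast (by lia : M ≠ 0)
  obtain ⟨R, hR⟩ := exists_supportedIn c
  -- The quotient mask is `∇ (S H)` for the Heaviside sequence `H`. Since `S` preserves `1`, `S H`
  -- is `0` far to the left and `1` far to the right, so its difference has finite support. Since `∇
  -- H = δ`, averaging `M` of these differences gives `c` back.
  set H : ℤ → ℂ := fun k => if 0 ≤ k then 1 else 0 with hH
  have hnH : nabla H = dirac := by
    funext k
    simp only [nabla, hH, dirac]
    grind
  have hper : ∀ j, sd M c H j - sd M c H (j - M) = M * c j := fun j => by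
    have h1 := sd_iterate_nabla hM c 1 H j
    simp only [Function.iterate_one, pow_one] at h1
    rw [← h1, hnH, sd_dirac]
  have hneg : ∀ j < -(R : ℤ), sd M c H j = 0 := fun j hj => by
    have : ∀ k, H k * c (j - M * k) = 0 := fun k => by
      rcases lt_or_ge k 0 with h | h
      · simp [hH, not_le.2 h]
      · rw [hR, mul_zero]
        have : 0 ≤ (M : ℤ) * k := by positivity
        grind
    simp [sd, this]
  have hpos : ∀ j > (R : ℤ), sd M c H j = 1 := fun j hj => by
    rw [← hc j]
    unfold sd
    congr 1
    refine tsum_congr fun k => ?_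
    rcases lt_or_ge k 0 with h | h
    · rw [hR, mul_zero, mul_zero]
      have : 0 ≤ (M : ℤ) * (-k) := mul_nonneg (by lia) (by lia)
      grind
    · simp [hH, h]
  have hd : SupportedIn (R + 1) (nabla (sd M c H)) := fun k hk => by
    rw [nabla]
    rcases lt_abs.1 hk with h | h
    · rw [hpos k (by lia), hpos (k - 1) (by lia), sub_self]
    · rw [hneg k (by lia), hneg (k - 1) (by lia), sub_self]
  refine ⟨Finsupp.ofSupportFinite _ hd.finite_support, ?_⟩
  ext k
  rw [nbox_apply]
  simp only [Finsupp.ofSupportFinite_coe]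
  rw [sum_range_nabla, hper]
  field_simp

end SumRules

end BoxFactors

/-! ### Bounds for iterates that are uniform in the number of steps. -/

section OperatorBounds

/-- At most `2 * R + 1` terms survive, whatever the spacing `N`. With `N = M ^ n` this is the source
of constants independent of `n`. -/
theorem superposition_eq_sum {R N : ℤ} (hN : 1 ≤ N) {u : ℤ → ℂ} (hu : SupportedIn (R * N) u)
    (v : ℤ → ℂ) (j : ℤ) :
    ∑' k : ℤ, v k * u (j - N * k)
      = ∑ k ∈ Finset.Icc (j / N - R) (j / N + R), v k * u (j - N * k) := by
  refine tsum_eq_sum fun k hk => ?_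
  rw [hu, mul_zero]
  by_contra! h
  refine hk ?_
  rw [abs_le] at h
  have h1 := Int.emod_add_mul_ediv j N
  have h2 := Int.emod_nonneg j (by lia : N ≠ 0)
  have h3 := Int.emod_lt_of_pos j (by lia : 0 < N)
  rw [Finset.mem_Icc]
  constructor
  · by_contra! h4
    nlinarith [mul_le_mul_of_nonneg_left (Int.add_one_le_iff.2 h4) (by lia : 0 ≤ N)]
  · by_contra! h4
    nlinarith [mul_le_mul_of_nonneg_left (Int.add_one_le_iff.2 h4) (by lia : 0 ≤ N)]

theorem norm_sub_le_of_norm_nabla_le {v : ℤ → ℂ} {B : ℝ} (h : ∀ k, ‖nabla v k‖ ≤ B) (k l : ℤ) :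
    ‖v k - v l‖ ≤ |(k : ℝ) - l| * B := by
  have key : ∀ (n : ℕ) (k : ℤ), ‖v k - v (k - n)‖ ≤ n * B := fun n k => by
    rw [← sum_range_nabla]
    refine (norm_sum_le _ _).trans ((Finset.sum_le_card_nsmul _ _ B fun _ _ => h _).trans ?_)
    simp
  rcases le_total l k with hkl | hkl
  · have := key (k - l).toNat k
    rw [Int.toNat_of_nonneg (by lia), sub_sub_cancel] at this
    refine this.trans (le_of_eq ?_)
    rw [← Int.cast_natCast, Int.toNat_of_nonneg (by lia), ← Int.cast_sub, ← Int.cast_abs,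
      abs_of_nonneg (by lia)]
  · have := key (l - k).toNat l
    rw [Int.toNat_of_nonneg (by lia), sub_sub_cancel] at this
    rw [norm_sub_rev, abs_sub_comm]
    refine this.trans (le_of_eq ?_)
    rw [← Int.cast_natCast, Int.toNat_of_nonneg (by lia), ← Int.cast_sub, ← Int.cast_abs,
      abs_of_nonneg (by lia)]

theorem card_Icc_sub_add (q : ℤ) (R : ℕ) : (Finset.Icc (q - R) (q + R)).card = 2 * R + 1 := by
  rw [Int.card_Icc]
  lia

theorem exists_norm_le (a : ℤ →₀ ℂ) : ∃ A : ℝ, 0 ≤ A ∧ ∀ k, ‖a k‖ ≤ A := by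
  refine ⟨∑ k ∈ a.support, ‖a k‖, Finset.sum_nonneg fun _ _ => norm_nonneg _, fun k => ?_⟩
  by_cases hk : k ∈ a.support
  · exact Finset.single_le_sum (f := fun k => ‖a k‖) (fun _ _ => norm_nonneg _) hk
  · rw [Finsupp.notMem_support_iff.1 hk, norm_zero]
    exact Finset.sum_nonneg fun _ _ => norm_nonneg _

section

variable {M : ℕ} (hM : 2 ≤ M)

include hM in
theorem sd_eq_sum {c : ℤ →₀ ℂ} {R : ℕ} (hR : SupportedIn R c) (v : ℤ → ℂ) (j : ℤ) :
    sd M c v j = M * ∑ k ∈ Finset.Icc (j / M - R) (j / M + R), v k * c (j - M * k) := by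
  unfold sd
  rw [superposition_eq_sum (by lia) (hR.mono _)]
  exact le_mul_of_one_le_right (by lia) (by lia)

include hM in
/-- One step of a subdivision scheme preserving constants changes the data by at most a multiple
of the size of the differences. -/
theorem exists_norm_sd_sub_le {c : ℤ →₀ ℂ} (hc : ∀ j, sd M c (fun _ => 1) j = 1) :
    ∃ C : ℝ, 0 ≤ C ∧ ∀ (v : ℤ → ℂ) (B : ℝ), (∀ k, ‖nabla v k‖ ≤ B) →
      ∀ j : ℤ, ‖sd M c v j - v (j / M)‖ ≤ C * B := by
  obtain ⟨R, hR⟩ := exists_supportedIn c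
  obtain ⟨A, hA0, hA⟩ := exists_norm_le c
  refine ⟨M * ((2 * R + 1) * (R * A)), by positivity, fun v B hB j => ?_⟩
  have hB0 : 0 ≤ B := (norm_nonneg _).trans (hB 0)
  -- Reproduction of constants allows the central value `v (j / M)` to be subtracted inside the sum.
  have h1 : sd M c v j - v (j / M) = M * ∑ k ∈ Finset.Icc (j / M - R) (j / M + R),
      (v k - v (j / M)) * c (j - M * k) := by
    have h2 := hc j
    rw [sd_eq_sum hM hR] at h2
    simp_rw [sub_mul, one_mul] at h2 ⊢
    rw [Finset.sum_sub_distrib, ← Finset.mul_sum, mul_sub, mul_left_comm, h2, mul_one,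
      sd_eq_sum hM hR]
  rw [h1, norm_mul, Complex.norm_natCast, mul_assoc]
  refine mul_le_mul_of_nonneg_left ?_ (Nat.cast_nonneg _)
  refine (norm_sum_le _ _).trans ((Finset.sum_le_card_nsmul _ _ (R * A * B) fun k hk => ?_).trans
    (le_of_eq ?_))
  · rw [norm_mul]
    have h3 : |(k : ℝ) - (j / M : ℤ)| ≤ R := by
      rw [Finset.mem_Icc] at hk
      rw [← Int.cast_sub, ← Int.cast_abs]
      exact_mod_cast abs_le.2 (by constructor <;> linarith [hk.1, hk.2])
    calc ‖v k - v (j / M)‖ * ‖c (j - M * k)‖ ≤ (R * B) * A := by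
          gcongr
          · exact (norm_sub_le_of_norm_nabla_le hB _ _).trans (by gcongr)
          · exact hA _
      _ = _ := by ring
  · rw [card_Icc_sub_add, nsmul_eq_mul]
    push_cast
    ring

include hM in
-- Bounds the operator norm of `S^n` on bounded sequences by its value on `δ`, at the cost of a
-- constant independent of `n`.
theorem norm_sd_iterate_le {c : ℤ →₀ ℂ} {R : ℕ} (hR : SupportedIn R c) {n : ℕ} {B V : ℝ}
    (hB : ∀ k, ‖(sd M c)^[n] dirac k‖ ≤ B) {v : ℤ → ℂ} (hV : ∀ k, ‖v k‖ ≤ V) (j : ℤ) :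
    ‖(sd M c)^[n] v j‖ ≤ (2 * R + 1) * B * V := by
  have hV0 : 0 ≤ V := (norm_nonneg _).trans (hV 0)
  have hB0 : 0 ≤ B := (norm_nonneg _).trans (hB 0)
  have hs : SupportedIn ((R : ℤ) * (M : ℤ) ^ n) ((sd M c)^[n] dirac) := by
    simpa using hR.sd_iterate hM (by lia) supportedIn_dirac n
  rw [sd_iterate_apply hM, superposition_eq_sum (one_le_natCast_pow hM n) hs]
  refine (norm_sum_le _ _).trans ((Finset.sum_le_card_nsmul _ _ (B * V) fun k hk => ?_).trans
    (le_of_eq ?_))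
  · rw [norm_mul, mul_comm]
    gcongr
    · exact hB _
    · exact hV _
  · rw [card_Icc_sub_add, nsmul_eq_mul]
    push_cast
    ring

include hM in
-- On the fine level `∇` becomes a difference with step `M ^ n`, and `2 * (R + L) + 1` such steps
-- lead from any point of the support out of it.
theorem norm_sd_iterate_le_of_nabla {c : ℤ →₀ ℂ} {R : ℕ} (hR : SupportedIn R c) {L : ℕ}
    {v : ℤ → ℂ} (hv : SupportedIn L v) {n : ℕ} {B : ℝ}
    (hB : ∀ k, ‖(sd M c)^[n] (nabla v) k‖ ≤ B) (k : ℤ) :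
    ‖(sd M c)^[n] v k‖ ≤ (2 * (R + L) + 1) * B := by
  have hs := hR.sd_iterate hM (by lia) hv n
  have hN := one_le_natCast_pow hM n
  have hB0 : 0 ≤ B := (norm_nonneg _).trans (hB 0)
  by_cases hk : (R + L) * (M : ℤ) ^ n < |k|
  · rw [hs k hk, norm_zero]
    positivity
  have key : ∀ p : ℕ, ‖(sd M c)^[n] v k - (sd M c)^[n] v (k - p * (M : ℤ) ^ n)‖ ≤ p * B := by
    intro p
    induction p with
    | zero => simp
    | succ p ih =>
      have h := sd_iterate_nabla hM c n v (k - p * (M : ℤ) ^ n)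
      rw [sub_sub, ← add_one_mul] at h
      have h2 := hB (k - p * (M : ℤ) ^ n)
      rw [h] at h2
      push_cast
      rw [add_one_mul (p : ℝ)]
      refine le_trans ?_ (add_le_add ih h2)
      exact norm_sub_le_norm_sub_add_norm_sub _ _ _
  have h := key (2 * (R + L) + 1)
  rw [hs (k - _), sub_zero] at h
  · exact_mod_cast h
  · have := (abs_le.1 (not_lt.1 hk)).2
    rw [lt_abs]
    right
    push_cast
    nlinarith

include hM in
-- Undoing `J` differences of finitely supported data costs only a constant, so `S^n (∇^J δ)` and
-- `S^n δ` grow at the same rate.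
theorem exists_norm_sd_iterate_le_of_nabla_iterate (c : ℤ →₀ ℂ) (J : ℕ) :
    ∃ C : ℝ, 0 < C ∧ ∀ (n : ℕ) (B : ℝ), (∀ k, ‖(sd M c)^[n] (nabla^[J] dirac) k‖ ≤ B) →
      ∀ k, ‖(sd M c)^[n] dirac k‖ ≤ C * B := by
  obtain ⟨R, hR⟩ := exists_supportedIn c
  induction J with
  | zero => exact ⟨1, one_pos, fun n B h => by simpa using h⟩
  | succ J ih =>
    obtain ⟨C, hC, h⟩ := ih
    refine ⟨C * (2 * (R + J) + 1), by positivity, fun n B hB k => ?_⟩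
    rw [mul_assoc]
    refine h n _ (fun l => ?_) k
    have hs : SupportedIn J (nabla^[J] dirac) := by
      simpa using supportedIn_dirac.nabla_iterate J
    refine norm_sd_iterate_le_of_nabla hM hR hs (fun k => ?_) l
    rw [← Function.iterate_succ_apply' nabla]
    exact hB k

/-- At `z = 1` this gives the total mass of the iterates, and on the unit circle the partial
products of `φ̂`. -/
theorem tsum_sd_mul_zpow (a : ℤ →₀ ℂ) {L : ℤ} {v : ℤ → ℂ} (hv : SupportedIn L v) {z : ℂ}
    (hz : z ≠ 0) :
    ∑' j : ℤ, sd M a v j * z ^ j = M * symbol a z * ∑' k : ℤ, v k * (z ^ M) ^ k := by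
  obtain ⟨R, hR⟩ := exists_supportedIn a
  have h1 : ∀ k : ℤ, ∑' j : ℤ, a (j - M * k) * z ^ j = (z ^ M) ^ k * symbol a z := fun k => by
    rw [symbol_eq_tsum, ← tsum_mul_left, ← (Equiv.addRight ((M : ℤ) * k)).tsum_eq]
    refine tsum_congr fun j => ?_
    rw [Equiv.coe_addRight, add_sub_cancel_right, zpow_add₀ hz, zpow_mul, zpow_natCast]
    ring
  have hs : ∀ k : ℤ, Summable fun j : ℤ => a (j - M * k) * z ^ j := fun k => by
    rw [← (Equiv.addRight ((M : ℤ) * k)).summable_iff]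
    simp only [Function.comp_def, Equiv.coe_addRight, add_sub_cancel_right]
    exact (hR.mul_right _).summable
  have h2 : ∀ j : ℤ, sd M a v j * z ^ j
      = ∑ k ∈ Finset.Icc (-L) L, M * v k * (a (j - M * k) * z ^ j) := fun j => by
    unfold sd
    rw [(hv.mul_right fun k => a (j - M * k)).tsum_eq, Finset.mul_sum, Finset.sum_mul]
    refine Finset.sum_congr rfl fun k _ => ?_
    ring
  simp_rw [h2]
  rw [Summable.tsum_finsetSum fun k _ => (hs k).mul_left _, (hv.mul_right _).tsum_eq,
    Finset.mul_sum]
  refine Finset.sum_congr rfl fun k _ => ?_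
  rw [tsum_mul_left, h1]
  ring

include hM in
theorem tsum_sd_iterate_dirac {c : ℤ →₀ ℂ} (hc : (c.sum fun _ x => x) = 1) (n : ℕ) :
    ∑' j : ℤ, (sd M c)^[n] dirac j = (M : ℂ) ^ n := by
  induction n with
  | zero =>
    rw [tsum_eq_single 0 fun k hk => by simp [dirac, hk]]
    simp [dirac]
  | succ n ih =>
    obtain ⟨L, hL⟩ := exists_supportedIn_sd_iterate hM c supportedIn_dirac n
    have := tsum_sd_mul_zpow (M := M) c hL one_ne_zero
    simp only [one_zpow, one_pow, mul_one, ih, symbol_one, hc] at this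
    rw [Function.iterate_succ_apply', this, pow_succ']

include hM in
-- The mass `M ^ n` is spread over at most `2 * R * M ^ n + 1` points.
theorem exists_le_norm_sd_iterate_dirac {c : ℤ →₀ ℂ} (hc : (c.sum fun _ x => x) = 1) :
    ∃ κ : ℝ, 0 < κ ∧ ∀ (n : ℕ) (B : ℝ), (∀ k, ‖(sd M c)^[n] dirac k‖ ≤ B) → κ ≤ B := by
  obtain ⟨R, hR⟩ := exists_supportedIn c
  refine ⟨(2 * R + 1 : ℝ)⁻¹, by positivity, fun n B hB => ?_⟩
  have hs := hR.sd_iterate hM (by lia) supportedIn_dirac n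
  rw [add_zero] at hs
  have hB0 : 0 ≤ B := (norm_nonneg _).trans (hB 0)
  have h1 : (M : ℝ) ^ n ≤ (2 * R * M ^ n + 1) * B := by
    have h2 : ‖∑' j : ℤ, (sd M c)^[n] dirac j‖ = (M : ℝ) ^ n := by
      rw [tsum_sd_iterate_dirac hM hc, norm_pow, Complex.norm_natCast]
    refine h2.symm.le.trans ?_
    rw [hs.tsum_eq]
    refine (norm_sum_le _ _).trans ((Finset.sum_le_card_nsmul _ _ B fun k _ => hB k).trans
      (le_of_eq ?_))
    have : (Finset.Icc (-((R : ℤ) * (M : ℤ) ^ n)) (R * M ^ n)).card = 2 * (R * M ^ n) + 1 := by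
      have h : (R : ℤ) * (M : ℤ) ^ n = ((R * M ^ n : ℕ) : ℤ) := by push_cast; rfl
      rw [Int.card_Icc, h]
      lia
    rw [this, nsmul_eq_mul]
    push_cast
    ring
  have h3 : (1 : ℝ) ≤ (M : ℝ) ^ n := one_le_pow₀ (by exact_mod_cast (by lia : 1 ≤ M))
  rw [inv_le_iff_one_le_mul₀ (by positivity)]
  have h4 : (2 * R * (M : ℝ) ^ n + 1) * B ≤ (M : ℝ) ^ n * (B * (2 * R + 1)) := by
    nlinarith
  exact le_of_mul_le_mul_left (by linarith) (by linarith : (0 : ℝ) < (M : ℝ) ^ n)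

end

end OperatorBounds

/-! ### The growth rate `ρ_J` and the exponent `sm_∞`. -/

section SmoothnessExponent

section Limsup

theorem tendsto_mul_pow_rpow_one_div {C t : ℝ} (hC : 0 < C) (ht : 0 ≤ t) :
    Tendsto (fun n : ℕ => (C * t ^ n) ^ (1 / (n : ℝ))) atTop (𝓝 t) := by
  have h1 : Tendsto (fun n : ℕ => C ^ (1 / (n : ℝ)) * t) atTop (𝓝 (C ^ (0 : ℝ) * t)) :=
    (((Real.continuousAt_const_rpow hC.ne').tendsto.comp
      tendsto_one_div_atTop_nhds_zero_nat)).mul_const t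
  rw [Real.rpow_zero, one_mul] at h1
  refine h1.congr' ?_
  filter_upwards [eventually_ge_atTop 1] with n hn
  rw [Real.mul_rpow hC.le (pow_nonneg ht n), one_div, Real.pow_rpow_inv_natCast ht (by lia)]

variable {d : ℕ → ℝ} (hd : ∀ n, 0 ≤ d n)

include hd in
theorem isCoboundedUnder_rpow_one_div :
    IsCoboundedUnder (· ≤ ·) atTop fun n : ℕ => d n ^ (1 / (n : ℝ)) :=
  isCoboundedUnder_le_of_le atTop (x := 0) fun n => Real.rpow_nonneg (hd n) _

variable {C T : ℝ} (hC : 0 < C) (hT : 0 ≤ T) (hdT : ∀ n, d n ≤ C * T ^ n)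

include hd hC hT hdT

theorem isBoundedUnder_rpow_one_div :
    IsBoundedUnder (· ≤ ·) atTop fun n : ℕ => d n ^ (1 / (n : ℝ)) :=
  (tendsto_mul_pow_rpow_one_div hC hT).isBoundedUnder_le.mono_le
    (Eventually.of_forall fun n => Real.rpow_le_rpow (hd n) (hdT n) (by positivity))

theorem limsup_rpow_one_div_le : limsup (fun n : ℕ => d n ^ (1 / (n : ℝ))) atTop ≤ T := by
  have h := tendsto_mul_pow_rpow_one_div hC hT
  rw [← h.limsup_eq]
  exact limsup_le_limsup (Eventually.of_forall fun n =>
    Real.rpow_le_rpow (hd n) (hdT n) (by positivity)) (isCoboundedUnder_rpow_one_div hd)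
    h.isBoundedUnder_le

theorem le_limsup_rpow_one_div {κ t : ℝ} (hκ : 0 < κ) (ht : 0 ≤ t) (h : ∀ n, κ * t ^ n ≤ d n) :
    t ≤ limsup (fun n : ℕ => d n ^ (1 / (n : ℝ))) atTop := by
  have h1 := tendsto_mul_pow_rpow_one_div hκ ht
  nth_rewrite 1 [← h1.limsup_eq]
  exact limsup_le_limsup (Eventually.of_forall fun n =>
    Real.rpow_le_rpow (by positivity) (h n) (by positivity)) h1.isCoboundedUnder_le
    (isBoundedUnder_rpow_one_div hd hC hT hdT)

theorem eventually_le_pow_of_limsup_lt {x : ℝ}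
    (h : limsup (fun n : ℕ => d n ^ (1 / (n : ℝ))) atTop < x) : ∀ᶠ n : ℕ in atTop, d n ≤ x ^ n := by
  filter_upwards [eventually_lt_of_limsup_lt h (isBoundedUnder_rpow_one_div hd hC hT hdT),
    eventually_ge_atTop 1] with n hn hn1
  have := pow_le_pow_left₀ (Real.rpow_nonneg (hd n) _) hn.le n
  rwa [one_div, Real.rpow_inv_natCast_pow (hd n) (by lia)] at this

end Limsup

section SupNorm

theorem SupportedIn.bddAbove {L : ℤ} {v : ℤ → ℂ} (h : SupportedIn L v) :
    BddAbove (Set.range fun k => ‖v k‖) := by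
  refine ⟨∑ k ∈ Finset.Icc (-L) L, ‖v k‖, ?_⟩
  rintro _ ⟨k, rfl⟩
  beta_reduce
  by_cases hk : k ∈ Finset.Icc (-L) L
  · exact Finset.single_le_sum (f := fun k => ‖v k‖) (fun _ _ => norm_nonneg _) hk
  · rw [h.eq_zero_of_notMem hk, norm_zero]
    exact Finset.sum_nonneg fun _ _ => norm_nonneg _

theorem SupportedIn.norm_le_supNorm {L : ℤ} {v : ℤ → ℂ} (h : SupportedIn L v) (k : ℤ) :
    ‖v k‖ ≤ supNorm v := le_ciSup h.bddAbove k

theorem supNorm_le {v : ℤ → ℂ} {B : ℝ} (h : ∀ k, ‖v k‖ ≤ B) : supNorm v ≤ B := ciSup_le h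

theorem supNorm_nonneg (v : ℤ → ℂ) : 0 ≤ supNorm v := Real.iSup_nonneg fun _ => norm_nonneg _

theorem norm_nabla_le {v : ℤ → ℂ} {B : ℝ} (h : ∀ k, ‖v k‖ ≤ B) (k : ℤ) : ‖nabla v k‖ ≤ 2 * B := by
  rw [nabla, two_mul]
  exact (norm_sub_le _ _).trans (add_le_add (h _) (h _))

theorem norm_nabla_iterate_le (i : ℕ) {v : ℤ → ℂ} {B : ℝ} (h : ∀ k, ‖v k‖ ≤ B) (k : ℤ) :
    ‖nabla^[i] v k‖ ≤ 2 ^ i * B := by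
  induction i generalizing v B with
  | zero => simpa using h k
  | succ i ih =>
    rw [Function.iterate_succ_apply, pow_succ, mul_assoc]
    exact ih (norm_nabla_le h)

end SupNorm

section Rho

variable {M : ℕ} (hM : 2 ≤ M)

include hM in
theorem exists_norm_sd_iterate_dirac_le (a : ℤ →₀ ℂ) :
    ∃ T : ℝ, 0 ≤ T ∧ ∀ (n : ℕ) (k : ℤ), ‖(sd M a)^[n] dirac k‖ ≤ T ^ n := by
  obtain ⟨R, hR⟩ := exists_supportedIn a
  obtain ⟨A, hA0, hA⟩ := exists_norm_le a
  refine ⟨(2 * R + 1) * (M * A), by positivity, fun n => ?_⟩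
  have h1 : ∀ k, ‖(sd M a)^[1] dirac k‖ ≤ M * A := fun k => by
    rw [Function.iterate_one, sd_dirac, norm_mul, Complex.norm_natCast]
    exact mul_le_mul_of_nonneg_left (hA k) (Nat.cast_nonneg _)
  induction n with
  | zero =>
    intro k
    simp only [Function.iterate_zero, id_eq, pow_zero, dirac]
    split_ifs <;> simp
  | succ n ih =>
    intro k
    rw [Function.iterate_succ_apply', pow_succ']
    exact norm_sd_iterate_le hM hR h1 ih k

include hM in
theorem supportedIn_nabla_iterate_sd_iterate (a : ℤ →₀ ℂ) (J n : ℕ) :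
    ∃ L, SupportedIn L (nabla^[J] ((sd M a)^[n] dirac)) := by
  obtain ⟨L, hL⟩ := exists_supportedIn_sd_iterate hM a supportedIn_dirac n
  exact ⟨_, hL.nabla_iterate J⟩

include hM in
theorem exists_supNorm_nabla_le (a : ℤ →₀ ℂ) (J : ℕ) :
    ∃ C T : ℝ, 0 < C ∧ 0 ≤ T ∧ ∀ n, supNorm (nabla^[J] ((sd M a)^[n] dirac)) ≤ C * T ^ n := by
  obtain ⟨T, hT, h⟩ := exists_norm_sd_iterate_dirac_le hM a
  exact ⟨2 ^ J, T, by positivity, hT, fun n => supNorm_le fun k => norm_nabla_iterate_le J (h n) k⟩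

include hM in
-- `M ^ (J * n) * ∇^J S^n δ` is an iterate for `c` applied to `∇^J δ`; it controls the iterate of
-- `δ`, which the total mass keeps away from `0`.
theorem le_rhoInfty {a c : ℤ →₀ ℂ} (ha : (a.sum fun _ x => x) = 1) {J : ℕ}
    (hc : a = (nbox M)^[J] c) : ((M : ℝ) ^ J)⁻¹ ≤ rhoInfty M a J := by
  have hM0 : (0 : ℝ) < M := by exact_mod_cast (by lia : 0 < M)
  obtain ⟨C, T, hC, hT, h⟩ := exists_supNorm_nabla_le hM a J
  rw [hc, sum_nbox_iterate hM] at ha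
  obtain ⟨κ, hκ, h1⟩ := exists_le_norm_sd_iterate_dirac hM ha
  obtain ⟨K, hK, h2⟩ := exists_norm_sd_iterate_le_of_nabla_iterate hM c J
  refine le_limsup_rpow_one_div (fun _ => supNorm_nonneg _) hC hT h (κ := κ / K) (by positivity)
    (by positivity) fun n => ?_
  obtain ⟨L, hL⟩ := supportedIn_nabla_iterate_sd_iterate hM a J n
  have h3 := h1 n _ (h2 n ((M : ℝ) ^ (J * n) * supNorm (nabla^[J] ((sd M a)^[n] dirac))) fun k => by
    rw [← nabla_iterate_sd_iterate_nbox hM, ← hc, norm_mul, norm_pow, Complex.norm_natCast]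
    exact mul_le_mul_of_nonneg_left (hL.norm_le_supNorm k) (by positivity))
  rw [inv_pow, ← pow_mul, ← div_eq_mul_inv, div_div, div_le_iff₀ (by positivity)]
  linarith

include hM in
theorem eventually_norm_nabla_le_of_rhoInfty_lt {a : ℤ →₀ ℂ} {J : ℕ} {x : ℝ}
    (h : rhoInfty M a J < x) :
    ∀ᶠ n : ℕ in atTop, ∀ k, ‖nabla^[J] ((sd M a)^[n] dirac) k‖ ≤ x ^ n := by
  obtain ⟨C, T, hC, hT, hCT⟩ := exists_supNorm_nabla_le hM a J
  filter_upwards [eventually_le_pow_of_limsup_lt (fun _ => supNorm_nonneg _) hC hT hCT h]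
    with n hn k
  obtain ⟨L, hL⟩ := supportedIn_nabla_iterate_sd_iterate hM a J n
  exact (hL.norm_le_supNorm k).trans hn

include hM in
theorem lt_smInfty_iff {a : ℤ →₀ ℂ} (ha : (a.sum fun _ x => x) = 1) (m : ℕ) :
    (m : ℝ) < smInfty M a ↔ rhoInfty M a (sr M a) < ((M : ℝ) ^ m)⁻¹ := by
  have hM1 : (1 : ℝ) < M := by exact_mod_cast (by lia : 1 < M)
  have hM0 : (0 : ℝ) < M := by linarith
  have ha0 : a ≠ 0 := by
    rintro rfl
    simp at ha
  obtain ⟨c, hc⟩ := exists_eq_nbox_iterate_sr hM ha0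
  -- Positivity excludes the default value of the logarithm at `0`.
  have hpos : 0 < rhoInfty M a (sr M a) :=
    (by positivity : 0 < ((M : ℝ) ^ sr M a)⁻¹).trans_le (le_rhoInfty hM ha hc)
  rw [smInfty, lt_neg, Real.logb_lt_iff_lt_rpow hM1 hpos, Real.rpow_neg hM0.le, Real.rpow_natCast]

include hM in
-- Compares the lower bound `M ^ (-J) ≤ ρ_J` with `ρ_J < M ^ (-m)`.
theorem lt_sr_of_rhoInfty_lt {a : ℤ →₀ ℂ} (ha : (a.sum fun _ x => x) = 1) {m : ℕ}
    (h : rhoInfty M a (sr M a) < ((M : ℝ) ^ m)⁻¹) : m < sr M a := by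
  have hM1 : (1 : ℝ) < M := by exact_mod_cast (by lia : 1 < M)
  have ha0 : a ≠ 0 := by
    rintro rfl
    simp at ha
  obtain ⟨c, hc⟩ := exists_eq_nbox_iterate_sr hM ha0
  have h1 := (le_rhoInfty hM ha hc).trans_lt h
  rw [inv_lt_inv₀ (by positivity) (by positivity)] at h1
  exact (pow_lt_pow_iff_right₀ hM1).1 h1

end Rho

end SmoothnessExponent

/-! ### Limits of data on refined grids and their derivatives. -/

section GridLimits

/-- The values `x n k` at the points `k / M ^ n` converge to `F`, uniformly on bounded sets. -/
def IsGridLimit (M : ℕ) (x : ℕ → ℤ → ℂ) (F : ℝ → ℂ) : Prop :=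
  ∀ K : ℝ, 0 < K → ∀ ε : ℝ, 0 < ε → ∀ᶠ n : ℕ in atTop, ∀ k : ℤ,
    |(k : ℝ)| ≤ (M : ℝ) ^ n * K → ‖x n k - F ((k : ℝ) / (M : ℝ) ^ n)‖ < ε

theorem isLimitFunction_iff {M : ℕ} {a : ℤ →₀ ℂ} {m : ℕ} {v : ℤ → ℂ} {η : ℝ → ℂ} :
    IsLimitFunction M a m v η ↔ ContDiff ℝ m η ∧ ∀ j ≤ m, IsGridLimit M
      (fun n k => (M : ℂ) ^ (j * n) * (nabla^[j] ((sd M a)^[n] v)) k) (iteratedDeriv j η) :=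
  ⟨fun h => ⟨h.1, fun j hj K hK => h.2 K hK j hj⟩, fun h => ⟨h.1, fun K hK j hj => h.2 j hj K hK⟩⟩

variable {M : ℕ} (hM : 2 ≤ M)

include hM in
theorem one_le_cast_pow (n : ℕ) : (1 : ℝ) ≤ (M : ℝ) ^ n :=
  one_le_pow₀ (by exact_mod_cast (by lia : 1 ≤ M))

include hM in
theorem tendsto_inv_cast_pow : Tendsto (fun n : ℕ => ((M : ℝ) ^ n)⁻¹) atTop (𝓝 0) :=
  (tendsto_pow_atTop_atTop_of_one_lt (by exact_mod_cast (by lia : 1 < M))).inv_tendsto_atTop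

include hM in
theorem tendsto_floor_div (t : ℝ) :
    Tendsto (fun n : ℕ => (⌊(M : ℝ) ^ n * t⌋ : ℝ) / (M : ℝ) ^ n) atTop (𝓝 t) := by
  have h1 : Tendsto (fun n : ℕ => t - ((M : ℝ) ^ n)⁻¹) atTop (𝓝 t) := by
    simpa using (tendsto_inv_cast_pow hM).const_sub t
  refine tendsto_of_tendsto_of_tendsto_of_le_of_le h1 tendsto_const_nhds (fun n => ?_) fun n => ?_
  · have h2 : (0 : ℝ) < (M : ℝ) ^ n := by linarith [one_le_cast_pow hM n]
    have h3 := Int.lt_floor_add_one ((M : ℝ) ^ n * t)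
    beta_reduce
    rw [le_div_iff₀ h2, sub_mul, inv_mul_cancel₀ h2.ne']
    linarith
  · have h2 : (0 : ℝ) < (M : ℝ) ^ n := by linarith [one_le_cast_pow hM n]
    beta_reduce
    rw [div_le_iff₀ h2, mul_comm t]
    exact Int.floor_le _

include hM in
theorem tendsto_int_add_div {j : ℕ → ℤ} {t : ℝ}
    (h : Tendsto (fun n => (j n : ℝ) / (M : ℝ) ^ n) atTop (𝓝 t)) (r : ℤ) :
    Tendsto (fun n => ((j n + r : ℤ) : ℝ) / (M : ℝ) ^ n) atTop (𝓝 t) := by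
  have h1 := h.add ((tendsto_inv_cast_pow hM).const_mul (r : ℝ))
  rw [mul_zero, add_zero] at h1
  refine h1.congr fun n => ?_
  push_cast
  ring

namespace IsGridLimit

variable {x y : ℕ → ℤ → ℂ} {F G : ℝ → ℂ}

include hM in
-- The subsequence `φ` serves both for iterating in blocks of `ns` steps and for shifting `n` by
-- one.
theorem tendsto_comp (h : IsGridLimit M x F) {t : ℝ} (hF : ContinuousAt F t) {φ : ℕ → ℕ}
    (hφ : Tendsto φ atTop atTop) {j : ℕ → ℤ}
    (hj : Tendsto (fun n => (j n : ℝ) / (M : ℝ) ^ φ n) atTop (𝓝 t)) :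
    Tendsto (fun n => x (φ n) (j n)) atTop (𝓝 (F t)) := by
  have h1 : Tendsto (fun n => F ((j n : ℝ) / (M : ℝ) ^ φ n)) atTop (𝓝 (F t)) :=
    hF.tendsto.comp hj
  have h2 : Tendsto (fun n => x (φ n) (j n) - F ((j n : ℝ) / (M : ℝ) ^ φ n)) atTop (𝓝 0) := by
    rw [Metric.tendsto_nhds]
    intro ε hε
    have h3 : ∀ᶠ n in atTop, |(j n : ℝ) / (M : ℝ) ^ φ n| < |t| + 1 :=
      hj.abs.eventually_lt_const (by linarith)
    filter_upwards [hφ.eventually (h (|t| + 1) (by positivity) ε hε), h3] with n hn hn3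
    rw [dist_zero_right]
    refine hn _ ?_
    have h2 : (0 : ℝ) < (M : ℝ) ^ φ n := by linarith [one_le_cast_pow hM (φ n)]
    rw [abs_div, abs_of_pos h2, div_lt_iff₀ h2] at hn3
    linarith
  simpa using h2.add h1

include hM in
theorem tendsto (h : IsGridLimit M x F) {t : ℝ} (hF : ContinuousAt F t) {j : ℕ → ℤ}
    (hj : Tendsto (fun n => (j n : ℝ) / (M : ℝ) ^ n) atTop (𝓝 t)) :
    Tendsto (fun n => x n (j n)) atTop (𝓝 (F t)) :=
  h.tendsto_comp hM hF tendsto_id hj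

theorem of_norm_le {C q : ℝ} (hq0 : 0 ≤ q) (hq1 : q < 1)
    (h : ∀ n k, ‖x n k - F ((k : ℝ) / (M : ℝ) ^ n)‖ ≤ C * q ^ n) : IsGridLimit M x F := by
  intro K _ ε hε
  have h1 : Tendsto (fun n => C * q ^ n) atTop (𝓝 0) := by
    simpa using (tendsto_pow_atTop_nhds_zero_of_lt_one hq0 hq1).const_mul C
  filter_upwards [h1.eventually_lt_const hε] with n hn k _
  exact (h n k).trans_lt hn

include hM in
/-- Differences scaled by `M ^ n` converging to `G` force the limit to have derivative `G`. -/
theorem norm_sub_sub_le (hx : IsGridLimit M x F) (hy : IsGridLimit M y G) (hF : Continuous F)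
    (hxy : ∀ n k, nabla (x n) k = ((M : ℂ) ^ n)⁻¹ * y n k) {s t : ℝ} (hst : s ≤ t) {c : ℂ}
    {ε : ℝ} (hε : 0 < ε) (hG : ∀ u ∈ Set.Icc s t, ‖G u - c‖ ≤ ε) :
    ‖F t - F s - (t - s) * c‖ ≤ (ε + ε) * (t - s) := by
  have hlim : ∀ u : ℝ, Tendsto (fun n => x n ⌊(M : ℝ) ^ n * u⌋) atTop (𝓝 (F u)) := fun u =>
    hx.tendsto hM hF.continuousAt (tendsto_floor_div hM u)
  have hd : Tendsto (fun n : ℕ => ((⌊(M : ℝ) ^ n * t⌋ : ℝ) / (M : ℝ) ^ n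
      - (⌊(M : ℝ) ^ n * s⌋ : ℝ) / (M : ℝ) ^ n)) atTop (𝓝 (t - s)) :=
    (tendsto_floor_div hM t).sub (tendsto_floor_div hM s)
  have hd' : Tendsto (fun n : ℕ => (((⌊(M : ℝ) ^ n * t⌋ : ℝ) / (M : ℝ) ^ n
      - (⌊(M : ℝ) ^ n * s⌋ : ℝ) / (M : ℝ) ^ n : ℝ) : ℂ) * c) atTop (𝓝 ((t - s) * c)) := by
    simpa using ((Complex.continuous_ofReal.tendsto _).comp hd).mul_const c
  refine le_of_tendsto_of_tendsto (((hlim t).sub (hlim s)).sub hd').norm (hd.const_mul (ε + ε)) ?_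
  filter_upwards [hy (|s| + |t| + 1) (by positivity) ε hε] with n hn
  have hpos : (0 : ℝ) < (M : ℝ) ^ n := by linarith [one_le_cast_pow hM n]
  have hMC : ((M : ℂ) ^ n) ≠ 0 := by exact_mod_cast hpos.ne'
  set k := ⌊(M : ℝ) ^ n * s⌋ with hk
  set l := ⌊(M : ℝ) ^ n * t⌋ with hl
  have hkl : k ≤ l := Int.floor_le_floor (by gcongr)
  have hcast : ((l - k).toNat : ℝ) = l - k := by
    rw [← Int.cast_natCast, Int.toNat_of_nonneg (by lia)]
    push_cast
    rfl
  have hsum : x n l - x n k = ∑ i ∈ Finset.range (l - k).toNat, nabla (x n) (l - i) := by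
    rw [sum_range_nabla, Int.toNat_of_nonneg (by lia), sub_sub_cancel]
  have hsum2 : x n l - x n k - (((l : ℝ) / (M : ℝ) ^ n - (k : ℝ) / (M : ℝ) ^ n : ℝ) : ℂ) * c
      = ∑ i ∈ Finset.range (l - k).toNat, ((M : ℂ) ^ n)⁻¹ * (y n (l - i) - c) := by
    simp_rw [hsum, hxy, mul_sub]
    rw [Finset.sum_sub_distrib, Finset.sum_const, Finset.card_range, nsmul_eq_mul]
    congr 1
    have : (((l - k).toNat : ℝ) : ℂ) = l - k := by
      rw [hcast]
      push_cast
      rfl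
    rw [Complex.ofReal_natCast] at this
    rw [this]
    push_cast
    field_simp
  rw [hsum2]
  -- One `ε` is the grid error of `y`, the other the oscillation of `G` around `c`.
  refine (norm_sum_le _ _).trans ((Finset.sum_le_card_nsmul _ _ (((M : ℝ) ^ n)⁻¹ * (ε + ε))
    fun i hi => ?_).trans (le_of_eq ?_))
  · rw [norm_mul, norm_inv, norm_pow, Complex.norm_natCast]
    refine mul_le_mul_of_nonneg_left ?_ (by positivity)
    rw [Finset.mem_range] at hi
    -- The telescoped indices exceed `⌊M ^ n * s⌋`, so the corresponding grid points do not fall to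
    -- the left of `s`.
    have h1 : (M : ℝ) ^ n * s < ((l - i : ℤ) : ℝ) := by
      rw [← Int.floor_lt]
      lia
    have h2 : ((l - i : ℤ) : ℝ) ≤ (M : ℝ) ^ n * t := by
      rw [← Int.le_floor]
      lia
    have h3 : |((l - i : ℤ) : ℝ)| ≤ (M : ℝ) ^ n * (|s| + |t| + 1) := by
      rw [abs_le]
      constructor
      · nlinarith [neg_abs_le s, abs_nonneg t]
      · nlinarith [le_abs_self t, abs_nonneg s]
    have h4 := hG (((l - i : ℤ) : ℝ) / (M : ℝ) ^ n) ⟨by rw [le_div_iff₀ hpos]; linarith,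
      by rw [div_le_iff₀ hpos]; linarith⟩
    have h5 := norm_add_le (y n (l - i) - G (((l - i : ℤ) : ℝ) / (M : ℝ) ^ n))
      (G (((l - i : ℤ) : ℝ) / (M : ℝ) ^ n) - c)
    rw [sub_add_sub_cancel] at h5
    linarith [hn _ h3]
  · rw [Finset.card_range, nsmul_eq_mul, hcast]
    ring

include hM in
theorem hasDerivAt (hx : IsGridLimit M x F) (hy : IsGridLimit M y G) (hF : Continuous F)
    (hG : Continuous G) (hxy : ∀ n k, nabla (x n) k = ((M : ℂ) ^ n)⁻¹ * y n k) (t : ℝ) :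
    HasDerivAt F (G t) t := by
  rw [hasDerivAt_iff_isLittleO, Asymptotics.isLittleO_iff]
  intro ε hε
  obtain ⟨δ, hδ, h⟩ := Metric.continuousAt_iff.1 (hG.continuousAt (x := t)) (ε / 2) (by positivity)
  filter_upwards [Metric.ball_mem_nhds t hδ] with u hu
  rw [Metric.mem_ball, Real.dist_eq, abs_lt] at hu
  have hG' : ∀ w, |w - t| < δ → ‖G w - G t‖ ≤ ε / 2 := fun w hw => by
    rw [← dist_eq_norm]
    exact (h (by rwa [Real.dist_eq])).le
  rw [Complex.real_smul, Complex.ofReal_sub, Real.norm_eq_abs]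
  rcases le_total t u with htu | htu
  · rw [abs_of_nonneg (by linarith)]
    refine (norm_sub_sub_le hM hx hy hF hxy htu (half_pos hε) fun w hw => hG' w ?_).trans
      (le_of_eq (by ring))
    rw [abs_lt]
    constructor <;> linarith [hw.1, hw.2]
  · rw [abs_of_nonpos (by linarith), ← norm_neg]
    refine le_trans (le_of_eq ?_) ((norm_sub_sub_le hM hx hy hF hxy htu (half_pos hε)
      (c := G t) fun w hw => hG' w ?_).trans (le_of_eq (by ring)))
    · congr 1
      ring
    · rw [abs_lt]
      constructor <;> linarith [hw.1, hw.2]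

end IsGridLimit

include hM in
/-- Data changing by geometrically decreasing amounts, with geometrically decreasing differences,
converge to a continuous function. -/
theorem exists_continuous_limit {x : ℕ → ℤ → ℂ} {C q : ℝ} (hq0 : 0 ≤ q) (hq1 : q < 1)
    (h1 : ∀ n k, ‖x (n + 1) k - x n (k / M)‖ ≤ C * q ^ n) (h2 : ∀ n k, ‖nabla (x n) k‖ ≤ C * q ^ n) :
    ∃ F : ℝ → ℂ, Continuous F ∧ IsGridLimit M x F := by
  set g : ℕ → ℝ → ℂ := fun n t => x n ⌊(M : ℝ) ^ n * t⌋ with hg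
  have hdist : ∀ t n, dist (g n t) (g (n + 1) t) ≤ C * q ^ n := fun t n => by
    rw [dist_comm, dist_eq_norm]
    -- The cells of successive grids are nested, so the hypothesis compares `g n` and `g (n + 1)` at
    -- the same `t`.
    have h3 : ⌊(M : ℝ) ^ n * t⌋ = ⌊(M : ℝ) ^ (n + 1) * t⌋ / M := by
      rw [pow_succ', mul_assoc]
      exact (Int.natCast_mul_floor_div_cancel (by lia) _).symm
    simp only [hg, h3]
    exact h1 n _
  choose F hF using fun t => cauchySeq_tendsto_of_complete
    (cauchySeq_of_le_geometric q C hq1 (hdist t))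
  have hle : ∀ n t, ‖g n t - F t‖ ≤ C / (1 - q) * q ^ n := fun n t => by
    rw [← dist_eq_norm]
    exact (dist_le_of_le_geometric_of_tendsto q C hq1 (hdist t) (hF t) n).trans
      (le_of_eq (by ring))
  refine ⟨F, ?_, IsGridLimit.of_norm_le hq0 hq1 (C := C / (1 - q)) fun n k => ?_⟩
  · rw [continuous_iff_continuousAt]
    intro t
    rw [Metric.continuousAt_iff]
    intro ε hε
    have h3 : Tendsto (fun n => (C / (1 - q) + C + C / (1 - q)) * q ^ n) atTop (𝓝 0) := by
      simpa using (tendsto_pow_atTop_nhds_zero_of_lt_one hq0 hq1).const_mul _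
    obtain ⟨n, hn⟩ := (h3.eventually_lt_const hε).exists
    have hpos : (0 : ℝ) < (M : ℝ) ^ n := by linarith [one_le_cast_pow hM n]
    -- Points closer than one cell have floor indices differing by at most one.
    refine ⟨((M : ℝ) ^ n)⁻¹, by positivity, fun {u} hu => ?_⟩
    have hC : 0 ≤ C * q ^ n := (norm_nonneg _).trans (h2 n 0)
    have h4 : ‖g n u - g n t‖ ≤ C * q ^ n := by
      refine (norm_sub_le_of_norm_nabla_le (h2 n) _ _).trans (mul_le_of_le_one_left hC ?_)
      have h5 : |(M : ℝ) ^ n * u - (M : ℝ) ^ n * t| < 1 := by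
        rw [← mul_sub, abs_mul, abs_of_pos hpos, mul_comm, ← lt_div_iff₀ hpos, one_div]
        exact hu
      rw [abs_lt] at h5
      have a1 : ⌊(M : ℝ) ^ n * u⌋ ≤ ⌊(M : ℝ) ^ n * t⌋ + 1 := by
        rw [← Int.lt_add_one_iff, Int.floor_lt]
        push_cast
        linarith [Int.lt_floor_add_one ((M : ℝ) ^ n * t)]
      have a2 : ⌊(M : ℝ) ^ n * t⌋ ≤ ⌊(M : ℝ) ^ n * u⌋ + 1 := by
        rw [← Int.lt_add_one_iff, Int.floor_lt]
        push_cast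
        linarith [Int.lt_floor_add_one ((M : ℝ) ^ n * u)]
      rw [← Int.cast_sub, ← Int.cast_abs]
      exact_mod_cast abs_le.2 ⟨by lia, by lia⟩
    calc dist (F u) (F t) = ‖-(g n u - F u) + (g n u - g n t) + (g n t - F t)‖ := by
          rw [dist_eq_norm]
          congr 1
          ring
      _ ≤ ‖g n u - F u‖ + ‖g n u - g n t‖ + ‖g n t - F t‖ := by
          refine norm_add₃_le.trans ?_
          rw [norm_neg]
      _ ≤ _ := add_le_add_three (hle n u) h4 (hle n t)
      _ = (C / (1 - q) + C + C / (1 - q)) * q ^ n := by ring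
      _ < ε := hn
  · have h3 := hle n ((k : ℝ) / (M : ℝ) ^ n)
    have hpos : (0 : ℝ) < (M : ℝ) ^ n := by linarith [one_le_cast_pow hM n]
    simp only [hg] at h3
    rwa [mul_div_cancel₀ _ hpos.ne', Int.floor_intCast] at h3

end GridLimits

/-! ### From `ρ_J < M ^ (-m)` to `C^m` convergence. -/

section Convergence

/-- The scaled differences `M ^ (i n) ∇ ^ i S ^ n δ`. -/
noncomputable def scaledDiff (M : ℕ) (a : ℤ →₀ ℂ) (i n : ℕ) : ℤ → ℂ :=
  fun k => (M : ℂ) ^ (i * n) * nabla^[i] ((sd M a)^[n] dirac) k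

variable {M : ℕ} (hM : 2 ≤ M)

theorem norm_scaledDiff (a : ℤ →₀ ℂ) (i n : ℕ) (k : ℤ) : ‖scaledDiff M a i n k‖
    = (M : ℝ) ^ (i * n) * ‖nabla^[i] ((sd M a)^[n] dirac) k‖ := by
  rw [scaledDiff, norm_mul, norm_pow, Complex.norm_natCast]

theorem norm_scaledDiff_zero_le (a : ℤ →₀ ℂ) (i : ℕ) (k : ℤ) :
    ‖scaledDiff M a i 0 k‖ ≤ 2 ^ i := by
  rw [norm_scaledDiff, mul_zero, pow_zero, one_mul, ← mul_one (2 ^ i)]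
  refine norm_nabla_iterate_le i (fun k => ?_) k
  simp only [Function.iterate_zero, id_eq, dirac]
  split_ifs <;> simp

include hM in
theorem nabla_scaledDiff (a : ℤ →₀ ℂ) (i n : ℕ) (k : ℤ) :
    nabla (scaledDiff M a i n) k = ((M : ℂ) ^ n)⁻¹ * scaledDiff M a (i + 1) n k := by
  have hM0 : (M : ℂ) ≠ 0 := by exact_mod_cast (by lia : M ≠ 0)
  unfold scaledDiff
  rw [nabla_const_mul, Function.iterate_succ_apply', add_mul, one_mul, pow_add]
  field_simp

include hM in
theorem norm_nabla_scaledDiff (a : ℤ →₀ ℂ) (i n : ℕ) (k : ℤ) :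
    ‖nabla (scaledDiff M a i n) k‖ = ((M : ℝ) ^ n)⁻¹ * ‖scaledDiff M a (i + 1) n k‖ := by
  rw [nabla_scaledDiff hM, norm_mul, norm_inv, norm_pow, Complex.norm_natCast]

include hM in
theorem scaledDiff_succ {a c : ℤ →₀ ℂ} {i : ℕ} (hc : a = (nbox M)^[i] c) (n : ℕ) :
    scaledDiff M a i (n + 1) = sd M c (scaledDiff M a i n) := by
  have h : ∀ n, scaledDiff M a i n = (sd M c)^[n] (nabla^[i] dirac) := fun n => by
    funext k
    rw [scaledDiff, hc, nabla_iterate_sd_iterate_nbox hM]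
  rw [h, h, Function.iterate_succ_apply']

include hM in
-- Because `i < J`, the mask left after removing `i` box factors still has one, so its scheme
-- preserves constants and moves the data only by the size of their differences.
theorem exists_norm_scaledDiff_sub_le {a : ℤ →₀ ℂ} (ha : (a.sum fun _ x => x) = 1) {i J : ℕ}
    (hi : i < J) (h : ∃ c, a = (nbox M)^[J] c) :
    ∃ C : ℝ, 0 ≤ C ∧ ∀ (n : ℕ) (B : ℝ), (∀ k, ‖nabla (scaledDiff M a i n) k‖ ≤ B) →
      ∀ k, ‖scaledDiff M a i (n + 1) k - scaledDiff M a i n (k / M)‖ ≤ C * B := by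
  obtain ⟨d, hd⟩ := exists_nbox_iterate_of_le (Nat.succ_le_of_lt hi) h
  have hd1 : (d.sum fun _ x => x) = 1 := by rw [← ha, hd, sum_nbox_iterate hM]
  rw [Function.iterate_succ_apply] at hd
  obtain ⟨C, hC, hCB⟩ := exists_norm_sd_sub_le hM (sd_nbox_one hM hd1)
  refine ⟨C, hC, fun n B hB k => ?_⟩
  rw [scaledDiff_succ hM hd]
  exact hCB _ B hB k

include hM in
/-- If the scaled differences of order `i + 1` grow at a geometric rate larger than `M`, those of
order `i` grow at that rate divided by `M`. -/
theorem exists_norm_scaledDiff_le_of_succ {a : ℤ →₀ ℂ} (ha : (a.sum fun _ x => x) = 1) {i J : ℕ}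
    (hi : i < J) (h : ∃ c, a = (nbox M)^[J] c) {r : ℝ} (hr : 1 < r)
    (h1 : ∃ C, ∀ n k, ‖scaledDiff M a (i + 1) n k‖ ≤ C * (M * r) ^ n) :
    ∃ C, ∀ n k, ‖scaledDiff M a i n k‖ ≤ C * r ^ n := by
  have hM0 : (0 : ℝ) < M := by exact_mod_cast (by lia : 0 < M)
  obtain ⟨C, hC⟩ := h1
  have hC0 : 0 ≤ C := by simpa using (norm_nonneg _).trans (hC 0 0)
  obtain ⟨D, hD, hDB⟩ := exists_norm_scaledDiff_sub_le hM ha hi h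
  have hnab : ∀ n k, ‖nabla (scaledDiff M a i n) k‖ ≤ C * r ^ n := fun n k => by
    rw [norm_nabla_scaledDiff hM, inv_mul_le_iff₀ (by positivity)]
    refine (hC n k).trans (le_of_eq ?_)
    rw [mul_pow]
    ring
  -- The second summand absorbs the increments `D * C * r ^ n`, whose geometric sum is of order `r ^
  -- n`; the first covers `n = 0`.
  refine ⟨2 ^ i + D * C / (r - 1), fun n => ?_⟩
  induction n with
  | zero =>
    intro k
    refine (norm_scaledDiff_zero_le a i k).trans ?_
    rw [pow_zero, mul_one]
    exact le_add_of_nonneg_right (div_nonneg (by positivity) (by linarith))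
  | succ n ih =>
    intro k
    have h2 := norm_add_le (scaledDiff M a i (n + 1) k - scaledDiff M a i n (k / M))
      (scaledDiff M a i n (k / M))
    rw [sub_add_cancel] at h2
    refine h2.trans ((add_le_add (hDB n _ (hnab n) k) (ih _)).trans ?_)
    have h3 : 0 ≤ (2 : ℝ) ^ i * r ^ n * (r - 1) := mul_nonneg (by positivity) (by linarith)
    have h4 : r - 1 ≠ 0 := by linarith
    have h5 : (2 ^ i + D * C / (r - 1)) * r ^ (n + 1)
        = D * (C * r ^ n) + (2 ^ i + D * C / (r - 1)) * r ^ n + 2 ^ i * r ^ n * (r - 1) := by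
      field_simp
      ring
    linarith

include hM in
-- The increments from one level to the next are dominated by a summable geometric series.
theorem exists_norm_scaledDiff_le_of_nabla {a : ℤ →₀ ℂ} (ha : (a.sum fun _ x => x) = 1)
    {i J : ℕ} (hi : i < J) (h : ∃ c, a = (nbox M)^[J] c) {C q : ℝ} (hq0 : 0 ≤ q) (hq1 : q < 1)
    (hC : ∀ n k, ‖nabla (scaledDiff M a i n) k‖ ≤ C * q ^ n) :
    ∃ B, ∀ n k, ‖scaledDiff M a i n k‖ ≤ B := by
  have hC0 : 0 ≤ C := by simpa using (norm_nonneg _).trans (hC 0 0)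
  obtain ⟨D, hD, hDB⟩ := exists_norm_scaledDiff_sub_le hM ha hi h
  have key : ∀ n k, ‖scaledDiff M a i n k‖ ≤ 2 ^ i + D * C * (1 - q ^ n) / (1 - q) := by
    intro n
    induction n with
    | zero => simpa using norm_scaledDiff_zero_le a i
    | succ n ih =>
      intro k
      have h2 := norm_add_le (scaledDiff M a i (n + 1) k - scaledDiff M a i n (k / M))
        (scaledDiff M a i n (k / M))
      rw [sub_add_cancel] at h2
      refine h2.trans ((add_le_add (hDB n _ (hC n) k) (ih _)).trans (le_of_eq ?_))
      have h4 : 1 - q ≠ 0 := by linarith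
      field_simp
      ring
  refine ⟨2 ^ i + D * C / (1 - q), fun n k => (key n k).trans ?_⟩
  have : 0 < 1 - q := by linarith
  have h5 : D * C * (1 - q ^ n) ≤ D * C :=
    mul_le_of_le_one_right (by positivity) (by linarith [pow_nonneg hq0 n])
  gcongr

include hM in
-- The rate known at order `J` is carried down. As long as it exceeds `1`, lowering the order
-- divides it by `M`; at order `m` the differences decay, and below `m` boundedness alone makes them
-- decay like `M ^ (-n)`. Each order `i ≤ m` then has a continuous limit, and each limit is the
-- derivative of the preceding one.
theorem exists_isLimitFunction_dirac {a : ℤ →₀ ℂ} (ha : (a.sum fun _ x => x) = 1) {m J : ℕ}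
    (hmJ : m < J) (h : ∃ c, a = (nbox M)^[J] c) (hρ : rhoInfty M a J < ((M : ℝ) ^ m)⁻¹) :
    ∃ f : ℝ → ℂ, IsLimitFunction M a m dirac f := by
  have hM1 : (1 : ℝ) < M := by exact_mod_cast (by lia : 1 < M)
  have hM0 : (0 : ℝ) < M := by linarith
  -- `θ < M ^ (-m)` makes the differences of the order `m` data decay, while `θ > M ^ (-(m + 1))`
  -- keeps the rates `M ^ i * θ` with `i > m` above `1`, as the descent requires.
  obtain ⟨θ, hθ, hθm⟩ := exists_between (max_lt hρ (inv_strictAnti₀ (by positivity)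
    (pow_lt_pow_right₀ hM1 m.lt_succ_self)))
  rw [max_lt_iff] at hθ
  have hθ0 : 0 < θ := (by positivity : (0 : ℝ) < ((M : ℝ) ^ (m + 1))⁻¹).trans hθ.2
  -- the differences of order `J`
  have hJ : ∃ C, ∀ n k, ‖scaledDiff M a J n k‖ ≤ C * ((M : ℝ) ^ J * θ) ^ n := by
    obtain ⟨N, hN⟩ := eventually_atTop.1 (eventually_norm_nabla_le_of_rhoInfty_lt hM hθ.1)
    obtain ⟨C, T, hC, hT, hCT⟩ := exists_supNorm_nabla_le hM a J
    -- The sum takes care of the finitely many `n` to which the limsup says nothing.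
    refine ⟨1 + ∑ n ∈ Finset.range N, C * T ^ n / θ ^ n, fun n k => ?_⟩
    have hS : 0 ≤ ∑ n ∈ Finset.range N, C * T ^ n / θ ^ n :=
      Finset.sum_nonneg fun _ _ => by positivity
    rw [norm_scaledDiff, mul_pow, ← pow_mul, mul_left_comm]
    refine mul_le_mul_of_nonneg_left ?_ (by positivity)
    rcases lt_or_ge n N with hn | hn
    · obtain ⟨L, hL⟩ := supportedIn_nabla_iterate_sd_iterate hM a J n
      refine ((hL.norm_le_supNorm k).trans (hCT n)).trans ?_
      rw [← div_le_iff₀ (by positivity)]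
      have := Finset.single_le_sum (f := fun n => C * T ^ n / θ ^ n)
        (fun _ _ => by positivity) (Finset.mem_range.2 hn)
      linarith
    · exact (hN n hn k).trans (le_mul_of_one_le_left (by positivity) (by linarith))
  have hm1 : ∃ C, ∀ n k, ‖scaledDiff M a (m + 1) n k‖ ≤ C * ((M : ℝ) ^ (m + 1) * θ) ^ n := by
    refine Nat.decreasingInduction' (P := fun i =>
      ∃ C, ∀ n k, ‖scaledDiff M a i n k‖ ≤ C * ((M : ℝ) ^ i * θ) ^ n) (fun i hi hmi ih => ?_)
      hmJ hJ
    refine exists_norm_scaledDiff_le_of_succ hM ha hi h ?_ (by simpa [pow_succ', mul_assoc] using ih)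
    have h1 : 1 < (M : ℝ) ^ (m + 1) * θ := by
      rw [← inv_lt_iff_one_lt_mul₀' (by positivity)]
      exact hθ.2
    exact h1.trans_le (by gcongr; exact hM1.le)
  have hnab : ∀ i ≤ m, ∃ C q, 0 ≤ q ∧ q < 1 ∧ ∀ n k, ‖nabla (scaledDiff M a i n) k‖ ≤ C * q ^ n := by
    intro i hi
    refine Nat.decreasingInduction' (P := fun i => ∃ C q, 0 ≤ q ∧ q < 1 ∧
      ∀ n k, ‖nabla (scaledDiff M a i n) k‖ ≤ C * q ^ n) (fun i hi' _ ih => ?_) hi ?_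
    · obtain ⟨C, q, hq0, hq1, hC⟩ := ih
      obtain ⟨B, hB⟩ := exists_norm_scaledDiff_le_of_nabla hM ha (by lia) h hq0 hq1 hC
      refine ⟨B, (M : ℝ)⁻¹, by positivity, inv_lt_one_of_one_lt₀ hM1, fun n k => ?_⟩
      rw [norm_nabla_scaledDiff hM, mul_comm, inv_pow]
      exact mul_le_mul_of_nonneg_right (hB n k) (by positivity)
    · obtain ⟨C, hC⟩ := hm1
      refine ⟨C, (M : ℝ) ^ m * θ, by positivity, ?_, fun n k => ?_⟩
      · rwa [← lt_inv_mul_iff₀ (by positivity), mul_one]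
      · rw [norm_nabla_scaledDiff hM, inv_mul_le_iff₀ (by positivity)]
        refine (hC n k).trans (le_of_eq ?_)
        rw [pow_succ, mul_pow, mul_pow, mul_pow]
        ring
  have hF : ∀ i, ∃ F : ℝ → ℂ, i ≤ m → Continuous F ∧ IsGridLimit M (scaledDiff M a i) F := by
    intro i
    by_cases hi : i ≤ m
    · obtain ⟨C, q, hq0, hq1, hC⟩ := hnab i hi
      have hC0 : 0 ≤ C := by simpa using (norm_nonneg _).trans (hC 0 0)
      obtain ⟨D, hD, hDB⟩ := exists_norm_scaledDiff_sub_le hM ha (hi.trans_lt hmJ) h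
      obtain ⟨F, hF⟩ := exists_continuous_limit hM (x := scaledDiff M a i) (C := max C (D * C))
        hq0 hq1 (fun n k => (hDB n _ (hC n) k).trans (by
          rw [← mul_assoc]
          gcongr
          exact le_max_right _ _)) fun n k => (hC n k).trans (by
          gcongr
          exact le_max_left _ _)
      exact ⟨F, fun _ => hF⟩
    · exact ⟨0, fun h => absurd h hi⟩
  choose F hF using hF
  have hder : ∀ i < m, ∀ t, HasDerivAt (F i) (F (i + 1) t) t := fun i hi t =>
    (hF i hi.le).2.hasDerivAt hM (hF (i + 1) hi).2 (hF i hi.le).1 (hF (i + 1) hi).1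
      (nabla_scaledDiff hM a i) t
  have hiter : ∀ i ≤ m, iteratedDeriv i (F 0) = F i := by
    intro i
    induction i with
    | zero => exact fun _ => iteratedDeriv_zero
    | succ i ih =>
      intro hi
      rw [iteratedDeriv_succ, ih (by lia)]
      exact funext fun t => (hder i (by lia) t).deriv
  refine ⟨F 0, isLimitFunction_iff.2 ⟨contDiff_nat_iff_iteratedDeriv.2 ⟨fun i hi => ?_,
    fun i hi => ?_⟩, fun i hi => ?_⟩⟩
  · rw [hiter i hi]
    exact (hF i hi).1
  · rw [hiter i hi.le]
    exact fun t => (hder i hi t).differentiableAt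
  · rw [hiter i hi]
    exact (hF i hi).2

end Convergence

/-! ### Limit functions: support, refinement equation, superposition and sampling. -/

section LimitFunctions

variable {M : ℕ} (hM : 2 ≤ M) {a : ℤ →₀ ℂ} {m : ℕ}

namespace IsLimitFunction

variable {v : ℤ → ℂ} {η : ℝ → ℂ}

theorem isGridLimit (h : IsLimitFunction M a m v η) :
    IsGridLimit M (fun n => (sd M a)^[n] v) η := by
  simpa using (isLimitFunction_iff.1 h).2 0 (Nat.zero_le _)

include hM in
theorem tendsto (h : IsLimitFunction M a m v η) {t : ℝ} {j : ℕ → ℤ}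
    (hj : Tendsto (fun n => (j n : ℝ) / (M : ℝ) ^ n) atTop (𝓝 t)) :
    Tendsto (fun n => (sd M a)^[n] v (j n)) atTop (𝓝 (η t)) :=
  h.isGridLimit.tendsto hM h.1.continuous.continuousAt hj

include hM in
theorem unique {η' : ℝ → ℂ} (h : IsLimitFunction M a m v η) (h' : IsLimitFunction M a m v η') :
    η = η' :=
  funext fun t => tendsto_nhds_unique (h.tendsto hM (tendsto_floor_div hM t))
    (h'.tendsto hM (tendsto_floor_div hM t))

variable {f : ℝ → ℂ}

include hM in
theorem eq_zero_of_lt_abs (h : IsLimitFunction M a m dirac f) {R : ℕ} (hR : SupportedIn R a)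
    {x : ℝ} (hx : (R : ℝ) < |x|) : f x = 0 := by
  have h1 := tendsto_floor_div hM x
  refine tendsto_nhds_unique (h.tendsto hM h1) (tendsto_const_nhds.congr' ?_)
  filter_upwards [h1.abs.eventually_const_lt hx] with n hn
  have hs := hR.sd_iterate hM (by lia) supportedIn_dirac n
  rw [add_zero] at hs
  refine (hs _ ?_).symm
  have hpos : (0 : ℝ) < (M : ℝ) ^ n := by linarith [one_le_cast_pow hM n]
  rw [abs_div, abs_of_pos hpos, lt_div_iff₀ hpos] at hn
  exact_mod_cast hn

include hM in
theorem exists_eq_zero (h : IsLimitFunction M a m dirac f) :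
    ∃ R : ℕ, ∀ x : ℝ, (R : ℝ) < |x| → f x = 0 := by
  obtain ⟨R, hR⟩ := exists_supportedIn a
  exact ⟨R, fun x hx => h.eq_zero_of_lt_abs hM hR hx⟩

include hM in
/-- The limit function of the Dirac sequence is refinable. -/
theorem refinement (h : IsLimitFunction M a m dirac f) (p : ℕ) (x : ℝ) :
    f x = ∑' k : ℤ, (sd M a)^[p] dirac k * f ((M : ℝ) ^ p * x - k) := by
  obtain ⟨L, hL⟩ := exists_supportedIn_sd_iterate hM a supportedIn_dirac p
  have hp : (0 : ℝ) < (M : ℝ) ^ p := by linarith [one_le_cast_pow hM p]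
  -- `S^(n + p) δ` is `S^n` applied to the data `S^p δ`; the limit `n → ∞` is taken in its finite
  -- expansion into translates of `S^n δ`.
  have h1 : Tendsto (fun n : ℕ => (⌊(M : ℝ) ^ (n + p) * x⌋ : ℝ) / (M : ℝ) ^ (n + p)) atTop (𝓝 x) :=
    (tendsto_add_atTop_iff_nat (f := fun n : ℕ => (⌊(M : ℝ) ^ n * x⌋ : ℝ) / (M : ℝ) ^ n) p).2
      (tendsto_floor_div hM x)
  have h2 := (tendsto_add_atTop_iff_nat p).2 (h.tendsto hM (tendsto_floor_div hM x))
  refine tendsto_nhds_unique h2 ?_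
  rw [(hL.mul_right _).tsum_eq]
  have h3 : ∀ k : ℤ, Tendsto (fun n : ℕ =>
      ((⌊(M : ℝ) ^ (n + p) * x⌋ - (M : ℤ) ^ n * k : ℤ) : ℝ) / (M : ℝ) ^ n) atTop
      (𝓝 ((M : ℝ) ^ p * x - k)) := fun k => by
    refine ((h1.const_mul ((M : ℝ) ^ p)).sub_const (k : ℝ)).congr fun n => ?_
    have hn : (0 : ℝ) < (M : ℝ) ^ n := by linarith [one_le_cast_pow hM n]
    push_cast
    rw [pow_add]
    field_simp
  refine (tendsto_finsetSum _ fun k _ => (h.tendsto hM (h3 k)).const_mul _).congr fun n => ?_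
  rw [Function.iterate_add_apply, sd_iterate_apply hM, (hL.mul_right _).tsum_eq]

end IsLimitFunction

section Superposition

variable {f : ℝ → ℂ} {R : ℕ} (hf : ∀ x : ℝ, (R : ℝ) < |x| → f x = 0)

/-- The function `∑ l, v l * f (· - l)`, a locally finite sum for compactly supported `f`. -/
noncomputable def superposition (v : ℤ → ℂ) (f : ℝ → ℂ) (x : ℝ) : ℂ :=
  ∑' l : ℤ, v l * f (x - l)

include hf in
theorem superposition_eq {K : ℕ} (v : ℤ → ℂ) {x : ℝ} (hx : |x| ≤ K) {L : ℕ} (hL : K + R ≤ L) :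
    superposition v f x = ∑ l ∈ Finset.Icc (-(L : ℤ)) L, v l * f (x - l) := by
  refine tsum_eq_sum fun l hl => ?_
  rw [hf, mul_zero]
  rw [Finset.mem_Icc, ← abs_le, not_le] at hl
  have h1 := abs_sub_abs_le_abs_sub (l : ℝ) x
  rw [abs_sub_comm] at h1
  have h2 : (L : ℝ) < |(l : ℝ)| := by exact_mod_cast hl
  have h3 : (K : ℝ) + R ≤ L := by exact_mod_cast hL
  linarith

include hf in
theorem superposition_eventuallyEq {K : ℕ} (v : ℤ → ℂ) {x : ℝ} (hx : |x| < K) {L : ℕ}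
    (hL : K + R ≤ L) :
    superposition v f =ᶠ[𝓝 x] fun x => ∑ l ∈ Finset.Icc (-(L : ℤ)) L, v l * f (x - l) := by
  filter_upwards [continuous_abs.continuousAt.eventually_lt continuousAt_const hx] with y hy
  exact superposition_eq hf v hy.le hL

include hf in
theorem contDiff_superposition (hc : ContDiff ℝ m f) (v : ℤ → ℂ) :
    ContDiff ℝ m (superposition v f) := by
  rw [contDiff_iff_contDiffAt]
  intro x
  obtain ⟨K, hK⟩ := exists_nat_gt |x|
  refine ContDiffAt.congr_of_eventuallyEq ?_ (superposition_eventuallyEq hf v hK le_rfl)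
  refine ContDiff.contDiffAt (ContDiff.sum fun l _ => contDiff_const.mul
    (hc.comp (contDiff_id.sub contDiff_const)))

include hf in
theorem iteratedDeriv_superposition (hc : ContDiff ℝ m f) {j : ℕ} (hj : j ≤ m) (v : ℤ → ℂ) {K : ℕ}
    {x : ℝ} (hx : |x| < K) {L : ℕ} (hL : K + R ≤ L) :
    iteratedDeriv j (superposition v f) x
      = ∑ l ∈ Finset.Icc (-(L : ℤ)) L, v l * iteratedDeriv j f (x - l) := by
  have hc' : ∀ l : ℤ, ContDiff ℝ j fun x : ℝ => f (x - l) := fun l =>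
    (hc.of_le (by exact_mod_cast hj)).comp (contDiff_id.sub contDiff_const)
  rw [(superposition_eventuallyEq hf v hx hL).iteratedDeriv_eq,
    iteratedDeriv_fun_sum fun l _ => (contDiff_const.mul (hc' l)).contDiffAt]
  refine Finset.sum_congr rfl fun l _ => ?_
  rw [iteratedDeriv_const_mul_field, iteratedDeriv_comp_sub_const]

include hM in
/-- The limit function for the data `v` is the superposition of the translates of the limit
function of the Dirac sequence. -/
theorem IsLimitFunction.superposition (h : IsLimitFunction M a m dirac f) (v : ℤ → ℂ) :
    IsLimitFunction M a m v (superposition v f) := by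
  obtain ⟨R, hR⟩ := exists_supportedIn a
  have hf : ∀ x : ℝ, (R : ℝ) < |x| → f x = 0 := fun x hx => h.eq_zero_of_lt_abs hM hR hx
  refine isLimitFunction_iff.2 ⟨contDiff_superposition hf h.1 v, fun j hj K hK ε hε => ?_⟩
  obtain ⟨K', hK'⟩ := exists_nat_gt K
  -- Translates by `|l| > L` do not meet `[-K', K']`; the extra `j` allows for the widening of the
  -- support by `j` differences.
  set L : ℕ := K' + (R + j) with hL
  set V : ℝ := ∑ l ∈ Finset.Icc (-(L : ℤ)) L, ‖v l‖ with hV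
  have hV0 : 0 ≤ V := Finset.sum_nonneg fun _ _ => norm_nonneg _
  filter_upwards [(isLimitFunction_iff.1 h).2 j hj (K + L) (by positivity) (ε / (V + 1))
    (by positivity)] with n hn k hk
  have hpos : (0 : ℝ) < (M : ℝ) ^ n := by linarith [one_le_cast_pow hM n]
  have hx : |(k : ℝ) / (M : ℝ) ^ n| < K' := by
    rw [abs_div, abs_of_pos hpos, div_lt_iff₀ hpos]
    nlinarith
  have hs := (hR.sd_iterate hM (by lia) supportedIn_dirac n).nabla_iterate j
  have hsum : nabla^[j] ((sd M a)^[n] v) k = ∑ l ∈ Finset.Icc (-(L : ℤ)) L,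
      v l * nabla^[j] ((sd M a)^[n] dirac) (k - (M : ℤ) ^ n * l) := by
    rw [nabla_iterate_sd_iterate_apply hM]
    refine tsum_eq_sum fun l hl => ?_
    rw [hs, mul_zero]
    rw [Finset.mem_Icc, ← abs_le, not_le] at hl
    have hN := one_le_natCast_pow hM n
    have h1 := abs_sub_abs_le_abs_sub ((M : ℤ) ^ n * l) k
    rw [abs_sub_comm, abs_mul, abs_of_nonneg (by lia : 0 ≤ (M : ℤ) ^ n)] at h1
    have h2 : |k| ≤ (M : ℤ) ^ n * K' := by
      have : |(k : ℝ)| ≤ (M : ℝ) ^ n * K' := hk.trans (by gcongr)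
      exact_mod_cast this
    have h3 : (M : ℤ) ^ n * (K' + (R + j) + 1) ≤ (M : ℤ) ^ n * |l| :=
      mul_le_mul_of_nonneg_left (by rw [hL] at hl; push_cast at hl; lia) (by lia)
    nlinarith
  rw [hsum, iteratedDeriv_superposition hf h.1 hj v hx (L := L) (by lia), Finset.mul_sum,
    ← Finset.sum_sub_distrib]
  have hle : ∀ l ∈ Finset.Icc (-(L : ℤ)) L, ‖(M : ℂ) ^ (j * n) *
      (v l * nabla^[j] ((sd M a)^[n] dirac) (k - (M : ℤ) ^ n * l))
      - v l * iteratedDeriv j f ((k : ℝ) / (M : ℝ) ^ n - l)‖ ≤ ‖v l‖ * (ε / (V + 1)) := by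
    intro l hl
    rw [mul_left_comm, ← mul_sub, norm_mul]
    refine mul_le_mul_of_nonneg_left ?_ (norm_nonneg _)
    have h1 := hn (k - (M : ℤ) ^ n * l) ?_
    · have h2 : ((k - (M : ℤ) ^ n * l : ℤ) : ℝ) / (M : ℝ) ^ n = (k : ℝ) / (M : ℝ) ^ n - l := by
        push_cast
        field_simp
      rw [h2] at h1
      exact h1.le
    · push_cast
      have h2 : |(l : ℝ)| ≤ L := by
        rw [Finset.mem_Icc, ← abs_le] at hl
        exact_mod_cast hl
      refine (abs_sub _ _).trans ?_
      rw [abs_mul, abs_of_pos hpos, mul_add]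
      gcongr
  refine (norm_sum_le_of_le _ hle).trans_lt ?_
  rw [← Finset.sum_mul, ← hV, mul_div_assoc', div_lt_iff₀ (by positivity)]
  nlinarith

include hM in
theorem isCmConvergent_of_dirac (h : IsLimitFunction M a m dirac f) : IsCmConvergent M a m :=
  fun v => ⟨_, h.superposition hM v⟩

end Superposition

section Sampling

variable {f : ℝ → ℂ} {s : ℝ}

theorem superposition_add_int (hs : ∀ k : ℤ, f (s + k) = dirac k) (v : ℤ → ℂ) (k : ℤ) :
    superposition v f (s + k) = v k := by
  unfold superposition
  have h : ∀ l : ℤ, f (s + k - l) = dirac (k - l) := fun l => by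
    rw [← hs]
    push_cast
    congr 1
    ring
  simp_rw [h]
  rw [tsum_eq_single k fun l hl => by simp [dirac, sub_eq_zero, hl.symm]]
  simp [dirac]

/-- Evaluated at `(s + j) / M ^ p`, the refinement equation involves `f` only on `s + ℤ`, where a
single term survives. Interpolation thus makes the iterates exact samples of `f`. -/
theorem sd_iterate_dirac_eq (hs : ∀ k : ℤ, f (s + k) = dirac k) {p : ℕ} (hM : 2 ≤ M)
    (href : ∀ x, f x = ∑' k : ℤ, (sd M a)^[p] dirac k * f ((M : ℝ) ^ p * x - k)) (j : ℤ) :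
    (sd M a)^[p] dirac j = f ((s + j) / (M : ℝ) ^ p) := by
  have hpos : (0 : ℝ) < (M : ℝ) ^ p := by linarith [one_le_cast_pow hM p]
  rw [href, mul_div_cancel₀ _ hpos.ne']
  have h : ∀ l : ℤ, f (s + j - l) = dirac (j - l) := fun l => by
    rw [← hs]
    push_cast
    congr 1
    ring
  simp_rw [h]
  rw [tsum_eq_single j fun l hl => by simp [dirac, sub_eq_zero, hl.symm]]
  simp [dirac]

theorem sd_iterate_eq_superposition {p : ℕ} (hM : 2 ≤ M)
    (h : ∀ j : ℤ, (sd M a)^[p] dirac j = f ((s + j) / (M : ℝ) ^ p)) (v : ℤ → ℂ) (j : ℤ) :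
    (sd M a)^[p] v j = superposition v f ((s + j) / (M : ℝ) ^ p) := by
  have hpos : (0 : ℝ) < (M : ℝ) ^ p := by linarith [one_le_cast_pow hM p]
  rw [sd_iterate_apply hM, superposition]
  refine tsum_congr fun l => ?_
  rw [h]
  push_cast
  congr 2
  field_simp
  ring

end Sampling

end LimitFunctions

/-! ### Iterates that sample a function, and the interpolation conditions. -/

section SampledLimits

section FiniteDifference

/-- The backward difference with step `h` of a function on `ℝ`. -/
def stepDiff (h : ℝ) (g : ℝ → ℂ) : ℝ → ℂ := fun t => g t - g (t - h)

/-- A mean value inequality for iterated differences. -/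
theorem norm_stepDiff_iterate_sub_le {h : ℝ} (hh : 0 ≤ h) {c : ℂ} {ε : ℝ} (j : ℕ) {g : ℝ → ℂ}
    (hg : ContDiff ℝ j g) {y : ℝ}
    (hc : ∀ t ∈ Set.Icc (y - j * h) y, ‖iteratedDeriv j g t - c‖ ≤ ε) :
    ‖(stepDiff h)^[j] g y - h ^ j * c‖ ≤ h ^ j * ε := by
  induction j generalizing g c ε with
  | zero => simpa using hc y (by simp)
  | succ j ih =>
    have hgj : ContDiff ℝ j g := hg.of_le (by exact_mod_cast j.le_succ)
    have hshift : ContDiff ℝ j fun t => g (t - h) := hgj.comp (contDiff_id.sub contDiff_const)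
    have hdiff : Differentiable ℝ (iteratedDeriv j g) :=
      hg.differentiable_iteratedDeriv j (by exact_mod_cast j.lt_succ_self)
    -- The induction hypothesis is applied to the first difference of `g`, whose `j`-th derivative
    -- is within `h * ε` of `h * c` by the mean value inequality.
    have key := ih (g := stepDiff h g) (c := h * c) (ε := h * ε) (hgj.sub hshift) fun t ht => ?_
    · rw [Function.iterate_succ_apply, pow_succ, pow_succ, mul_assoc, mul_assoc]
      exact key
    have h1 : iteratedDeriv j (stepDiff h g) t
        = iteratedDeriv j g t - iteratedDeriv j g (t - h) := by
      change iteratedDeriv j (g - fun t => g (t - h)) t = _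
      rw [iteratedDeriv_sub hgj.contDiffAt hshift.contDiffAt, iteratedDeriv_comp_sub_const]
    have h2 := norm_image_sub_le_of_norm_deriv_le_segment' (a := t - h) (b := t) (C := ε)
      (f := fun u : ℝ => iteratedDeriv j g u - u • c)
      (f' := fun u => iteratedDeriv (j + 1) g u - c)
      (fun u _ => by
        rw [iteratedDeriv_succ]
        have h3 := (hdiff u).hasDerivAt.sub ((hasDerivAt_id u).smul_const c)
        rw [one_smul] at h3
        exact h3.hasDerivWithinAt)
      (fun u hu => hc u (by
        push_cast
        constructor <;> linarith [hu.1, hu.2, ht.1, ht.2])) t (by simpa using hh)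
    rw [h1]
    refine le_trans (le_of_eq ?_) (h2.trans (le_of_eq (by ring)))
    congr 1
    simp only [Complex.real_smul]
    push_cast
    ring

theorem nabla_iterate_sample (g : ℝ → ℂ) (s : ℝ) {N : ℝ} (j : ℕ) (k : ℤ) :
    nabla^[j] (fun k : ℤ => g ((s + k) / N)) k = (stepDiff N⁻¹)^[j] g ((s + k) / N) := by
  induction j generalizing g with
  | zero => rfl
  | succ j ih =>
    rw [Function.iterate_succ_apply, Function.iterate_succ_apply, ← ih]
    refine congrArg (fun w => nabla^[j] w k) (funext fun k => ?_)
    simp only [nabla, stepDiff]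
    congr 2
    push_cast
    ring

end FiniteDifference

variable {M : ℕ} (hM : 2 ≤ M) {a : ℤ →₀ ℂ} {m : ℕ} {f : ℝ → ℂ} {s : ℝ}

theorem iteratedDeriv_eq_zero_of_lt_abs {R : ℕ} (hf : ∀ x : ℝ, (R : ℝ) < |x| → f x = 0) (j : ℕ)
    {x : ℝ} (hx : (R : ℝ) < |x|) : iteratedDeriv j f x = 0 := by
  have h : f =ᶠ[𝓝 x] fun _ => 0 := by
    filter_upwards [continuousAt_const.eventually_lt continuous_abs.continuousAt hx] with y hy
    exact hf y hy
  rw [h.iteratedDeriv_eq, iteratedDeriv_fun_const_zero]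

theorem uniformContinuous_iteratedDeriv {R : ℕ} (hf : ∀ x : ℝ, (R : ℝ) < |x| → f x = 0) {j : ℕ}
    (hc : ContDiff ℝ j f) : UniformContinuous (iteratedDeriv j f) := by
  refine (hc.continuous_iteratedDeriv' j).uniformContinuous_of_tendsto_cocompact (x := 0) ?_
  refine tendsto_const_nhds.congr' ?_
  filter_upwards [(isCompact_Icc (a := -(R : ℝ)) (b := R)).compl_mem_cocompact] with x hx
  rw [Set.mem_compl_iff, Set.mem_Icc, ← abs_le, not_le] at hx
  exact (iteratedDeriv_eq_zero_of_lt_abs hf j hx).symm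

include hM in
/-- If the iterates of the Dirac sequence sample a compactly supported function of class `C ^ m`,
then this function is their limit function. -/
theorem isLimitFunction_of_sample {R : ℕ} (hf : ∀ x : ℝ, (R : ℝ) < |x| → f x = 0)
    (hc : ContDiff ℝ m f)
    (h : ∀ (n : ℕ) (j : ℤ), (sd M a)^[n] dirac j = f ((s + j) / (M : ℝ) ^ n)) :
    IsLimitFunction M a m dirac f := by
  refine isLimitFunction_iff.2 ⟨hc, fun j hj K _ ε hε => ?_⟩
  have hcj : ContDiff ℝ j f := hc.of_le (by exact_mod_cast hj)
  obtain ⟨δ, hδ, hu⟩ := Metric.uniformContinuous_iff.1 (uniformContinuous_iteratedDeriv hf hcj)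
    (ε / 2) (by positivity)
  -- `|s|` is the offset between the sampling point and `k / M ^ n`, and `j` the number of steps
  -- spanned by the difference.
  have h1 : Tendsto (fun n : ℕ => (|s| + j) * ((M : ℝ) ^ n)⁻¹) atTop (𝓝 0) := by
    simpa using (tendsto_inv_cast_pow hM).const_mul (|s| + j)
  filter_upwards [h1.eventually_lt_const hδ] with n hn k _
  have hpos : (0 : ℝ) < (M : ℝ) ^ n := by linarith [one_le_cast_pow hM n]
  have hfun : (sd M a)^[n] dirac = fun k : ℤ => f ((s + k) / (M : ℝ) ^ n) := funext (h n)
  rw [hfun, nabla_iterate_sample]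
  set c := iteratedDeriv j f ((k : ℝ) / (M : ℝ) ^ n)
  have h2 := norm_stepDiff_iterate_sub_le (h := ((M : ℝ) ^ n)⁻¹) (c := c) (ε := ε / 2)
    (by positivity) j hcj (y := (s + k) / (M : ℝ) ^ n) fun t ht => by
      rw [← dist_eq_norm]
      refine (hu ?_).le
      rw [Real.dist_eq]
      refine lt_of_le_of_lt ?_ hn
      have h3 : (s + k) / (M : ℝ) ^ n - (k : ℝ) / (M : ℝ) ^ n = s * ((M : ℝ) ^ n)⁻¹ := by
        field_simp
        ring
      have h4 : -(|s| * ((M : ℝ) ^ n)⁻¹) ≤ s * ((M : ℝ) ^ n)⁻¹ := by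
        rw [← neg_mul]
        gcongr
        exact neg_abs_le s
      have h5 : s * ((M : ℝ) ^ n)⁻¹ ≤ |s| * ((M : ℝ) ^ n)⁻¹ := by
        gcongr
        exact le_abs_self s
      have h6 : 0 ≤ (j : ℝ) * ((M : ℝ) ^ n)⁻¹ := by positivity
      rw [abs_le, add_mul]
      constructor <;> linarith [ht.1, ht.2]
  have h3 : (M : ℂ) ^ (j * n) * (((M : ℝ) ^ n)⁻¹ : ℝ) ^ j = 1 := by
    have : (M : ℂ) ≠ 0 := by exact_mod_cast (by lia : M ≠ 0)
    push_cast
    rw [inv_pow, ← pow_mul, mul_comm j n]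
    field_simp
  have h4 : ∀ x : ℂ, (M : ℂ) ^ (j * n) * x - c
      = (M : ℂ) ^ (j * n) * (x - (((M : ℝ) ^ n)⁻¹ : ℝ) ^ j * c) := fun x => by
    rw [mul_sub, ← mul_assoc, h3, one_mul]
  rw [h4, norm_mul, norm_pow, Complex.norm_natCast]
  have h5 : (M : ℝ) ^ (j * n) * (((M : ℝ) ^ n)⁻¹ ^ j * (ε / 2)) = ε / 2 := by
    rw [inv_pow, ← pow_mul, mul_comm j n]
    field_simp
  calc _ ≤ (M : ℝ) ^ (j * n) * (((M : ℝ) ^ n)⁻¹ ^ j * (ε / 2)) := by gcongr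
    _ < ε := by rw [h5]; exact half_lt_self hε

/-! ### Conditions (i) and (ii) on `w`. -/

section Interpolation

theorem conv_comm (u v : ℤ → ℂ) (j : ℤ) : conv u v j = ∑' l : ℤ, v l * u (j - l) := by
  unfold conv
  rw [← (Equiv.subLeft j).tsum_eq]
  refine tsum_congr fun l => ?_
  simp only [Equiv.subLeft_apply, sub_sub_cancel]
  ring

theorem conv_iterMask (n : ℕ) (w : ℤ → ℂ) (j : ℤ) :
    conv (iterMask M a n) w j = ((M : ℂ) ^ n)⁻¹ * conv ((sd M a)^[n] dirac) w j := by
  simp only [conv, iterMask, mul_assoc, tsum_mul_left]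

include hM in
-- The refinement equation at `(y + j) / M ^ p`. With `y = M ^ ms * s` it serves (i) for `p = ms`
-- and (ii) for `p = ns`.
theorem conv_iterMask_sample {p : ℕ}
    (href : ∀ x, f x = ∑' k : ℤ, (sd M a)^[p] dirac k * f ((M : ℝ) ^ p * x - k)) (y : ℝ) (j : ℤ) :
    conv (iterMask M a p) (fun k => f (y + k)) j
      = ((M : ℂ) ^ p)⁻¹ * f ((y + j) / (M : ℝ) ^ p) := by
  have hpos : (0 : ℝ) < (M : ℝ) ^ p := by linarith [one_le_cast_pow hM p]
  rw [conv_iterMask, href, mul_div_cancel₀ _ hpos.ne', conv]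
  congr 1
  refine tsum_congr fun k => ?_
  push_cast
  rw [add_sub_assoc]

include hM in
theorem conv_sd_iterate_add (w : ℤ →₀ ℂ) (n p : ℕ) (j : ℤ) :
    conv ((sd M a)^[p + n] dirac) w j
      = ∑' i : ℤ, (sd M a)^[n] dirac i * conv ((sd M a)^[p] dirac) w (j - (M : ℤ) ^ p * i) := by
  obtain ⟨L, hL⟩ := exists_supportedIn w
  obtain ⟨L', hL'⟩ := exists_supportedIn_sd_iterate hM a supportedIn_dirac p
  have hN := one_le_natCast_pow hM p
  simp_rw [conv_comm, (hL.mul_right _).tsum_eq, Finset.mul_sum]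
  rw [Summable.tsum_finsetSum]
  · refine Finset.sum_congr rfl fun l _ => ?_
    rw [Function.iterate_add_apply, sd_iterate_apply hM, ← tsum_mul_left]
    refine tsum_congr fun i => ?_
    rw [sub_right_comm]
    ring
  · intro l _
    refine ((summable_mul_comp hL' hN ((sd M a)^[n] dirac) (j - l)).mul_left (w l)).congr
      fun i => ?_
    rw [sub_right_comm]
    ring

variable {ms ns : ℕ} (hns : 1 ≤ ns) {γ : ℤ}
  (hγ : (M : ℝ) ^ ms * ((M : ℝ) ^ ns - 1) * s = (γ : ℝ))

include hγ in
theorem geom_sum_mul_shift (q : ℕ) :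
    (((∑ i ∈ Finset.range q, (M : ℤ) ^ (i * ns)) * γ : ℤ) : ℝ)
      = (M : ℝ) ^ ms * ((M : ℝ) ^ (q * ns) - 1) * s := by
  push_cast
  rw [← hγ]
  have h := geom_sum_mul ((M : ℝ) ^ ns) q
  simp_rw [← pow_mul, mul_comm ns] at h
  rw [← h]
  ring

include hM in
-- Condition (ii) iterated `q` times. The shifts accumulate by `γ_(q + 1) = γ + M ^ ns * γ_q`,
-- whence the geometric sum.
theorem conv_sd_iterate_mul {w : ℤ →₀ ℂ}
    (hw : ∀ k : ℤ, conv ((sd M a)^[ns] dirac) w (γ + (M : ℤ) ^ ns * k) = w k) (q : ℕ) (k : ℤ) :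
    conv ((sd M a)^[q * ns] dirac) w
      ((∑ i ∈ Finset.range q, (M : ℤ) ^ (i * ns)) * γ + (M : ℤ) ^ (q * ns) * k) = w k := by
  induction q generalizing k with
  | zero =>
    simp only [zero_mul, Function.iterate_zero, id_eq, Finset.range_zero, Finset.sum_empty,
      pow_zero, one_mul, zero_add]
    rw [conv_comm, tsum_eq_single k fun l hl => by simp [dirac, sub_eq_zero, hl.symm]]
    simp [dirac]
  | succ q ih =>
    rw [add_one_mul, add_comm (q * ns), conv_sd_iterate_add hM]
    refine Eq.trans ?_ (ih k)
    refine tsum_congr fun i => congrArg _ ?_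
    rw [← hw]
    congr 1
    have : ∑ i ∈ Finset.range (q + 1), (M : ℤ) ^ (i * ns)
        = 1 + (M : ℤ) ^ ns * ∑ i ∈ Finset.range q, (M : ℤ) ^ (i * ns) := by
      rw [Finset.sum_range_succ', Finset.mul_sum, zero_mul, pow_zero, add_comm]
      congr 1
      refine Finset.sum_congr rfl fun i _ => ?_
      ring
    rw [this]
    ring

include hM hns hγ in
/-- An eigensequence of the transition operator for the eigenvalue `1` samples the limit
function. -/
theorem eq_mul_limit_of_conv_eq (hf : IsLimitFunction M a m dirac f) {w : ℤ →₀ ℂ}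
    (hw : ∀ k : ℤ, conv ((sd M a)^[ns] dirac) w (γ + (M : ℤ) ^ ns * k) = w k) (k : ℤ) :
    w k = (∑' l, w l) * f ((M : ℝ) ^ ms * s + k) := by
  obtain ⟨L, hL⟩ := exists_supportedIn w
  have hφ : Tendsto (fun q : ℕ => q * ns) atTop atTop :=
    tendsto_id.atTop_mul_const' (by lia)
  -- Divided by `M ^ (q * ns)`, the arguments tend to `M ^ ms * s + k` whatever `l` is. The limit is
  -- therefore the same for every term of the convolution, and the sum of `w` factors out.
  have hlim : ∀ l : ℤ, Tendsto (fun q : ℕ => (sd M a)^[q * ns] dirac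
      ((∑ i ∈ Finset.range q, (M : ℤ) ^ (i * ns)) * γ + (M : ℤ) ^ (q * ns) * k - l)) atTop
      (𝓝 (f ((M : ℝ) ^ ms * s + k))) := fun l => by
    refine hf.isGridLimit.tendsto_comp hM hf.1.continuous.continuousAt hφ ?_
    have h1 : Tendsto (fun q : ℕ => (M : ℝ) ^ ms * s + k
        - ((M : ℝ) ^ ms * s + l) * ((M : ℝ) ^ (q * ns))⁻¹) atTop (𝓝 ((M : ℝ) ^ ms * s + k)) := by
      simpa using (((tendsto_inv_cast_pow hM).comp hφ).const_mul
        ((M : ℝ) ^ ms * s + l)).const_sub ((M : ℝ) ^ ms * s + k)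
    refine h1.congr fun q => ?_
    have hpos : (0 : ℝ) < (M : ℝ) ^ (q * ns) := by linarith [one_le_cast_pow hM (q * ns)]
    rw [Int.cast_sub, Int.cast_add, geom_sum_mul_shift hγ]
    push_cast
    field_simp
    ring
  have h1 : Tendsto (fun _ : ℕ => w k) atTop
      (𝓝 (∑ l ∈ Finset.Icc (-(L : ℤ)) L, w l * f ((M : ℝ) ^ ms * s + k))) := by
    refine (tendsto_finsetSum _ fun l _ => (hlim l).const_mul (w l)).congr fun q => ?_
    rw [← conv_sd_iterate_mul hM hw q k, conv_comm, (hL.mul_right _).tsum_eq]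
  rw [hL.tsum_eq, Finset.sum_mul]
  exact tendsto_nhds_unique tendsto_const_nhds h1

include hM in
/-- The translates of the limit function form a partition of unity. -/
theorem tsum_limit_sub_eq_one (hf : IsLimitFunction M a m dirac f)
    (h1 : ∀ j, sd M a (fun _ => 1) j = 1) (x : ℝ) : ∑' l : ℤ, f (x - l) = 1 := by
  have h2 := (hf.superposition hM fun _ => 1).tendsto hM (tendsto_floor_div hM x)
  have h3 : ∀ n, (sd M a)^[n] (fun _ => 1) = fun _ => 1 := fun n =>
    Function.iterate_fixed (funext h1) n
  simp_rw [h3] at h2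
  simpa [superposition] using tendsto_nhds_unique h2 tendsto_const_nhds

include hM hns hγ in
-- Condition (ii) makes `w` equal to `W` times the samples of `f` on `M ^ ms * s + ℤ`, with `W` its
-- sum; (i) refines these to `W * f (s + k) = δ k`. Summing over `k` and using the partition of
-- unity gives `W = 1`.
theorem limit_add_int_eq_dirac (hf : IsLimitFunction M a m dirac f)
    (h1 : ∀ j, sd M a (fun _ => 1) j = 1) {w : ℤ →₀ ℂ}
    (hi : ∀ k : ℤ, conv (iterMask M a ms) w ((M : ℤ) ^ ms * k) = ((M : ℂ) ^ ms)⁻¹ * dirac k)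
    (hii : ∀ k : ℤ, conv (iterMask M a ns) w (γ + (M : ℤ) ^ ns * k) = ((M : ℂ) ^ ns)⁻¹ * w k)
    (k : ℤ) : f (s + k) = dirac k := by
  have hM0 : (M : ℂ) ≠ 0 := by exact_mod_cast (by lia : M ≠ 0)
  have hpos : (0 : ℝ) < (M : ℝ) ^ ms := by linarith [one_le_cast_pow hM ms]
  have hw : ∀ k : ℤ, conv ((sd M a)^[ns] dirac) w (γ + (M : ℤ) ^ ns * k) = w k := fun k => by
    have := hii k
    rw [conv_iterMask] at this
    exact mul_left_cancel₀ (inv_ne_zero (pow_ne_zero _ hM0)) this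
  set W := ∑' l, w l with hW
  have hwf : (w : ℤ → ℂ) = fun k : ℤ => W * f ((M : ℝ) ^ ms * s + k) :=
    funext (eq_mul_limit_of_conv_eq hM hns hγ hf hw)
  have h2 : ∀ k : ℤ, W * f (s + k) = dirac k := fun k => by
    have h3 := hi k
    have h4 := conv_iterMask_sample hM (hf.refinement hM ms) ((M : ℝ) ^ ms * s) ((M : ℤ) ^ ms * k)
    have h5 : conv (iterMask M a ms) w ((M : ℤ) ^ ms * k) = W * conv (iterMask M a ms)
        (fun k : ℤ => f ((M : ℝ) ^ ms * s + k)) ((M : ℤ) ^ ms * k) := by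
      rw [hwf]
      simp only [conv, mul_left_comm _ W, tsum_mul_left]
    rw [h5, h4, mul_left_comm] at h3
    rw [← mul_left_cancel₀ (inv_ne_zero (pow_ne_zero _ hM0)) h3]
    congr 2
    push_cast
    field_simp
  have h3 : W = 1 := by
    have h4 : ∑' l : ℤ, W * f (s - l) = 1 := by
      have h5 : ∀ l : ℤ, W * f (s - l) = dirac (-l) := fun l => by
        rw [← h2]
        push_cast
        rw [sub_eq_add_neg]
      simp_rw [h5]
      rw [tsum_eq_single 0 fun l hl => by simp [dirac, hl]]
      simp [dirac]
    rwa [tsum_mul_left, tsum_limit_sub_eq_one hM hf h1, mul_one] at h4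
  rw [← h2, h3, one_mul]

include hM hγ in
-- The witness is `w k = f (M ^ ms * s + k)`. The shift `γ` is exactly what makes `(M ^ ms * s + γ +
-- M ^ ns * k) / M ^ ns` equal to `M ^ ms * s + k`.
theorem exists_conv_iterMask_eq (hf : IsLimitFunction M a m dirac f)
    (hs : ∀ k : ℤ, f (s + k) = dirac k) : ∃ w : ℤ →₀ ℂ,
      (∀ k : ℤ, conv (iterMask M a ms) w ((M : ℤ) ^ ms * k) = ((M : ℂ) ^ ms)⁻¹ * dirac k) ∧
      ∀ k : ℤ, conv (iterMask M a ns) w (γ + (M : ℤ) ^ ns * k) = ((M : ℂ) ^ ns)⁻¹ * w k := by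
  obtain ⟨R, hR⟩ := hf.exists_eq_zero hM
  have hsupp : SupportedIn (R + ⌈|(M : ℝ) ^ ms * s|⌉) fun k : ℤ => f ((M : ℝ) ^ ms * s + k) := by
    intro k hk
    refine hR _ ?_
    have h1 : (R : ℝ) + ⌈|(M : ℝ) ^ ms * s|⌉ < |(k : ℝ)| := by exact_mod_cast hk
    have h2 := Int.le_ceil |(M : ℝ) ^ ms * s|
    have h3 := abs_sub_abs_le_abs_sub (k : ℝ) (-((M : ℝ) ^ ms * s))
    rw [abs_neg, sub_neg_eq_add, add_comm (k : ℝ)] at h3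
    linarith
  refine ⟨Finsupp.ofSupportFinite _ hsupp.finite_support, fun k => ?_, fun k => ?_⟩
  · rw [Finsupp.ofSupportFinite_coe, conv_iterMask_sample hM (hf.refinement hM ms), ← hs]
    have hpos : (0 : ℝ) < (M : ℝ) ^ ms := by linarith [one_le_cast_pow hM ms]
    congr 2
    push_cast
    field_simp
  · rw [Finsupp.ofSupportFinite_coe, conv_iterMask_sample hM (hf.refinement hM ns)]
    have hpos : (0 : ℝ) < (M : ℝ) ^ ns := by linarith [one_le_cast_pow hM ns]
    congr 2
    push_cast
    rw [← hγ]
    field_simp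
    ring

end Interpolation

end SampledLimits

/-! ### Convergence forces sum rules and `sm_∞ > m`. -/

section Necessity

variable {M : ℕ} (hM : 2 ≤ M) {a : ℤ →₀ ℂ} {m : ℕ} {f : ℝ → ℂ}

/-- If a derivative vanishes, the preceding one is constant, and the constant is `0` because of the
compact support. -/
theorem eq_zero_of_iteratedDeriv_eq_zero {R : ℕ} (hf : ∀ x : ℝ, (R : ℝ) < |x| → f x = 0) (i : ℕ)
    (hc : ContDiff ℝ i f) (h : ∀ x, iteratedDeriv i f x = 0) (x : ℝ) : f x = 0 := by
  induction i with
  | zero => simpa using h x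
  | succ i ih =>
    refine ih (hc.of_le (by exact_mod_cast i.le_succ)) fun x => ?_
    have h1 := is_const_of_deriv_eq_zero
      (hc.differentiable_iteratedDeriv i (by exact_mod_cast i.lt_succ_self))
      (fun y => by rw [← iteratedDeriv_succ]; exact h y) x (R + 1)
    rw [h1]
    refine iteratedDeriv_eq_zero_of_lt_abs hf i ?_
    rw [abs_of_nonneg (by positivity)]
    linarith

theorem IsLimitFunction.isGridLimit_scaledDiff (h : IsLimitFunction M a m dirac f) {i : ℕ}
    (hi : i ≤ m) : IsGridLimit M (scaledDiff M a i) (iteratedDeriv i f) :=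
  (isLimitFunction_iff.1 h).2 i hi

theorem sd_mul_add (c : ℤ →₀ ℂ) (v : ℤ → ℂ) (q r : ℤ) :
    sd M c v (M * q + r) = M * ∑' t : ℤ, v (q + t) * c (r - M * t) := by
  unfold sd
  rw [← (Equiv.addLeft q).tsum_eq]
  congr 1
  refine tsum_congr fun t => ?_
  simp only [Equiv.coe_addLeft]
  congr 2
  ring

include hM in
/-- `C ^ m`-convergence with a nonzero limit function forces sum rules of order `m + 1`. -/
theorem IsLimitFunction.exists_nbox_iterate (h : IsLimitFunction M a m dirac f)
    (hne : ∃ x, f x ≠ 0) {i : ℕ} (hi : i ≤ m + 1) : ∃ c, a = (nbox M)^[i] c := by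
  obtain ⟨R, hR⟩ := h.exists_eq_zero hM
  induction i with
  | zero => exact ⟨a, rfl⟩
  | succ i ih =>
    obtain ⟨c, hc⟩ := ih (by lia)
    have him : i ≤ m := by lia
    have hci : ContDiff ℝ i f := h.1.of_le (by exact_mod_cast him)
    obtain ⟨x, hx⟩ : ∃ x, iteratedDeriv i f x ≠ 0 := by
      by_contra! h0
      obtain ⟨x, hx⟩ := hne
      exact hx (eq_zero_of_iteratedDeriv_eq_zero hR i hci h0 x)
    have hcont := (hci.continuous_iteratedDeriv' i).continuousAt (x := x)
    have hgrid := h.isGridLimit_scaledDiff him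
    obtain ⟨L, hL⟩ := exists_supportedIn c
    -- One step of the scheme for `c` is taken to the limit at `x`: all values of the scaled
    -- differences involved tend to `f^(i) x`. Hence `f^(i) x` is itself times `[S_c 1](r)`, and it
    -- is nonzero.
    have hone : ∀ r, sd M c (fun _ => 1) r = 1 := fun r => by
      have h1 : Tendsto (fun n : ℕ => ((M * ⌊(M : ℝ) ^ n * x⌋ + r : ℤ) : ℝ) / (M : ℝ) ^ (n + 1))
          atTop (𝓝 x) := by
        have h2 := (tendsto_floor_div hM x).add
          (((tendsto_inv_cast_pow hM).comp (tendsto_add_atTop_nat 1)).const_mul (r : ℝ))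
        rw [mul_zero, add_zero] at h2
        refine h2.congr fun n => ?_
        have : (M : ℝ) ≠ 0 := by exact_mod_cast (by lia : M ≠ 0)
        simp only [Function.comp_apply]
        push_cast
        field_simp
        ring
      have h2 := hgrid.tendsto_comp hM hcont (tendsto_add_atTop_nat 1) h1
      have hM1 : (1 : ℤ) ≤ M := by lia
      have h3 : Tendsto (fun n => (M : ℂ) * ∑ t ∈ Finset.Icc (-((L : ℤ) + |r|)) (L + |r|),
          scaledDiff M a i n (⌊(M : ℝ) ^ n * x⌋ + t) * c (r - M * t)) atTop
          (𝓝 (M * ∑ t ∈ Finset.Icc (-((L : ℤ) + |r|)) (L + |r|),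
            iteratedDeriv i f x * c (r - M * t))) :=
        (tendsto_finsetSum _ fun t _ => (hgrid.tendsto hM hcont
          (tendsto_int_add_div hM (tendsto_floor_div hM x) t)).mul_const _).const_mul _
      have h4 := tendsto_nhds_unique (h2.congr fun n => by
        rw [scaledDiff_succ hM hc, sd_mul_add, (hL.mul_comp hM1 _ r).tsum_eq]) h3
      have h5 : sd M c (fun _ => 1) r
          = M * ∑ t ∈ Finset.Icc (-((L : ℤ) + |r|)) (L + |r|), c (r - M * t) := by
        unfold sd
        rw [(hL.mul_comp hM1 _ r).tsum_eq]
        simp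
      rw [← Finset.mul_sum, mul_left_comm, ← h5] at h4
      exact (mul_eq_left₀ hx).1 h4.symm
    obtain ⟨d, rfl⟩ := exists_eq_nbox hM hone
    exact ⟨d, by rw [hc, Function.iterate_succ_apply]⟩

include hM in
-- Uniform over all `k`: on a bounded range by grid convergence and uniform continuity of `f^(m)`,
-- beyond it because the differences vanish.
theorem IsLimitFunction.eventually_norm_nabla_scaledDiff_le (h : IsLimitFunction M a m dirac f)
    {ε : ℝ} (hε : 0 < ε) : ∀ᶠ n in atTop, ∀ k, ‖nabla (scaledDiff M a m n) k‖ ≤ ε := by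
  obtain ⟨R, hR⟩ := exists_supportedIn a
  obtain ⟨R', hR'⟩ := h.exists_eq_zero hM
  obtain ⟨δ, hδ, hu⟩ := Metric.uniformContinuous_iff.1 (uniformContinuous_iteratedDeriv hR' h.1)
    (ε / 3) (by positivity)
  filter_upwards [h.isGridLimit_scaledDiff le_rfl (R + m + 2) (by positivity) (ε / 3)
    (by positivity), (tendsto_inv_cast_pow hM).eventually_lt_const hδ] with n hn hnδ k
  have hpos : (0 : ℝ) < (M : ℝ) ^ n := by linarith [one_le_cast_pow hM n]
  by_cases hk : |k| ≤ (M : ℤ) ^ n * (R + m + 1)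
  · have h1 := hn k (by
      have : |(k : ℝ)| ≤ (M : ℝ) ^ n * (R + m + 1) := by exact_mod_cast hk
      nlinarith)
    have h2 := hn (k - 1) (by
      have : |(k : ℝ)| ≤ (M : ℝ) ^ n * (R + m + 1) := by exact_mod_cast hk
      have h4 := abs_sub (k : ℝ) 1
      rw [abs_one] at h4
      push_cast
      nlinarith [one_le_cast_pow hM n])
    have h3 : dist (iteratedDeriv m f ((k : ℝ) / (M : ℝ) ^ n))
        (iteratedDeriv m f (((k - 1 : ℤ) : ℝ) / (M : ℝ) ^ n)) < ε / 3 := by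
      refine hu ?_
      rw [Real.dist_eq, ← sub_div]
      push_cast
      rwa [sub_sub_cancel, abs_of_nonneg (by positivity), one_div]
    rw [dist_eq_norm] at h3
    rw [nabla]
    set A := iteratedDeriv m f ((k : ℝ) / (M : ℝ) ^ n)
    set B := iteratedDeriv m f (((k - 1 : ℤ) : ℝ) / (M : ℝ) ^ n)
    have h5 : scaledDiff M a m n k - scaledDiff M a m n (k - 1)
        = (scaledDiff M a m n k - A) + (A - B) - (scaledDiff M a m n (k - 1) - B) := by ring
    rw [h5]
    have h6 := norm_sub_le ((scaledDiff M a m n k - A) + (A - B)) (scaledDiff M a m n (k - 1) - B)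
    have h7 := norm_add_le (scaledDiff M a m n k - A) (A - B)
    linarith
  · have hs := (hR.sd_iterate hM (by lia) supportedIn_dirac n).nabla_iterate (m + 1)
    rw [norm_nabla_scaledDiff hM, norm_scaledDiff, hs k, norm_zero, mul_zero, mul_zero]
    · exact hε.le
    · have := one_le_natCast_pow hM n
      push_cast
      nlinarith

theorem exists_le_pow_of_add_le {b : ℕ → ℝ} {t : ℝ} (ht : 0 < t) {N : ℕ} (hN : 1 ≤ N)
    (hb : ∀ n, 0 ≤ b n) (h : ∀ n, b (N + n) ≤ t ^ N * b n) : ∃ C, 0 < C ∧ ∀ n, b n ≤ C * t ^ n := by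
  have hS : 0 ≤ ∑ r ∈ Finset.range N, b r / t ^ r :=
    Finset.sum_nonneg fun r _ => div_nonneg (hb r) (by positivity)
  refine ⟨1 + ∑ r ∈ Finset.range N, b r / t ^ r, by positivity, fun n => ?_⟩
  induction n using Nat.strong_induction_on with
  | _ n ih =>
    rcases lt_or_ge n N with hn | hn
    · rw [← div_le_iff₀ (by positivity)]
      have := Finset.single_le_sum (f := fun r => b r / t ^ r)
        (fun r _ => div_nonneg (hb r) (by positivity)) (Finset.mem_range.2 hn)
      linarith
    · obtain ⟨p, rfl⟩ := Nat.exists_eq_add_of_le hn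
      refine (h p).trans ?_
      have := mul_le_mul_of_nonneg_left (ih p (by lia)) (by positivity : 0 ≤ t ^ N)
      refine this.trans (le_of_eq ?_)
      rw [pow_add]
      ring

include hM in
-- Write `J = m + e + 1`. If the differences of the order `m` data are small at one level `N`, then
-- `S_c^N` has norm at most `M ^ ((e + 1) * N) / 2` on bounded sequences. The factor `1 / 2` lowers
-- the rate strictly below `M ^ (e + 1)`, and dividing by `M ^ J` gives a number below `M ^ (-m)`.
theorem IsLimitFunction.rhoInfty_lt (h : IsLimitFunction M a m dirac f) {J : ℕ} (hmJ : m < J)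
    {c : ℤ →₀ ℂ} (hc : a = (nbox M)^[J] c) : rhoInfty M a J < ((M : ℝ) ^ m)⁻¹ := by
  have hM1 : (1 : ℝ) < M := by exact_mod_cast (by lia : 1 < M)
  have hM0 : (0 : ℝ) < M := by linarith
  obtain ⟨e, rfl⟩ := Nat.exists_eq_add_of_lt hmJ
  obtain ⟨R, hR⟩ := exists_supportedIn c
  obtain ⟨C, hC, hCB⟩ := exists_norm_sd_iterate_le_of_nabla_iterate hM c (m + e + 1)
  have hbase : ∀ n k, ‖(sd M c)^[n] (nabla^[m + e + 1] dirac) k‖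
      = (M : ℝ) ^ ((m + e + 1) * n) * ‖nabla^[m + e + 1] ((sd M a)^[n] dirac) k‖ := fun n k => by
    rw [← nabla_iterate_sd_iterate_nbox hM, ← hc, norm_mul, norm_pow, Complex.norm_natCast]
  -- Chosen to make the product of all constants `1 / 2`: `2 ^ e` for the `e` further differences,
  -- `C` for undoing all `J` of them, and `2 * R + 1` for passing from `δ` to general data.
  set ε : ℝ := (2 * ((2 * R + 1) * C * 2 ^ e))⁻¹ with hε
  obtain ⟨N, hN, hN1⟩ := ((h.eventually_norm_nabla_scaledDiff_le hM
    (by positivity : 0 < ε)).and (eventually_ge_atTop 1)).exists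
  have hdiff : ∀ k, ‖(sd M c)^[N] (nabla^[m + e + 1] dirac) k‖
      ≤ (M : ℝ) ^ ((e + 1) * N) * (2 ^ e * ε) := fun k => by
    have h1 : ∀ k, ‖nabla^[m + 1] ((sd M a)^[N] dirac) k‖ ≤ ((M : ℝ) ^ (m * N))⁻¹ * ε := fun k => by
      have h2 := hN k
      unfold scaledDiff at h2
      rw [nabla_const_mul, ← Function.iterate_succ_apply' nabla, norm_mul, norm_pow,
        Complex.norm_natCast] at h2
      rwa [le_inv_mul_iff₀ (by positivity)]
    have h3 := norm_nabla_iterate_le e h1 k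
    rw [← Function.iterate_add_apply, show e + (m + 1) = m + e + 1 by ring] at h3
    rw [hbase, show (m + e + 1) * N = (e + 1) * N + m * N by ring, pow_add, mul_assoc]
    refine mul_le_mul_of_nonneg_left ?_ (by positivity)
    calc _ ≤ (M : ℝ) ^ (m * N) * (2 ^ e * (((M : ℝ) ^ (m * N))⁻¹ * ε)) := by gcongr
      _ = _ := by field_simp
  -- the `N`-th iterate is a contraction, up to the factor `M ^ ((e + 1) N)`
  have hop : ∀ {v : ℤ → ℂ} {V : ℝ}, (∀ k, ‖v k‖ ≤ V) →
      ∀ k, ‖(sd M c)^[N] v k‖ ≤ 1 / 2 * (M : ℝ) ^ ((e + 1) * N) * V := fun {v V} hV k => by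
    refine (norm_sd_iterate_le hM hR (hCB N _ hdiff) hV k).trans (le_of_eq ?_)
    rw [hε]
    field_simp
  -- The growth rate per step, the `N`-th root of the norm bound for `N` steps.
  set t : ℝ := (1 / 2) ^ ((N : ℝ)⁻¹) * (M : ℝ) ^ (e + 1) with ht
  have ht0 : 0 < t := by positivity
  have htN : t ^ N = 1 / 2 * (M : ℝ) ^ ((e + 1) * N) := by
    rw [ht, mul_pow, Real.rpow_inv_natCast_pow (by norm_num) (by lia), ← pow_mul]
  have htlt : t < (M : ℝ) ^ (e + 1) := by
    refine mul_lt_of_lt_one_left (by positivity) (Real.rpow_lt_one (by norm_num) (by norm_num) ?_)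
    have : (0 : ℝ) < N := by exact_mod_cast hN1
    positivity
  have hsupp : ∀ n, ∃ L, SupportedIn L ((sd M c)^[n] (nabla^[m + e + 1] dirac)) := fun n =>
    exists_supportedIn_sd_iterate hM c (supportedIn_dirac.nabla_iterate _) n
  obtain ⟨D, hD, hDt⟩ := exists_le_pow_of_add_le
    (b := fun n => supNorm ((sd M c)^[n] (nabla^[m + e + 1] dirac))) ht0 hN1
    (fun _ => supNorm_nonneg _) fun n => supNorm_le fun k => by
      obtain ⟨L, hL⟩ := hsupp n
      rw [Function.iterate_add_apply, htN]
      exact hop hL.norm_le_supNorm k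
  have hle : rhoInfty M a (m + e + 1) ≤ t / (M : ℝ) ^ (m + e + 1) := by
    refine limsup_rpow_one_div_le (fun _ => supNorm_nonneg _) hD (by positivity)
      fun n => supNorm_le fun k => ?_
    obtain ⟨L, hL⟩ := hsupp n
    have h1 := (hL.norm_le_supNorm k).trans (hDt n)
    rw [hbase] at h1
    rw [div_pow, ← pow_mul, mul_div_assoc', le_div_iff₀ (by positivity)]
    linarith
  refine hle.trans_lt ?_
  rw [div_lt_iff₀ (by positivity), show m + e + 1 = m + (e + 1) by ring, pow_add,
    inv_mul_cancel_left₀ (by positivity)]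
  exact htlt

end Necessity

/-! ### The iterates as discrete measures converging to `φ`. -/

section DistributionalLimit

open scoped ContDiff

variable {M : ℕ} (hM : 2 ≤ M) (a : ℤ →₀ ℂ)

/-- The discrete approximation `M ^ (-n) ∑ k, [S ^ n δ](k) g (k / M ^ n)` of `⟨φ, g⟩`. -/
noncomputable def gridMean (M : ℕ) (a : ℤ →₀ ℂ) (n : ℕ) (g : ℝ → ℂ) : ℂ :=
  ((M : ℂ) ^ n)⁻¹ * ∑' k : ℤ, (sd M a)^[n] dirac k * g ((k : ℝ) / (M : ℝ) ^ n)

/-- Each subdivision step multiplies the symbol by that of the mask at the next finer frequency. -/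
theorem gridMean_exp (hM : 2 ≤ M) (n : ℕ) (θ : ℝ) :
    gridMean M a n (fun x => Complex.exp (-Complex.I * ((x * θ : ℝ) : ℂ)))
      = ∏ j ∈ Finset.range n, trigMask a (θ / (M : ℝ) ^ (j + 1)) := by
  have hM0 : (M : ℂ) ≠ 0 := by exact_mod_cast (by lia : M ≠ 0)
  have hz : ∀ (n : ℕ) (k : ℤ), Complex.exp (-Complex.I * (((k : ℝ) / (M : ℝ) ^ n * θ : ℝ) : ℂ))
      = Complex.exp (-Complex.I * ((θ / (M : ℝ) ^ n : ℝ) : ℂ)) ^ k := fun n k => by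
    rw [← Complex.exp_int_mul]
    congr 1
    push_cast
    ring
  induction n with
  | zero =>
    simp only [gridMean, Finset.range_zero, Finset.prod_empty, Function.iterate_zero, id_eq]
    rw [tsum_eq_single 0 fun k hk => by simp [dirac, hk]]
    simp [dirac]
  | succ n ih =>
    obtain ⟨L, hL⟩ := exists_supportedIn_sd_iterate hM a supportedIn_dirac n
    have h := tsum_sd_mul_zpow (M := M) a hL
      (Complex.exp_ne_zero (-Complex.I * ((θ / (M : ℝ) ^ (n + 1) : ℝ) : ℂ)))
    have hpow : Complex.exp (-Complex.I * ((θ / (M : ℝ) ^ (n + 1) : ℝ) : ℂ)) ^ M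
        = Complex.exp (-Complex.I * ((θ / (M : ℝ) ^ n : ℝ) : ℂ)) := by
      rw [← Complex.exp_nat_mul]
      congr 1
      push_cast
      field_simp
      ring
    rw [hpow] at h
    rw [Finset.prod_range_succ, ← ih, gridMean, gridMean]
    simp_rw [hz, Function.iterate_succ_apply', h, trigMask]
    field_simp
    ring

/-- The partial products of `φ̂` have uniform polynomial growth. -/
theorem exists_norm_prod_trigMask_le (hM : 2 ≤ M) (ha : (a.sum fun _ c => c) = 1) :
    ∃ (C : ℝ) (N : ℕ), 0 ≤ C ∧ ∀ (n : ℕ) (ξ : ℝ),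
      ‖∏ j ∈ Finset.range n, trigMask a (ξ / (M : ℝ) ^ (j + 1))‖ ≤ C * (1 + |ξ|) ^ N := by
  have hM' : (2 : ℝ) ≤ M := by exact_mod_cast hM
  have hM0 : (0 : ℝ) < M := by linarith
  set A : ℝ := ∑ k ∈ a.support, ‖a k‖ with hA
  set L : ℝ := ∑ k ∈ a.support, ‖a k‖ * |(k : ℝ)| with hL
  have hL0 : 0 ≤ L := Finset.sum_nonneg fun _ _ => by positivity
  have hA0 : 0 ≤ A := Finset.sum_nonneg fun _ _ => norm_nonneg _
  -- For `|ξ| ≥ M ≥ 2`, dividing `ξ` by `M` shrinks `1 + |ξ|` by a factor of at least `3 / 2`, so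
  -- `(1 + |ξ|) ^ N` compensates the factor `A` split off from the product.
  obtain ⟨N, hN⟩ := pow_unbounded_of_one_lt A (by norm_num : (1 : ℝ) < 3 / 2)
  have hgeo : ∀ q : ℕ, ∑ j ∈ Finset.range q, ((M : ℝ)⁻¹) ^ (j + 1) ≤ 1 - (1 / 2) ^ q := by
    intro q
    induction q with
    | zero => simp
    | succ q ihq =>
      rw [Finset.sum_range_succ]
      have : ((M : ℝ)⁻¹) ^ (q + 1) ≤ (1 / 2) ^ (q + 1) := by
        refine pow_le_pow_left₀ (by positivity) ?_ _
        rw [one_div]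
        exact inv_anti₀ (by norm_num) hM'
      have h3 : ((1 : ℝ) / 2) ^ (q + 1) = (1 / 2) ^ q / 2 := by ring
      linarith
  have hsmall : ∀ (n : ℕ) (ξ : ℝ), |ξ| ≤ M →
      ‖∏ j ∈ Finset.range n, trigMask a (ξ / (M : ℝ) ^ (j + 1))‖ ≤ Real.exp (L * M) := by
    intro n ξ h
    rw [norm_prod]
    calc ∏ j ∈ Finset.range n, ‖trigMask a (ξ / (M : ℝ) ^ (j + 1))‖
        ≤ ∏ j ∈ Finset.range n, Real.exp (L * M * ((M : ℝ)⁻¹) ^ (j + 1)) := by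
          refine Finset.prod_le_prod (fun _ _ => norm_nonneg _) fun j _ => ?_
          have h3 := norm_trigMask_sub_one_le a ha (ξ / (M : ℝ) ^ (j + 1))
          have h4 : ‖trigMask a (ξ / (M : ℝ) ^ (j + 1))‖
              ≤ ‖trigMask a (ξ / (M : ℝ) ^ (j + 1)) - 1‖ + 1 := by
            simpa using norm_add_le (trigMask a (ξ / (M : ℝ) ^ (j + 1)) - 1) 1
          have h5 : L * |ξ / (M : ℝ) ^ (j + 1)| ≤ L * M * ((M : ℝ)⁻¹) ^ (j + 1) := by
            rw [abs_div, abs_of_nonneg (by positivity : (0 : ℝ) ≤ (M : ℝ) ^ (j + 1)),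
              inv_pow, div_eq_mul_inv, ← mul_assoc]
            gcongr
          linarith [Real.add_one_le_exp (L * M * ((M : ℝ)⁻¹) ^ (j + 1))]
      _ = Real.exp (L * M * ∑ j ∈ Finset.range n, ((M : ℝ)⁻¹) ^ (j + 1)) := by
          rw [← Real.exp_sum, Finset.mul_sum]
      _ ≤ Real.exp (L * M) := by
          refine Real.exp_le_exp.2 (mul_le_of_le_one_right (by positivity) ?_)
          linarith [hgeo n, (by positivity : (0 : ℝ) ≤ (1 / 2) ^ n)]
  refine ⟨Real.exp (L * M), N, (Real.exp_pos _).le, fun n => ?_⟩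
  induction n with
  | zero =>
    intro ξ
    refine (hsmall 0 0 (by simp)).trans (le_mul_of_one_le_right (Real.exp_pos _).le ?_)
    exact one_le_pow₀ (by linarith [abs_nonneg ξ])
  | succ n ih =>
    intro ξ
    rcases le_total |ξ| M with h | h
    · refine (hsmall _ ξ h).trans (le_mul_of_one_le_right (Real.exp_pos _).le ?_)
      exact one_le_pow₀ (by linarith [abs_nonneg ξ])
    · rw [Finset.prod_range_succ', norm_mul]
      have h1 : ∏ j ∈ Finset.range n, trigMask a (ξ / (M : ℝ) ^ (j + 1 + 1))
          = ∏ j ∈ Finset.range n, trigMask a ((ξ / M) / (M : ℝ) ^ (j + 1)) := by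
        refine Finset.prod_congr rfl fun j _ => ?_
        rw [div_div, pow_succ' (M : ℝ) (j + 1)]
      rw [h1]
      have h4 : (3 / 2) * (1 + |ξ / M|) ≤ 1 + |ξ| := by
        rw [abs_div, abs_of_pos hM0]
        have h5 : |ξ| / M ≤ |ξ| / 2 := div_le_div_of_nonneg_left (abs_nonneg _) (by norm_num) hM'
        linarith
      calc _ ≤ Real.exp (L * M) * (1 + |ξ / M|) ^ N * A :=
            mul_le_mul (ih (ξ / M)) (norm_trigMask_le a _) (norm_nonneg _) (by positivity)
        _ ≤ Real.exp (L * M) * (1 + |ξ / M|) ^ N * (3 / 2) ^ N := by gcongr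
        _ = Real.exp (L * M) * ((3 / 2) * (1 + |ξ / M|)) ^ N := by rw [mul_pow]; ring
        _ ≤ _ := by gcongr

/-- Fourier inversion writes `g` as an integral of exponentials, whose grid means are the partial
products. -/
theorem gridMean_eq_integral (hM : 2 ≤ M) (n : ℕ) (g : 𝓢(ℝ, ℂ)) :
    gridMean M a n g = ∫ x : ℝ, (𝓕⁻ g) x
      * ∏ j ∈ Finset.range n, trigMask a (2 * Real.pi * x / (M : ℝ) ^ (j + 1)) := by
  obtain ⟨L, hL⟩ := exists_supportedIn_sd_iterate hM a supportedIn_dirac n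
  set h : 𝓢(ℝ, ℂ) := 𝓕⁻ g with hh
  have hg : ∀ y : ℝ, g y = ∫ x : ℝ, Complex.exp (-Complex.I * ((y * (2 * Real.pi * x) : ℝ) : ℂ))
      * h x := fun y => by
    have h1 : g = 𝓕 h := by rw [hh, FourierTransform.fourier_fourierInv_eq]
    rw [h1, SchwartzMap.fourier_coe, Real.fourier_real_eq_integral_exp_smul]
    refine integral_congr_ae (Eventually.of_forall fun x => ?_)
    beta_reduce
    rw [smul_eq_mul]
    congr 2
    push_cast
    ring
  have hint : ∀ y : ℝ, Integrable fun x : ℝ =>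
      Complex.exp (-Complex.I * ((y * (2 * Real.pi * x) : ℝ) : ℂ)) * h x := fun y => by
    refine (h.integrable (μ := volume)).bdd_mul (c := 1) (by fun_prop)
      (Eventually.of_forall fun x => ?_)
    rw [Complex.norm_exp]
    simp
  set u := (sd M a)^[n] dirac with hu
  have hsum : ∑' k : ℤ, u k * g ((k : ℝ) / (M : ℝ) ^ n)
      = ∫ x : ℝ, ∑ k ∈ Finset.Icc (-L) L, u k
        * (Complex.exp (-Complex.I * (((k : ℝ) / (M : ℝ) ^ n * (2 * Real.pi * x) : ℝ) : ℂ))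
          * h x) := by
    rw [integral_finsetSum _ fun k _ => (hint _).const_mul _,
      (hL.mul_right fun k => g ((k : ℝ) / (M : ℝ) ^ n)).tsum_eq]
    refine Finset.sum_congr rfl fun k _ => ?_
    rw [integral_const_mul, ← hg]
  rw [gridMean, hsum, ← integral_const_mul]
  refine integral_congr_ae (Eventually.of_forall fun x => ?_)
  beta_reduce
  rw [← gridMean_exp a hM, gridMean, (hL.mul_right _).tsum_eq, mul_left_comm]
  congr 1
  rw [Finset.mul_sum]
  refine Finset.sum_congr rfl fun k _ => ?_
  ring

/-- Dominated convergence on the Fourier side: the partial products grow polynomially, uniformly in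
`n`, against a Schwartz function. -/
theorem tendsto_gridMean_phi (hM : 2 ≤ M) (ha : (a.sum fun _ c => c) = 1) (g : 𝓢(ℝ, ℂ)) :
    Tendsto (fun n => gridMean M a n g) atTop (𝓝 (phi hM a ha g)) := by
  obtain ⟨C, N, hC, h⟩ := exists_norm_prod_trigMask_le a hM ha
  simp_rw [phi_apply, gridMean_eq_integral a hM]
  set u : 𝓢(ℝ, ℂ) := 𝓕⁻ g
  refine tendsto_integral_of_dominated_convergence
    (fun x => C * (2 * Real.pi) ^ N * 2 ^ N * (‖x‖ ^ 0 * ‖u x‖ + ‖x‖ ^ N * ‖u x‖))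
    (fun n => ?_) ?_ (fun n => Eventually.of_forall fun x => ?_)
    (Eventually.of_forall fun x => (tendsto_phiHat hM a ha _).const_mul _)
  · refine (u.continuous.mul (continuous_finsetProd _ fun j _ => ?_)).aestronglyMeasurable
    exact (continuous_trigMask a).comp (by fun_prop)
  · exact ((u.integrable_pow_mul volume 0).add (u.integrable_pow_mul volume N)).const_mul _
  · rw [norm_mul, mul_comm]
    have hpi : 1 ≤ 2 * Real.pi := by linarith [Real.pi_gt_three]
    have h1 : 1 + |2 * Real.pi * x| ≤ 2 * Real.pi * (1 + ‖x‖) := by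
      rw [abs_mul, abs_of_pos (by positivity), Real.norm_eq_abs]
      linarith
    have h2 : (1 + ‖x‖) ^ N ≤ 2 ^ N * (1 + ‖x‖ ^ N) := by
      rcases le_total ‖x‖ 1 with hx | hx
      · calc (1 + ‖x‖) ^ N ≤ 2 ^ N := by gcongr; linarith
          _ ≤ _ := le_mul_of_one_le_right (by positivity) (by
            linarith [pow_nonneg (norm_nonneg x) N])
      · calc (1 + ‖x‖) ^ N ≤ (2 * ‖x‖) ^ N := by gcongr; linarith
          _ = 2 ^ N * ‖x‖ ^ N := mul_pow _ _ _
          _ ≤ _ := by gcongr; linarith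
    calc _ ≤ C * (1 + |2 * Real.pi * x|) ^ N * ‖u x‖ := by gcongr; exact h n _
      _ ≤ C * (2 * Real.pi * (1 + ‖x‖)) ^ N * ‖u x‖ := by gcongr
      _ = C * (2 * Real.pi) ^ N * (1 + ‖x‖) ^ N * ‖u x‖ := by rw [mul_pow]; ring
      _ ≤ C * (2 * Real.pi) ^ N * (2 ^ N * (1 + ‖x‖ ^ N)) * ‖u x‖ := by gcongr
      _ = _ := by ring

section RiemannSum

/-- Turns a grid mean into the integral of a step function, to which dominated convergence applies.
-/
theorem integral_comp_floor {L : ℤ} {u : ℤ → ℂ} (hu : SupportedIn L u) {N : ℝ} (hN : 0 < N) :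
    ∫ x : ℝ, u ⌊N * x⌋ = (N : ℂ)⁻¹ * ∑' k, u k := by
  have h1 : ∀ y : ℝ, u ⌊y⌋ = ∑ k ∈ Finset.Icc (-L) L,
      (Set.Ico (k : ℝ) (k + 1)).indicator (fun _ => u k) y := fun y => by
    have h2 : ∀ k : ℤ, (Set.Ico (k : ℝ) (k + 1)).indicator (fun _ => u k) y
        = if ⌊y⌋ = k then u k else 0 := fun k => by
      simp only [Set.indicator_apply, Set.mem_Ico, Int.floor_eq_iff]
    simp_rw [h2]
    rw [Finset.sum_ite_eq]
    split_ifs with h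
    · rfl
    · exact hu.eq_zero_of_notMem h
  rw [Measure.integral_comp_mul_left (fun y => u ⌊y⌋), hu.tsum_eq]
  simp_rw [h1]
  rw [integral_finsetSum]
  · simp_rw [integral_indicator measurableSet_Ico, setIntegral_const]
    rw [abs_of_pos (by positivity)]
    simp [measureReal_def]
  · intro k _
    exact (integrable_indicator_iff measurableSet_Ico).2 (integrableOn_const (by simp))

include hM in
theorem IsLimitFunction.tendsto_gridMean {a : ℤ →₀ ℂ} {m : ℕ} {f : ℝ → ℂ}
    (h : IsLimitFunction M a m dirac f) {g : ℝ → ℂ} (hg : Continuous g) {B : ℝ}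
    (hB : ∀ x, ‖g x‖ ≤ B) :
    Tendsto (fun n => gridMean M a n g) atTop (𝓝 (∫ x, g x * f x)) := by
  obtain ⟨R, hR⟩ := exists_supportedIn a
  have hf0 : ∀ x : ℝ, (R : ℝ) < |x| → f x = 0 := fun x hx => h.eq_zero_of_lt_abs hM hR hx
  obtain ⟨D, hD⟩ : ∃ D, ∀ x, ‖f x‖ ≤ D :=
    h.1.continuous.bounded_above_of_compact_support
      (HasCompactSupport.intro (isCompact_Icc (a := -(R : ℝ)) (b := R)) fun x hx => hf0 x (by
        rwa [Set.mem_Icc, ← abs_le, not_le] at hx))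
  have hsupp : ∀ n, SupportedIn (R * M ^ n) ((sd M a)^[n] dirac) := fun n => by
    simpa using hR.sd_iterate hM (by lia) supportedIn_dirac n
  have hpos : ∀ n, (0 : ℝ) < (M : ℝ) ^ n := fun n => by linarith [one_le_cast_pow hM n]
  have hB0 : 0 ≤ B := (norm_nonneg _).trans (hB 0)
  set F : ℕ → ℝ → ℂ := fun n x => (sd M a)^[n] dirac ⌊(M : ℝ) ^ n * x⌋
    * g ((⌊(M : ℝ) ^ n * x⌋ : ℝ) / (M : ℝ) ^ n) with hF
  have hint : ∀ n, gridMean M a n g = ∫ x, F n x := fun n => by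
    rw [gridMean, integral_comp_floor ((hsupp n).mul_right fun k => g ((k : ℝ) / (M : ℝ) ^ n))
      (hpos n)]
    push_cast
    rfl
  simp_rw [hint]
  refine tendsto_integral_filter_of_dominated_convergence
    -- For large `n` the iterates are within `1` of `f`, whence `D + 1`; replacing `x` by its grid
    -- point moves it by less than one cell, whence `R + 1`.
    ((Set.Icc (-(R + 1 : ℝ)) (R + 1)).indicator fun _ => (D + 1) * B) ?_ ?_ ?_ ?_
  · refine Eventually.of_forall fun n => Measurable.aestronglyMeasurable ?_
    exact (measurable_of_countable
      (fun k : ℤ => (sd M a)^[n] dirac k * g ((k : ℝ) / (M : ℝ) ^ n))).comp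
      (Int.measurable_floor.comp (measurable_const_mul _))
  · filter_upwards [h.isGridLimit (R + 1) (by positivity) 1 one_pos] with n hn
    refine Eventually.of_forall fun x => ?_
    have hx1 := Int.floor_le ((M : ℝ) ^ n * x)
    have hx2 := Int.lt_floor_add_one ((M : ℝ) ^ n * x)
    by_cases hk : (R : ℤ) * (M : ℤ) ^ n < |⌊(M : ℝ) ^ n * x⌋|
    · simp only [hF]
      rw [hsupp n _ hk, zero_mul, norm_zero]
      exact Set.indicator_nonneg (fun _ _ =>
        mul_nonneg (by linarith [(norm_nonneg _).trans (hD 0)]) hB0) x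
    · have hk' : |(⌊(M : ℝ) ^ n * x⌋ : ℝ)| ≤ R * (M : ℝ) ^ n := by exact_mod_cast not_lt.1 hk
      have hx : x ∈ Set.Icc (-(R + 1 : ℝ)) (R + 1) := by
        rw [abs_le] at hk'
        have h1 := one_le_cast_pow hM n
        constructor
        · refine le_of_mul_le_mul_left ?_ (hpos n)
          nlinarith
        · refine le_of_mul_le_mul_left ?_ (hpos n)
          nlinarith
      rw [Set.indicator_of_mem hx, norm_mul]
      have h2 := hn ⌊(M : ℝ) ^ n * x⌋ (by nlinarith [hpos n])
      have h3 := norm_add_le ((sd M a)^[n] dirac ⌊(M : ℝ) ^ n * x⌋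
        - f ((⌊(M : ℝ) ^ n * x⌋ : ℝ) / (M : ℝ) ^ n)) (f ((⌊(M : ℝ) ^ n * x⌋ : ℝ) / (M : ℝ) ^ n))
      rw [sub_add_cancel] at h3
      have h4 := hD ((⌊(M : ℝ) ^ n * x⌋ : ℝ) / (M : ℝ) ^ n)
      exact mul_le_mul (by linarith) (hB _) (norm_nonneg _) (by linarith [norm_nonneg (f 0), hD 0])
  · exact (integrable_indicator_iff measurableSet_Icc).2 (integrableOn_const (by simp))
  · refine Eventually.of_forall fun x => ?_
    rw [mul_comm (g x)]
    exact (h.tendsto hM (tendsto_floor_div hM x)).mul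
      (hg.continuousAt.tendsto.comp (tendsto_floor_div hM x))

include hM in
theorem IsLimitFunction.agreesWith {a : ℤ →₀ ℂ} (ha : (a.sum fun _ c => c) = 1) {m : ℕ}
    {f : ℝ → ℂ} (h : IsLimitFunction M a m dirac f) : AgreesWith (phi hM a ha) f := by
  intro g hg
  obtain ⟨B, hB⟩ := g.continuous.bounded_above_of_compact_support hg
  exact tendsto_nhds_unique (tendsto_gridMean_phi a hM ha g)
    (h.tendsto_gridMean hM g.continuous hB)

end RiemannSum

end DistributionalLimit

/-! ### Support and refinement equation of a continuous `φ`. -/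

section RefinableFunction

open scoped ContDiff

section Distribution

variable {M : ℕ} {a : ℤ →₀ ℂ} {f : ℝ → ℂ}

/-- The discrete form of the refinement equation, with the dilation and the translations moved to
the test function. -/
theorem gridMean_add (hM : 2 ≤ M) {L : ℤ} {p : ℕ} (hL : SupportedIn L ((sd M a)^[p] dirac))
    (n : ℕ) (g : ℝ → ℂ) :
    gridMean M a (n + p) g = ((M : ℂ) ^ p)⁻¹ * ∑ k ∈ Finset.Icc (-L) L, (sd M a)^[p] dirac k
      * gridMean M a n fun x => g ((x + k) / (M : ℝ) ^ p) := by
  obtain ⟨L', hL'⟩ := exists_supportedIn_sd_iterate hM a supportedIn_dirac n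
  have hpos : ∀ n, (0 : ℝ) < (M : ℝ) ^ n := fun n => by linarith [one_le_cast_pow hM n]
  set u := (sd M a)^[p] dirac
  set v := (sd M a)^[n] dirac with hv
  have hterm : ∀ k j : ℤ, u k * v (j + (M : ℤ) ^ n * k - (M : ℤ) ^ n * k)
      * g (((j + (M : ℤ) ^ n * k : ℤ) : ℝ) / (M : ℝ) ^ (n + p))
      = u k * (v j * g (((j : ℝ) / (M : ℝ) ^ n + k) / (M : ℝ) ^ p)) := fun k j => by
    rw [add_sub_cancel_right, mul_assoc]
    congr 3
    have := hpos n
    have := hpos p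
    push_cast
    rw [pow_add]
    field_simp
  have hsum : ∀ k : ℤ, Summable fun j : ℤ => v j * g (((j : ℝ) / (M : ℝ) ^ n + k) / (M : ℝ) ^ p) :=
    fun k => (hL'.mul_right fun j : ℤ => g (((j : ℝ) / (M : ℝ) ^ n + k) / (M : ℝ) ^ p)).summable
  have hsum' : ∀ k : ℤ, Summable fun j : ℤ => u k * v (j - (M : ℤ) ^ n * k)
      * g ((j : ℝ) / (M : ℝ) ^ (n + p)) := fun k => by
    rw [← (Equiv.addRight ((M : ℤ) ^ n * k)).summable_iff]
    exact ((hsum k).mul_left (u k)).congr fun j => (hterm k j).symm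
  have h1 : ∀ j : ℤ, (sd M a)^[n + p] dirac j * g ((j : ℝ) / (M : ℝ) ^ (n + p))
      = ∑ k ∈ Finset.Icc (-L) L, u k * v (j - (M : ℤ) ^ n * k)
        * g ((j : ℝ) / (M : ℝ) ^ (n + p)) := fun j => by
    rw [Function.iterate_add_apply, sd_iterate_apply hM,
      (hL.mul_right fun k => v (j - (M : ℤ) ^ n * k)).tsum_eq, Finset.sum_mul]
  unfold gridMean
  simp_rw [h1]
  rw [Summable.tsum_finsetSum fun k _ => hsum' k, pow_add, mul_inv, mul_comm ((M : ℂ) ^ n)⁻¹,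
    mul_assoc, Finset.mul_sum]
  congr 1
  refine Finset.sum_congr rfl fun k _ => ?_
  rw [← (Equiv.addRight ((M : ℤ) ^ n * k)).tsum_eq, ← hv, mul_left_comm]
  congr 1
  rw [← tsum_mul_left]
  exact tsum_congr fun j => hterm k j

namespace AgreesWith

variable {hM : 2 ≤ M} {ha : (a.sum fun _ c => c) = 1}

theorem tendsto_gridMean (h : AgreesWith (phi hM a ha) f) {g : ℝ → ℂ} (hg : ContDiff ℝ ∞ g)
    (hgc : HasCompactSupport g) :
    Tendsto (fun n => gridMean M a n g) atTop (𝓝 (∫ x, g x * f x)) := by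
  have h1 := tendsto_gridMean_phi a hM ha (hgc.toSchwartzMap hg)
  rwa [h _ hgc] at h1

/-- The refinable distribution is supported in `[-R, R]` if the mask is. -/
theorem eq_zero_of_lt_abs (h : AgreesWith (phi hM a ha) f) (hf : Continuous f) {R : ℕ}
    (hR : SupportedIn R a) {x : ℝ} (hx : (R : ℝ) < |x|) : f x = 0 := by
  set U : Set ℝ := {x | (R : ℝ) < |x|} with hU
  have hUo : IsOpen U := isOpen_lt continuous_const continuous_abs
  have hae : ∀ᵐ x, x ∈ U → f x = 0 := by
    refine hUo.ae_eq_zero_of_integral_contDiff_smul_eq_zero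
      (hf.locallyIntegrable.locallyIntegrableOn U) fun g hg hgc hgU => ?_
    have h1 := h.tendsto_gridMean (g := fun x => (g x : ℂ)) (Complex.ofRealCLM.contDiff.comp hg)
      (hgc.comp_left (g := Complex.ofReal) rfl)
    -- At every level the iterates live on grid points in `[-R, R]`, where the test function
    -- vanishes.
    have h2 : ∀ n, gridMean M a n (fun x => (g x : ℂ)) = 0 := fun n => by
      have hpos : (0 : ℝ) < (M : ℝ) ^ n := by linarith [one_le_cast_pow hM n]
      have hs := hR.sd_iterate hM (by lia) supportedIn_dirac n
      have h3 : ∀ k : ℤ, (sd M a)^[n] dirac k * (g ((k : ℝ) / (M : ℝ) ^ n) : ℂ) = 0 := fun k => by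
        by_cases hk : (k : ℝ) / (M : ℝ) ^ n ∈ U
        · rw [hs k, zero_mul]
          rw [hU, Set.mem_ofPred_eq, abs_div, abs_of_pos hpos, lt_div_iff₀ hpos] at hk
          rw [add_zero]
          exact_mod_cast hk
        · rw [image_eq_zero_of_notMem_tsupport fun h => hk (hgU h), Complex.ofReal_zero, mul_zero]
      simp [gridMean, h3]
    simp_rw [h2] at h1
    simp_rw [Complex.real_smul]
    exact tendsto_nhds_unique h1 tendsto_const_nhds
  exact Measure.eqOn_open_of_ae_eq (μ := volume) (g := fun _ => 0)
    ((ae_restrict_iff' hUo.measurableSet).2 hae) hUo hf.continuousOn continuousOn_const hx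

/-- The refinement equation. -/
theorem refinement (h : AgreesWith (phi hM a ha) f) (hf : Continuous f) (p : ℕ) (x : ℝ) :
    f x = ∑' k : ℤ, (sd M a)^[p] dirac k * f ((M : ℝ) ^ p * x - k) := by
  obtain ⟨L, hL⟩ := exists_supportedIn_sd_iterate hM a supportedIn_dirac p
  have hpos : (0 : ℝ) < (M : ℝ) ^ p := by linarith [one_le_cast_pow hM p]
  rw [(hL.mul_right fun k => f ((M : ℝ) ^ p * x - k)).tsum_eq]
  set u := (sd M a)^[p] dirac
  have hf' : Continuous fun x : ℝ => ∑ k ∈ Finset.Icc (-L) L, u k * f ((M : ℝ) ^ p * x - k) := by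
    fun_prop
  refine congrFun ((Continuous.ae_eq_iff_eq volume hf hf').1
    (ae_eq_of_integral_contDiff_smul_eq hf.locallyIntegrable hf'.locallyIntegrable
      fun g hg hgc => ?_)) x
  have hG : ContDiff ℝ ∞ fun x => (g x : ℂ) := Complex.ofRealCLM.contDiff.comp hg
  have hGc : HasCompactSupport fun x => (g x : ℂ) := hgc.comp_left (g := Complex.ofReal) rfl
  have hscale : ∀ k : ℤ, ∫ x : ℝ, (g ((x + k) / (M : ℝ) ^ p) : ℂ) * f x
      = (M : ℂ) ^ p * ∫ x : ℝ, (g x : ℂ) * f ((M : ℝ) ^ p * x - k) := fun k => by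
    have h1 := Measure.integral_comp_div
      (fun y : ℝ => (g y : ℂ) * f ((M : ℝ) ^ p * y - k)) ((M : ℝ) ^ p)
    rw [← integral_add_right_eq_self _ (k : ℝ), abs_of_pos hpos, Complex.real_smul] at h1
    push_cast at h1
    rw [← h1]
    refine integral_congr_ae (Eventually.of_forall fun x => ?_)
    beta_reduce
    rw [mul_div_cancel₀ _ hpos.ne', add_sub_cancel_right]
  -- The limit `n → ∞` is taken in `gridMean_add`; the change of variables `hscale` then moves
  -- dilation and translation from the test function to `f`.
  have hlim : Tendsto (fun n => gridMean M a (n + p) fun x => (g x : ℂ)) atTop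
      (𝓝 (((M : ℂ) ^ p)⁻¹ * ∑ k ∈ Finset.Icc (-L) L,
        u k * ∫ x : ℝ, (g ((x + k) / (M : ℝ) ^ p) : ℂ) * f x)) := by
    simp_rw [gridMean_add hM hL]
    refine (tendsto_finsetSum _ fun k _ => Tendsto.const_mul _ ?_).const_mul _
    refine h.tendsto_gridMean (hG.comp ((contDiff_id.add contDiff_const).div_const _)) ?_
    simp_rw [div_eq_mul_inv]
    exact hGc.comp_homeomorph
      ((Homeomorph.addRight (k : ℝ)).trans (Homeomorph.mulRight₀ _ (inv_ne_zero hpos.ne')))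
  have h1 := tendsto_nhds_unique
    ((h.tendsto_gridMean hG hGc).comp (tendsto_add_atTop_nat p)) hlim
  simp_rw [Complex.real_smul]
  rw [h1]
  simp_rw [hscale, Finset.mul_sum]
  rw [integral_finsetSum]
  · refine Finset.sum_congr rfl fun k _ => ?_
    simp_rw [mul_left_comm _ (u k)]
    rw [integral_const_mul, inv_mul_cancel_left₀]
    exact_mod_cast hpos.ne'
  · intro k _
    have hc : Continuous fun x : ℝ => (g x : ℂ) * (u k * f ((M : ℝ) ^ p * x - k)) :=
      hG.continuous.mul (by fun_prop)
    exact hc.integrable_of_hasCompactSupport hGc.mul_right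

/-- Refinement and interpolation make every iterate a sample of `f`, so smoothness of `f` alone
yields convergence. -/
theorem isLimitFunction {m : ℕ} (h : AgreesWith (phi hM a ha) f) (hf : ContDiff ℝ m f) {s : ℝ}
    (hs : ∀ k : ℤ, f (s + k) = dirac k) : IsLimitFunction M a m dirac f := by
  obtain ⟨R, hR⟩ := exists_supportedIn a
  exact isLimitFunction_of_sample hM (fun x hx => h.eq_zero_of_lt_abs hf.continuous hR hx) hf
    fun n j => sd_iterate_dirac_eq hs hM (h.refinement hf.continuous n) j

end AgreesWith

end Distribution

end RefinableFunction

/-! ### Subdivision of polynomial data. -/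

section PolynomialReproduction

section PolynomialSequences

open Polynomial

theorem degree_comp_linear_lt {p : ℂ[X]} {J : ℕ} (hp : p.degree < J) (b c : ℂ) :
    (p.comp (C b * X + C c)).degree < J := by
  rcases eq_or_ne p 0 with rfl | h0
  · simp
  refine degree_le_natDegree.trans_lt (Nat.cast_lt.2 ?_)
  calc (p.comp (C b * X + C c)).natDegree
      ≤ p.natDegree * (C b * X + C c).natDegree := natDegree_comp_le
    _ ≤ p.natDegree * 1 := by gcongr; exact natDegree_linear_le
    _ < J := by rwa [mul_one, natDegree_lt_iff_degree_lt h0]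

theorem nabla_iterate_comp_cast (g : ℂ → ℂ) (i : ℕ) (j : ℤ) :
    nabla^[i] (fun k : ℤ => g k) j = (fwdDiff 1)^[i] g ((j : ℂ) - i) := by
  induction i generalizing j with
  | zero => simp
  | succ i ih =>
    rw [Function.iterate_succ_apply', Function.iterate_succ_apply', nabla, ih, ih, fwdDiff]
    have h1 : (j : ℂ) - (i + 1 : ℕ) + 1 = j - i := by
      push_cast
      ring
    have h2 : ((j - 1 : ℤ) : ℂ) - i = j - (i + 1 : ℕ) := by
      push_cast
      ring
    rw [h1, h2]

theorem nabla_iterate_polynomial {p : ℂ[X]} {J : ℕ} (hp : p.degree < J) :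
    nabla^[J] (fun k : ℤ => p.eval (k : ℂ)) = 0 := by
  funext j
  rw [nabla_iterate_comp_cast fun x => p.eval x]
  -- The zero polynomial is treated apart because it has degree below `J = 0` while its `natDegree`
  -- is `0`.
  rcases eq_or_ne p 0 with rfl | h0
  · rcases J.eq_zero_or_pos with rfl | hJ
    · simp
    · exact congrFun (fwdDiff_iter_eq_zero_of_degree_lt (P := (0 : ℂ[X])) (by simpa using hJ)) _
  · exact congrFun (fwdDiff_iter_eq_zero_of_degree_lt ((natDegree_lt_iff_degree_lt h0).2 hp)) _

theorem nabla_iterate_sub (u v : ℤ → ℂ) (i : ℕ) :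
    nabla^[i] (u - v) = nabla^[i] u - nabla^[i] v := by
  induction i generalizing u v with
  | zero => rfl
  | succ i ih =>
    have h : nabla (u - v) = nabla u - nabla v := by
      funext j
      simp only [nabla, Pi.sub_apply]
      ring
    simp only [Function.iterate_succ_apply, h, ih]

theorem eq_zero_of_nabla_iterate_eq_zero {v : ℤ → ℂ} {J : ℕ} (h : nabla^[J] v = 0) {b : ℤ}
    (hb : ∀ i : ℕ, i < J → v (b + i) = 0) : v = 0 := by
  induction J generalizing v b with
  | zero => exact h
  | succ J ih =>
    have h1 : nabla v = 0 := by
      refine ih (b := b + 1) h fun i hi => ?_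
      have h2 := hb (i + 1) (by lia)
      have h3 := hb i (by lia)
      rw [nabla, add_assoc, add_comm 1, add_sub_assoc, add_sub_cancel_right, h3, sub_zero]
      exact_mod_cast h2
    funext k
    rw [eq_const_of_nabla_eq_zero (fun k => congrFun h1 k) k b]
    simpa using hb 0 (by lia)

theorem eval_eq_sum_lagrange_basis {q : ℂ[X]} {J : ℕ} (hq : q.degree < J) (t : ℂ) :
    q.eval t = ∑ i ∈ Finset.range J, q.eval (i : ℂ)
      * (Lagrange.basis (Finset.range J) (fun i : ℕ => (i : ℂ)) i).eval t := by
  have hinj : Set.InjOn (fun i : ℕ => (i : ℂ)) (Finset.range J) := Nat.cast_injective.injOn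
  have hq' : q.degree < (Finset.range J).card := by rwa [Finset.card_range]
  conv_lhs => rw [Lagrange.eq_interpolate hinj hq', Lagrange.interpolate_apply, eval_finsetSum]
  simp only [eval_mul, eval_C]

/-- Sequences annihilated by `∇ ^ J` are polynomial sequences. -/
theorem exists_polynomial_of_nabla_iterate_eq_zero {v : ℤ → ℂ} {J : ℕ} (h : nabla^[J] v = 0) :
    ∃ q : ℂ[X], q.degree < J ∧ ∀ k : ℤ, v k = q.eval (k : ℂ) := by
  have hinj : Set.InjOn (fun i : ℕ => (i : ℂ)) (Finset.range J) := Nat.cast_injective.injOn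
  have hdeg := Lagrange.degree_interpolate_lt (fun i : ℕ => v i) hinj
  rw [Finset.card_range] at hdeg
  refine ⟨_, hdeg, fun k => ?_⟩
  refine sub_eq_zero.1 (congrFun (eq_zero_of_nabla_iterate_eq_zero (J := J) (b := 0)
    (v := v - fun k : ℤ => eval (k : ℂ) (Lagrange.interpolate _ _ _)) ?_ fun i hi => ?_) k)
  · rw [nabla_iterate_sub, h, nabla_iterate_polynomial hdeg, sub_zero]
  · have h2 := Lagrange.eval_interpolate_at_node (fun i : ℕ => v i) hinj (Finset.mem_range.2 hi)
    rw [Pi.sub_apply, zero_add, Int.cast_natCast, h2, sub_self]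

variable {M : ℕ} {s : ℝ}

/-- A continuous function that is polynomial of degree less than `J` on the grids
`M ^ (-n) (s + ℤ)` and vanishes on `s + ℤ` is zero. -/
theorem eq_zero_of_polynomial_on_grids (hM : 2 ≤ M) {e : ℝ → ℂ} (he : Continuous e) {J : ℕ}
    (hgrid : ∀ n : ℕ, ∃ r : ℂ[X], r.degree < J ∧
      ∀ k : ℤ, e ((s + k) / (M : ℝ) ^ n) = r.eval (k : ℂ))
    (h0 : ∀ k : ℤ, e (s + k) = 0) (x : ℝ) : e x = 0 := by
  choose r hr hre using hgrid
  have hpos : ∀ n, (0 : ℝ) < (M : ℝ) ^ n := fun n => by linarith [one_le_cast_pow hM n]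
  have hlim : ∀ y : ℝ, Tendsto (fun n : ℕ => (s + (⌊(M : ℝ) ^ n * y⌋ : ℝ)) / (M : ℝ) ^ n) atTop
      (𝓝 y) := fun y => by
    have h1 := ((tendsto_inv_cast_pow hM).const_mul s).add (tendsto_floor_div hM y)
    rw [mul_zero, zero_add] at h1
    refine h1.congr fun n => ?_
    rw [add_div, div_eq_mul_inv s]
  set κ : ℕ → ℤ := fun n => ⌊(M : ℝ) ^ n * s⌋ with hκ
  set l : ℕ → ℤ := fun n => ⌊(M : ℝ) ^ n * x⌋ with hl
  set t : ℕ → ℝ := fun n => (s + l n) / (M : ℝ) ^ n - (s + κ n) / (M : ℝ) ^ n with ht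
  -- The points `(s + κ n) / M ^ n + i` with `i < J` lie on the same grid, so Lagrange interpolation
  -- from them recovers `e` at the grid point near `x`. As `n` grows they tend to `s + i`, where `e`
  -- vanishes, while the weights converge.
  have key : ∀ n, e ((s + l n) / (M : ℝ) ^ n) = ∑ i ∈ Finset.range J,
      e ((s + κ n) / (M : ℝ) ^ n + i)
        * (Lagrange.basis (Finset.range J) (fun i : ℕ => (i : ℂ)) i).eval (t n : ℂ) := fun n => by
    have hM0 : (M : ℂ) ^ n ≠ 0 := by exact_mod_cast (hpos n).ne'
    have hM0' := (hpos n).ne'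
    have h1 := eval_eq_sum_lagrange_basis
      (degree_comp_linear_lt (hr n) ((M : ℂ) ^ n) (κ n : ℂ)) (t n : ℂ)
    simp only [eval_comp, eval_add, eval_mul, eval_C, eval_X] at h1
    have h2 : (M : ℂ) ^ n * (t n : ℂ) + (κ n : ℂ) = (l n : ℂ) := by
      simp only [ht]
      push_cast
      field_simp
      ring
    rw [hre n (l n), ← h2, h1]
    refine Finset.sum_congr rfl fun i _ => ?_
    have h3 := hre n (κ n + (M : ℤ) ^ n * i)
    have h4 : (s + ((κ n + (M : ℤ) ^ n * i : ℤ) : ℝ)) / (M : ℝ) ^ n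
        = (s + κ n) / (M : ℝ) ^ n + i := by
      push_cast
      field_simp
      ring
    rw [← h4, h3]
    push_cast
    rw [add_comm (κ n : ℂ)]
  have hx := (he.tendsto x).comp (hlim x)
  have ht' : Tendsto t atTop (𝓝 (x - s)) := (hlim x).sub (hlim s)
  have hsum : Tendsto (fun n => ∑ i ∈ Finset.range J,
      e ((s + κ n) / (M : ℝ) ^ n + i)
        * (Lagrange.basis (Finset.range J) (fun i : ℕ => (i : ℂ)) i).eval (t n : ℂ)) atTop
      (𝓝 (∑ i ∈ Finset.range J, e (s + i)
        * (Lagrange.basis (Finset.range J) (fun i : ℕ => (i : ℂ)) i).eval ((x - s : ℝ) : ℂ))) := by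
    refine tendsto_finsetSum _ fun i _ => Tendsto.mul ?_ ?_
    · exact (he.tendsto _).comp ((hlim s).add_const (i : ℝ))
    · exact ((Polynomial.continuous _).comp Complex.continuous_ofReal).tendsto _ |>.comp ht'
  have h1 := tendsto_nhds_unique (hx.congr key) hsum
  rw [h1]
  refine Finset.sum_eq_zero fun i _ => ?_
  have h2 := h0 i
  rw [Int.cast_natCast] at h2
  rw [h2, zero_mul]

variable {a : ℤ →₀ ℂ} {m : ℕ} {f : ℝ → ℂ}

/-- The limit function samples `S^n p` on the grid `M ^ (-n) (s + ℤ)`. The sum rules give `∇^J S^n p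
= 0`, so these samples are polynomial, and on `s + ℤ` the limit function agrees with `p (x - s)`.
Hence it equals `p (x - s)` everywhere. -/
theorem sd_iterate_polynomial (hM : 2 ≤ M) (h : IsLimitFunction M a m dirac f)
    (hs : ∀ k : ℤ, f (s + k) = dirac k) {J : ℕ} (hJ : ∃ c, a = (nbox M)^[J] c) {p : ℂ[X]}
    (hp : p.degree < J) (n : ℕ) (k : ℤ) :
    (sd M a)^[n] (fun j : ℤ => p.eval (j : ℂ)) k
      = p.eval (((M : ℂ) ^ n)⁻¹ * ((s : ℂ) + (k : ℂ)) - (s : ℂ)) := by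
  obtain ⟨c, hc⟩ := hJ
  set v : ℤ → ℂ := fun j => p.eval (j : ℂ) with hv
  have hsample : ∀ (n : ℕ) (j : ℤ),
      (sd M a)^[n] v j = superposition v f ((s + j) / (M : ℝ) ^ n) := fun n j =>
    sd_iterate_eq_superposition hM (fun j => sd_iterate_dirac_eq hs hM (h.refinement hM n) j) v j
  have hη := (h.superposition hM v).1.continuous
  have key := eq_zero_of_polynomial_on_grids (s := s) hM (J := J)
    (e := fun x => superposition v f x - p.eval ((x : ℂ) - s))
    (hη.sub (p.continuous.comp (by fun_prop))) (fun n => ?_) (fun k => ?_)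
    ((s + k) / (M : ℝ) ^ n)
  · rw [hsample, sub_eq_zero.1 key]
    push_cast
    rw [div_eq_inv_mul]
  · have h0 : nabla^[J] ((sd M a)^[n] v) = 0 := by
      funext j
      have h1 := nabla_iterate_sd_iterate_nbox hM J c n v j
      rw [nabla_iterate_polynomial hp, ← hc] at h1
      have h2 : (sd M c)^[n] 0 j = 0 := by
        rw [sd_iterate_apply hM]
        simp
      rw [h2] at h1
      exact (mul_eq_zero.1 h1).resolve_left
        (pow_ne_zero _ (by exact_mod_cast (by lia : M ≠ 0)))
    obtain ⟨q, hq, hqe⟩ := exists_polynomial_of_nabla_iterate_eq_zero h0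
    refine ⟨q - p.comp (C ((M : ℂ) ^ n)⁻¹ * X + C (((M : ℂ) ^ n)⁻¹ * s - s)),
      (degree_sub_le _ _).trans_lt (max_lt hq (degree_comp_linear_lt hp _ _)), fun k => ?_⟩
    rw [← hsample, hqe, eval_sub, eval_comp]
    congr 2
    simp only [eval_add, eval_mul, eval_C, eval_X]
    push_cast
    ring
  · rw [superposition_add_int hs, hv]
    push_cast
    rw [add_sub_cancel_left, sub_self]

end PolynomialSequences

end PolynomialReproduction

/-! ### Assembling the equivalences. -/

section Equivalences

section Equivalence

variable {M : ℕ} {a : ℤ →₀ ℂ} {m : ℕ} {f : ℝ → ℂ} {s : ℝ}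

theorem IsLimitFunction.isInftyStepInterpolatory (hM : 2 ≤ M) (h : IsLimitFunction M a m dirac f)
    (hs : ∀ k : ℤ, f (s + k) = dirac k) : IsInftyStepInterpolatory M a m s := by
  intro v η hη k
  rw [hη.unique hM (h.superposition hM v), superposition_add_int hs]

theorem ne_zero_of_sum_eq_one (ha : (a.sum fun _ c => c) = 1) : a ≠ 0 := by
  rintro rfl
  simp at ha

theorem IsLimitFunction.lt_smInfty (hM : 2 ≤ M) (ha : (a.sum fun _ c => c) = 1)
    (h : IsLimitFunction M a m dirac f) (hne : ∃ x, f x ≠ 0) : (m : ℝ) < smInfty M a := by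
  have ha0 := ne_zero_of_sum_eq_one ha
  obtain ⟨c, hc⟩ := exists_eq_nbox_iterate_sr hM ha0
  exact (lt_smInfty_iff hM ha m).2
    (h.rhoInfty_lt hM (le_sr hM ha0 (h.exists_nbox_iterate hM hne le_rfl)) hc)

theorem sd_one_eq_one (hM : 2 ≤ M) (ha : (a.sum fun _ c => c) = 1) (h : 1 ≤ sr M a) (j : ℤ) :
    sd M a (fun _ => 1) j = 1 := by
  obtain ⟨c, rfl⟩ := exists_nbox_iterate_of_le h
    (exists_eq_nbox_iterate_sr hM (ne_zero_of_sum_eq_one ha))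
  rw [sum_nbox_iterate hM] at ha
  exact sd_nbox_one hM ha j

theorem exists_isLimitFunction_of_lt_smInfty (hM : 2 ≤ M) (ha : (a.sum fun _ c => c) = 1)
    (hm : (m : ℝ) < smInfty M a) {ms ns : ℕ} (hns : 1 ≤ ns) {γ : ℤ}
    (hγ : (M : ℝ) ^ ms * ((M : ℝ) ^ ns - 1) * s = (γ : ℝ)) {w : ℤ →₀ ℂ}
    (hi : ∀ k : ℤ, conv (iterMask M a ms) w ((M : ℤ) ^ ms * k) = ((M : ℂ) ^ ms)⁻¹ * dirac k)
    (hii : ∀ k : ℤ, conv (iterMask M a ns) w (γ + (M : ℤ) ^ ns * k) = ((M : ℂ) ^ ns)⁻¹ * w k) :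
    ∃ f : ℝ → ℂ, IsLimitFunction M a m dirac f ∧ ∀ k : ℤ, f (s + k) = dirac k := by
  rw [lt_smInfty_iff hM ha] at hm
  have hsr := lt_sr_of_rhoInfty_lt hM ha hm
  obtain ⟨f, hf⟩ := exists_isLimitFunction_dirac hM ha hsr
    (exists_eq_nbox_iterate_sr hM (ne_zero_of_sum_eq_one ha)) hm
  exact ⟨f, hf, limit_add_int_eq_dirac hM hns hγ hf (sd_one_eq_one hM ha (by lia)) hi hii⟩

theorem exists_isLimitFunction_of_isInftyStepInterpolatory (h : IsCmConvergent M a m)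
    (hs : IsInftyStepInterpolatory M a m s) :
    ∃ f : ℝ → ℂ, IsLimitFunction M a m dirac f ∧ ∀ k : ℤ, f (s + k) = dirac k := by
  obtain ⟨f, hf⟩ := h dirac
  exact ⟨f, hf, hs dirac f hf⟩

theorem conv_dirac_left (w : ℤ → ℂ) : conv dirac w = w := by
  funext j
  rw [conv, tsum_eq_single 0 fun k hk => by simp [dirac, hk]]
  simp [dirac]

theorem conv_dirac_right (w : ℤ → ℂ) : conv w dirac = w := by
  funext j
  rw [conv_comm]
  exact congrFun (conv_dirac_left w) j

theorem iterMask_zero : iterMask M a 0 = dirac := by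
  funext k
  simp [iterMask]

/-- The shift satisfies `(s + γ + M ^ n * k) / M ^ n = s + k`, so this entry of `S^n v` is the value
of the limit function at `s + k`. -/
theorem IsLimitFunction.sd_iterate_eq_of_shift (hM : 2 ≤ M) (h : IsLimitFunction M a m dirac f)
    (hs : ∀ k : ℤ, f (s + k) = dirac k) {n : ℕ} {γ : ℤ}
    (hγ : ((M : ℝ) ^ n - 1) * s = (γ : ℝ)) (v : ℤ → ℂ) (k : ℤ) :
    (sd M a)^[n] v (γ + (M : ℤ) ^ n * k) = v k := by
  have hpos : (0 : ℝ) < (M : ℝ) ^ n := by linarith [one_le_cast_pow hM n]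
  rw [sd_iterate_eq_superposition hM (fun j => sd_iterate_dirac_eq hs hM (h.refinement hM n) j),
    ← superposition_add_int hs v k]
  congr 1
  push_cast
  rw [← hγ]
  field_simp
  ring

end Equivalence

end Equivalences

end SubdivisionScheme

theorem theorem1p1 (M : ℕ) (hM : 2 ≤ M) (m : ℕ) (a : ℤ →₀ ℂ) (ha : (a.sum fun _ c => c) = 1)
    (s : ℝ) (ms ns : ℕ) (hns : 1 ≤ ns) (γ : ℤ)
    (hγ : (M : ℝ) ^ ms * ((M : ℝ) ^ ns - 1) * s = (γ : ℝ)) :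
    -- the equivalence of the three statements
    List.TFAE [
      ∃ f : ℝ → ℂ, ContDiff ℝ m f ∧ AgreesWith (phi hM a ha) f ∧
        ∀ k : ℤ, f (s + k) = dirac k,
      (m : ℝ) < smInfty M a ∧ ∃ w : ℤ →₀ ℂ,
        (∀ k : ℤ, conv (iterMask M a ms) w ((M : ℤ) ^ ms * k) = ((M : ℂ) ^ ms)⁻¹ * dirac k) ∧
        (∀ k : ℤ, conv (iterMask M a ns) w (γ + (M : ℤ) ^ ns * k) = ((M : ℂ) ^ ns)⁻¹ * w k),
      IsCmConvergent M a m ∧ IsInftyStepInterpolatory M a m s] ∧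
    -- the case `ms = 0` of the second statement
    (ms = 0 →
      (∀ w : ℤ →₀ ℂ,
        (∀ k : ℤ, conv (iterMask M a ms) w ((M : ℤ) ^ ms * k) = ((M : ℂ) ^ ms)⁻¹ * dirac k) ↔
          ∀ k : ℤ, w k = dirac k) ∧
      ((∃ w : ℤ →₀ ℂ,
        (∀ k : ℤ, conv (iterMask M a ms) w ((M : ℤ) ^ ms * k) = ((M : ℂ) ^ ms)⁻¹ * dirac k) ∧
        (∀ k : ℤ, conv (iterMask M a ns) w (γ + (M : ℤ) ^ ns * k) = ((M : ℂ) ^ ns)⁻¹ * w k)) ↔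
        ∀ k : ℤ, iterMask M a ns (γ + (M : ℤ) ^ ns * k) = ((M : ℂ) ^ ns)⁻¹ * dirac k)) ∧
    -- the case `ms = 0` of the third statement: interpolation after every `ns` steps
    (ms = 0 → IsCmConvergent M a m → IsInftyStepInterpolatory M a m s →
      ∀ v : ℤ → ℂ,
        (∀ k : ℤ, ((sd M a)^[ns] v) (γ + (M : ℤ) ^ ns * k) = v k) ∧
        ∀ (q : ℕ) (k : ℤ), ((sd M a)^[q * ns] v)
          ((∑ i ∈ Finset.range q, (M : ℤ) ^ (i * ns)) * γ + (M : ℤ) ^ (q * ns) * k) = v k) ∧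
    -- the polynomial-interpolation property (by the equivalence, from any of the statements)
    (IsCmConvergent M a m → IsInftyStepInterpolatory M a m s →
      ∀ n : ℕ, 1 ≤ n → ∀ p : Polynomial ℂ, p.degree < (sr M a : WithBot ℕ) → ∀ k : ℤ,
        ((sd M a)^[n] fun j : ℤ => p.eval (j : ℂ)) k
          = p.eval (((M : ℂ) ^ n)⁻¹ * ((s : ℂ) + (k : ℂ)) - (s : ℂ))) := by
  refine ⟨?_, ?_, ?_, ?_⟩
  · tfae_have 1 → 3 := by
      rintro ⟨f, hf, hφ, hs⟩
      have h := hφ.isLimitFunction hf hs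
      exact ⟨isCmConvergent_of_dirac hM h, h.isInftyStepInterpolatory hM hs⟩
    tfae_have 3 → 1 := by
      rintro ⟨h, hs⟩
      obtain ⟨f, hf, hfs⟩ := exists_isLimitFunction_of_isInftyStepInterpolatory h hs
      exact ⟨f, hf.1, hf.agreesWith hM ha, hfs⟩
    tfae_have 3 → 2 := by
      rintro ⟨h, hs⟩
      obtain ⟨f, hf, hfs⟩ := exists_isLimitFunction_of_isInftyStepInterpolatory h hs
      -- The limit function is nonzero because it takes the value `1` at `s`.
      refine ⟨hf.lt_smInfty hM ha ⟨s + (0 : ℤ), ?_⟩, exists_conv_iterMask_eq hM hγ hf hfs⟩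
      rw [hfs]
      simp [dirac]
    tfae_have 2 → 3 := by
      rintro ⟨hm, w, hi, hii⟩
      obtain ⟨f, hf, hfs⟩ := exists_isLimitFunction_of_lt_smInfty hM ha hm hns hγ hi hii
      exact ⟨isCmConvergent_of_dirac hM hf, hf.isInftyStepInterpolatory hM hfs⟩
    tfae_finish
  · rintro rfl
    have h1 : ∀ w : ℤ →₀ ℂ, (∀ k : ℤ, conv (iterMask M a 0) w ((M : ℤ) ^ 0 * k)
        = ((M : ℂ) ^ 0)⁻¹ * dirac k) ↔ ∀ k : ℤ, w k = dirac k := fun w => by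
      simp [iterMask_zero, conv_dirac_left]
    refine ⟨h1, ?_, fun h => ?_⟩
    · rintro ⟨w, hi, hii⟩ k
      have hw : (w : ℤ → ℂ) = dirac := funext ((h1 w).1 hi)
      simpa only [hw, conv_dirac_right] using hii k
    · have hw : (Finsupp.ofSupportFinite dirac supportedIn_dirac.finite_support : ℤ → ℂ) = dirac :=
        Finsupp.ofSupportFinite_coe
      refine ⟨_, (h1 _).2 (congrFun hw), fun k => ?_⟩
      rw [hw, conv_dirac_right, h]
  · rintro rfl h hs v
    obtain ⟨f, hf, hfs⟩ := exists_isLimitFunction_of_isInftyStepInterpolatory h hs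
    -- The statement for `q` blocks is the same shift identity with `n = q * ns`; no induction on
    -- `q` is needed.
    refine ⟨hf.sd_iterate_eq_of_shift hM hfs (by simpa using hγ) v, fun q =>
      hf.sd_iterate_eq_of_shift hM hfs ?_ v⟩
    rw [geom_sum_mul_shift hγ, pow_zero, one_mul]
  · intro h hs n _ p hp k
    obtain ⟨f, hf, hfs⟩ := exists_isLimitFunction_of_isInftyStepInterpolatory h hs
    exact sd_iterate_polynomial hM hf hfs
      (exists_eq_nbox_iterate_sr hM (ne_zero_of_sum_eq_one ha)) hp n k
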